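/- **Setting.** Let $d\in\{2,3\}$, $\Omega\subset\mathbb R^d$ open and bounded, $\mathbb S\subset\mathbb R^d$ the unit sphere with its surface measure, $\mathbb E=[E_{\min},E_{\max}]$ with $0\le E_{\min}<E_{\max}$, and $\mathcal D=\Omega\times\mathbb S\times\mathbb E$. Let $\alpha(x,E)\ge0$ be an integrable absorption cross-section, $\theta(x,\mu'\cdot\mu,E'\to E)\ge0$ a scattering kernel that is integrable in $(x,\mu',E',\mu,E)$, $f\in L_1(\mathcal D)$, and $g_D$ boundary data with $|\mu\cdot n|g_D$ integrable on the inflow boundary. Put $$S[w](x,\mu,E)=\int_{\mathbb E}\int_{\mathbb S}\theta(x,\mu'\cdot\mu,E'\to E)\,w(x,\mu',E')\,d\mu'dE',$$ $$\beta(x,E)=\int_{\mathbb E}\int_{\mathbb S}\theta(x,\mu\cdot\mu',E\to E')\,d\mu'dE',\quad \gamma(x,E)=\int_{\mathbb E}\int_{\mathbb S}\theta(x,\mu'\cdot\mu,E'\to E)\,d\mu'dE',\quad \overline\alpha=\alpha+\tfrac12(\beta-\gamma),$$ and assume $\overline\alpha\ge\alpha_0$ for a constant $\alpha_0>0$. **Discretisation.**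 Let $\mathcal T_\Omega$ be a finite subdivision of $\Omega$ into disjoint open (not necessarily convex) polytopes $\kappa_\Omega$ with outward unit normals $n$; let $\mathcal T_{\mathbb S}$ be a cube-sphere mesh, i.e. the radial projection onto $\mathbb S$ of a mesh of the surface of $[-1,1]^d$ by axis-parallel tensor-product cells; let $\mathcal T_{\mathbb E}$ consist of the intervals of a partition of $\mathbb E$. Let $\mathbb V=\mathbb V_\Omega\otimes\mathbb V_{\mathbb S}\otimes\mathbb V_{\mathbb E}$, where $\mathbb V_\Omega$, $\mathbb V_{\mathbb S}$, $\mathbb V_{\mathbb E}$ are the spaces of discontinuous functions which are, on every element, polynomials of total degree at most $p$, polynomials of degree at most $q$ in each coordinate of the flat cell mapped by the radial projection, and polynomials of degree at most $r$, respectively. For $\mu\in\mathbb S$ let $\partial_-\kappa_\Omega$, $\partial_+\kappa_\Omega$ be the parts of the union $\partial\kappa_\Omega$ of the open faces where $\mu\cdot n<0$, $\mu\cdot n\ge0$, and let $v^+$, $v^-$ be the interior and exterior traces relative to $\kappa_\Omega$. Define $$a(w,v)=\int_{\mathbb E}\int_{\mathbb S}\sum_{\kappa_\Omega}\Big[\int_{\kappa_\Omega}\big(-w\,\mu\cdot\nabla_xv+(\alpha+\beta)wv\big)dx+\int_{\partial_+\kappa_\Omega}|\mu\cdot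 n|w^+v^+ds-\int_{\partial_-\kappa_\Omega\setminus\partial\Omega}|\mu\cdot n|w^-v^+ds\Big]d\mu\,dE,$$ $$s(w,v)=\int_{\mathcal D}S[w]\,v,\qquad \ell(v)=\int_{\mathbb E}\int_{\mathbb S}\sum_{\kappa_\Omega}\Big[\int_{\kappa_\Omega}fv\,dx+\int_{\partial_-\kappa_\Omega\cap\partial\Omega}|\mu\cdot n|g_Dv^+ds\Big]d\mu\,dE,$$ $$|||v|||_{DG}^2=\|\sqrt{\overline\alpha}v\|_{L_2(\mathcal D)}^2+\tfrac12\int_{\mathbb E}\int_{\mathbb S}\sum_{\kappa_\Omega}\Big[\int_{\partial_-\kappa_\Omega\setminus\partial\Omega}|\mu\cdot n|(v^+-v^-)^2ds+\int_{\partial\kappa_\Omega\cap\partial\Omega}|\mu\cdot n|(v^+)^2ds\Big]d\mu\,dE.$$ The discrete solution $u_h\in\mathbb V$ is defined by $a(u_h,v_h)=s(u_h,v_h)+\ell(v_h)$ for all $v_h\in\mathbb V$. **Matrices.** Let $\phi_1,\dots,\phi_N$ be a basis of $\mathbb V$, $\mathbf A_{ij}=a(\phi_j,\phi_i)$, $\mathbf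 S_{ij}=s(\phi_j,\phi_i)$, $\mathbf F_i=\ell(\phi_i)$, $\hat{\mathbf M}_{ij}=\int_{\mathcal D}\overline\alpha\,\phi_i\phi_j$, and let $\mathbf P\in\mathbb R^{N\times N}$ be any invertible matrix. For $\mathbf B\in\mathbb R^{N\times N}$, $\mathbf b,\mathbf z_0\in\mathbb R^N$, the $n$-th GMRES iterate for $\mathbf B\mathbf z=\mathbf b$ with initial guess $\mathbf z_0$ minimises $\|\mathbf b-\mathbf B\mathbf y\|_2$ over $\mathbf y\in\mathbf z_0+\mathrm{span}\{\mathbf B^k(\mathbf b-\mathbf B\mathbf z_0):0\le k<n\}$; GMRES with tolerance $\mathrm{TOL}$ returns the first iterate whose Euclidean residual $\|\mathbf b-\mathbf B\mathbf z\|_2$ is at most $\mathrm{TOL}$. **Claim.** The discrete problem has a unique solution $u_h$, and $\hat{\mathbf M}$ has a Cholesky factor: $\hat{\mathbf M}=\mathbf L\mathbf L^*$ with $\mathbf L$ lower triangular with positive diagonal. For every such $\mathbf L$, put $\mathbf B=\mathbf L^{-1}(\mathbf A-\mathbf S)\mathbf P^{-1}\mathbf L$ and $\mathbf b=\mathbf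 L^{-1}\mathbf F$. 1. For every $\mathbf z\in\mathbb R^N$, let $\hat{\mathbf u}=\mathbf P^{-1}\mathbf L\mathbf z$ and $\hat u_h=\sum_i\hat{\mathbf u}_i\phi_i$. There is a unique $r_h\in\mathbb V$ with $(\overline\alpha r_h,v_h)_{L_2(\mathcal D)}=\ell(v_h)-a(\hat u_h,v_h)+s(\hat u_h,v_h)$ for all $v_h\in\mathbb V$, and $$|||u_h-\hat u_h|||_{DG}\le\Big(\sum_{\kappa\in\mathcal T_\Omega\times\mathcal T_{\mathbb S}\times\mathcal T_{\mathbb E}}\|\sqrt{\overline\alpha}r_h\|_{L_2(\kappa)}^2\Big)^{1/2}=\|\sqrt{\overline\alpha}r_h\|_{L_2(\mathcal D)}=\|\mathbf b-\mathbf B\mathbf z\|_2 .$$ 2. For every initial guess and every $\mathrm{TOL}\ge0$, GMRES applied to $\mathbf B\mathbf z=\mathbf b$ (in exact arithmetic) returns a vector. Whenever it returns $\hat{\mathbf z}$ with tolerance $\mathrm{TOL}$, the function $\hat u_h$ with coefficient vector $\hat{\mathbf u}=\mathbf P^{-1}\mathbf L\hat{\mathbf z}$ satisfies $|||u_h-\hat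 u_h|||_{DG}\le\mathrm{TOL}$. -/

import Mathlib

noncomputable section

namespace Boltzmann

open MeasureTheory Filter Topology

/-- Position space `ℝ^d` with its Euclidean norm. -/
abbrev Space (d : ℕ) : Type := EuclideanSpace ℝ (Fin d)

/-- The unit sphere of directions. -/
abbrev Direction (d : ℕ) : Type := Metric.sphere (0 : Space d) 1

/-- Points `(x, μ, E)` of phase space. -/
abbrev Phase (d : ℕ) : Type := Space d × Direction d × ℝ

/-- The surface measure of the unit sphere. -/
abbrev sphereMeasure (d : ℕ) : Measure (Direction d) :=
  (volume : Measure (Space d)).toSphere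

/-- The `(d-1)`-dimensional surface measure in `ℝ^d` (Hausdorff measure, normalised so that it is
Lebesgue measure on hyperplanes). -/
abbrev surfaceMeasure (d : ℕ) : Measure (Space d) :=
  Measure.euclideanHausdorffMeasure (d - 1)

/-! ### The transport problem -/

/-- The data of the linear Boltzmann transport problem and the standing assumptions on them.
`θ x t E' E` stands for `θ(x, t, E' → E)`. -/
structure Problem (d : ℕ) where
  /-- the spatial domain -/
  Ω : Set (Space d)
  /-- the energy domain is `[Emin, Emax]` -/
  Emin : ℝ
  Emax : ℝ
  /-- the macroscopic absorption cross-section -/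
  α : Space d → ℝ → ℝ
  /-- the scattering kernel -/
  θ : Space d → ℝ → ℝ → ℝ → ℝ
  /-- the forcing term -/
  f : Phase d → ℝ
  /-- the inflow boundary data -/
  gD : Phase d → ℝ
  isOpen_Ω : IsOpen Ω
  isBounded_Ω : Bornology.IsBounded Ω
  Emin_nonneg : 0 ≤ Emin
  Emin_lt_Emax : Emin < Emax
  α_nonneg : ∀ x ∈ Ω, ∀ E ∈ Set.Icc Emin Emax, 0 ≤ α x E
  θ_nonneg : ∀ x ∈ Ω, ∀ t ∈ Set.Icc (-1 : ℝ) 1, ∀ E' ∈ Set.Icc Emin Emax,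
    ∀ E ∈ Set.Icc Emin Emax, 0 ≤ θ x t E' E
  /-- `α` is integrable on `Ω × [Emin, Emax]` -/
  α_integrable : Integrable (fun p : Space d × ℝ => α p.1 p.2)
    ((volume.restrict Ω).prod (volume.restrict (Set.Icc Emin Emax)))
  /-- `(x, μ', E', μ, E) ↦ θ(x, μ'·μ, E' → E)` is integrable -/
  θ_integrable : Integrable
    (fun p : Space d × (Direction d × ℝ) × (Direction d × ℝ) =>
      θ p.1 (inner ℝ (p.2.1.1 : Space d) (p.2.2.1 : Space d)) p.2.1.2 p.2.2.2)
    ((volume.restrict Ω).prod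
      (((sphereMeasure d).prod (volume.restrict (Set.Icc Emin Emax))).prod
        ((sphereMeasure d).prod (volume.restrict (Set.Icc Emin Emax)))))
  f_integrable : Integrable f ((volume.restrict Ω).prod
    ((sphereMeasure d).prod (volume.restrict (Set.Icc Emin Emax))))

namespace Problem

variable {d : ℕ} (pb : Problem d)

/-- The energy domain. -/
def energies : Set ℝ := Set.Icc pb.Emin pb.Emax

/-- The macroscopic scattering cross-section
`β = ∫_𝔼 ∫_𝕊 θ(x, μ·μ', E → E') dμ' dE'` (its value does not depend on `μ`). -/
def β (x : Space d) (μ : Direction d) (E : ℝ) : ℝ :=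
  ∫ E' in pb.energies, ∫ μ' : Direction d,
    pb.θ x (inner ℝ (μ : Space d) (μ' : Space d)) E E' ∂(sphereMeasure d)

/-- `γ = ∫_𝔼 ∫_𝕊 θ(x, μ'·μ, E' → E) dμ' dE'` (its value does not depend on `μ`). -/
def γ (x : Space d) (μ : Direction d) (E : ℝ) : ℝ :=
  ∫ E' in pb.energies, ∫ μ' : Direction d,
    pb.θ x (inner ℝ (μ' : Space d) (μ : Space d)) E' E ∂(sphereMeasure d)

/-- `ᾱ = α + (β - γ) / 2`. -/
def αbar (x : Space d) (μ : Direction d) (E : ℝ) : ℝ :=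
  pb.α x E + (1 / 2) * (pb.β x μ E - pb.γ x μ E)

/-- The assumption that `ᾱ ≥ α₀` for some constant `α₀ > 0`. -/
def Coercive : Prop :=
  ∃ α₀ : ℝ, 0 < α₀ ∧ ∀ x ∈ pb.Ω, ∀ μ : Direction d, ∀ E ∈ pb.energies, α₀ ≤ pb.αbar x μ E

/-- The scattering operator. -/
def scatter (w : Phase d → ℝ) (x : Space d) (μ : Direction d) (E : ℝ) : ℝ :=
  ∫ E' in pb.energies, ∫ μ' : Direction d,
    pb.θ x (inner ℝ (μ' : Space d) (μ : Space d)) E' E * w (x, μ', E') ∂(sphereMeasure d)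

end Problem

/-! ### Polytopic elements, their faces and traces -/

/-- A (not necessarily convex) open polytope: a nonempty bounded open set which is the interior of
its closure and whose boundary lies in a finite union of hyperplanes. -/
structure IsPolytope {d : ℕ} (κ : Set (Space d)) : Prop where
  nonempty : κ.Nonempty
  isOpen : IsOpen κ
  isBounded : Bornology.IsBounded κ
  interior_closure : interior (closure κ) = κ
  frontier_subset : ∃ H : Finset (Space d × ℝ), (∀ h ∈ H, h.1 ≠ 0) ∧
    frontier κ ⊆ ⋃ h ∈ H, {x | inner ℝ h.1 x = h.2}

/-- `n` is the outward unit normal of `κ` at the flat boundary point `x`: near `x` the set `κ` is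
the open half-space through `x` with outward unit normal `n`. -/
def IsOutwardNormal {d : ℕ} (κ : Set (Space d)) (x n : Space d) : Prop :=
  ‖n‖ = 1 ∧ ∃ r > 0, ∀ y ∈ Metric.ball x r, y ∈ κ ↔ inner ℝ n (y - x) < 0

/-- The union `∂κ` of the open `(d-1)`-dimensional faces of `κ`. -/
def faces {d : ℕ} (κ : Set (Space d)) : Set (Space d) :=
  {x | ∃ n, IsOutwardNormal κ x n}

open Classical in
/-- The outward unit normal of `κ` at the points of its open faces (`0` elsewhere). -/
def normal {d : ℕ} (κ : Set (Space d)) (x : Space d) : Space d :=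
  if h : ∃ n, IsOutwardNormal κ x n then h.choose else 0

/-- `μ·n_κ(x)`. -/
def normalFlux {d : ℕ} (κ : Set (Space d)) (μ : Direction d) (x : Space d) : ℝ :=
  inner ℝ (μ : Space d) (normal κ x)

/-- The inflow boundary `∂₋κ` for the direction `μ`. -/
def inflow {d : ℕ} (κ : Set (Space d)) (μ : Direction d) : Set (Space d) :=
  {x | x ∈ faces κ ∧ normalFlux κ μ x < 0}

/-- The outflow boundary `∂₊κ` for the direction `μ`. -/
def outflow {d : ℕ} (κ : Set (Space d)) (μ : Direction d) : Set (Space d) :=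
  {x | x ∈ faces κ ∧ 0 ≤ normalFlux κ μ x}

/-- The interior trace `v⁺` relative to `κ`. -/
def traceIn {d : ℕ} (κ : Set (Space d)) (v : Phase d → ℝ)
    (x : Space d) (μ : Direction d) (E : ℝ) : ℝ :=
  limUnder (𝓝[κ] x) (fun y => v (y, μ, E))

/-- The exterior trace `v⁻` relative to `κ`. -/
def traceOut {d : ℕ} (κ : Set (Space d)) (v : Phase d → ℝ)
    (x : Space d) (μ : Direction d) (E : ℝ) : ℝ :=
  limUnder (𝓝[(closure κ)ᶜ] x) (fun y => v (y, μ, E))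

/-! ### Meshes and finite element spaces

Finite element functions are represented by their canonical pointwise representatives, which are
(mapped) polynomials on every open mesh element and vanish off the union of these elements. -/

/-- A subdivision of `Ω` into finitely many disjoint open polytopic elements. -/
structure SpatialMesh {d : ℕ} (Ω : Set (Space d)) where
  card : ℕ
  elem : Fin card → Set (Space d)
  isPolytope : ∀ i, IsPolytope (elem i)
  subset : ∀ i, elem i ⊆ Ω
  disjoint : ∀ i j, i ≠ j → Disjoint (elem i) (elem j)
  cover : closure Ω = ⋃ i, closure (elem i)

/-- The spatial space: total degree at most `p` on every element. -/
def SpatialMesh.space {d : ℕ} {Ω : Set (Space d)} (T : SpatialMesh Ω) (p : ℕ) :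
    Set (Space d → ℝ) :=
  {v | (∀ i, ∃ P : MvPolynomial (Fin d) ℝ, P.totalDegree ≤ p ∧
          ∀ x ∈ T.elem i, v x = MvPolynomial.eval (fun k => x k) P) ∧
       ∀ x, x ∉ ⋃ i, T.elem i → v x = 0}

/-- A tensor-product cell on the face `{x_dir = sgn}` of the surface of the cube `[-1,1]^d`. -/
structure CubeCell (d : ℕ) where
  dir : Fin d
  sgn : ℝ
  sgn_eq : sgn = 1 ∨ sgn = -1
  lo : Fin d → ℝ
  hi : Fin d → ℝ
  le_lo : ∀ k, k ≠ dir → -1 ≤ lo k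
  lo_lt_hi : ∀ k, k ≠ dir → lo k < hi k
  hi_le : ∀ k, k ≠ dir → hi k ≤ 1

/-- The relatively open cell. -/
def CubeCell.openCell {d : ℕ} (c : CubeCell d) : Set (Fin d → ℝ) :=
  {x | x c.dir = c.sgn ∧ ∀ k, k ≠ c.dir → c.lo k < x k ∧ x k < c.hi k}

/-- The closed cell. -/
def CubeCell.closedCell {d : ℕ} (c : CubeCell d) : Set (Fin d → ℝ) :=
  {x | x c.dir = c.sgn ∧ ∀ k, k ≠ c.dir → c.lo k ≤ x k ∧ x k ≤ c.hi k}

/-- The inverse `μ ↦ μ / |μ|_∞` of the radial projection `y ↦ y / |y|₂` from the surface of the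
cube `[-1,1]^d` onto the unit sphere. -/
def toCube {d : ℕ} (μ : Direction d) : Fin d → ℝ :=
  fun k => (μ : Space d) k / ‖(WithLp.ofLp (μ : Space d) : Fin d → ℝ)‖

/-- The curved surface element: the image of the open cell under the radial projection. -/
def CubeCell.curved {d : ℕ} (c : CubeCell d) : Set (Direction d) :=
  {μ | toCube μ ∈ c.openCell}

/-- A cube-sphere mesh. In `Fin d → ℝ` the norm is the maximum norm, so `{x | ‖x‖ = 1}` is the
surface of the cube `[-1,1]^d`. -/
structure AngularMesh (d : ℕ) where
  card : ℕ
  cell : Fin card → CubeCell d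
  disjoint : ∀ i j, i ≠ j → Disjoint (cell i).openCell (cell j).openCell
  cover : {x : Fin d → ℝ | ‖x‖ = 1} = ⋃ i, (cell i).closedCell

/-- The angular space: on every curved element a polynomial of degree at most `q` in each of the
`d - 1` coordinates of the flat cell, composed with the inverse of the radial projection. -/
def AngularMesh.space {d : ℕ} (T : AngularMesh d) (q : ℕ) : Set (Direction d → ℝ) :=
  {v | (∀ j, ∃ Q : MvPolynomial (Fin d) ℝ,
          Q.degreeOf (T.cell j).dir = 0 ∧ (∀ k, Q.degreeOf k ≤ q) ∧
          ∀ μ ∈ (T.cell j).curved, v μ = MvPolynomial.eval (toCube μ) Q) ∧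
       ∀ μ, μ ∉ ⋃ j, (T.cell j).curved → v μ = 0}

/-- A partition `Emax = E_0 > E_1 > ⋯ > E_card = Emin` of the energy domain. -/
structure EnergyMesh (Emin Emax : ℝ) where
  card : ℕ
  node : Fin (card + 1) → ℝ
  anti : StrictAnti node
  node_zero : node 0 = Emax
  node_last : node (Fin.last card) = Emin

/-- The energy groups. -/
def EnergyMesh.group {Emin Emax : ℝ} (T : EnergyMesh Emin Emax) (g : Fin T.card) : Set ℝ :=
  Set.Ioo (T.node g.succ) (T.node g.castSucc)

/-- The energetic space: degree at most `r` on every energy group. -/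
def EnergyMesh.space {Emin Emax : ℝ} (T : EnergyMesh Emin Emax) (r : ℕ) : Set (ℝ → ℝ) :=
  {v | (∀ g, ∃ R : Polynomial ℝ, R.natDegree ≤ r ∧ ∀ E ∈ T.group g, v E = R.eval E) ∧
       ∀ E, E ∉ ⋃ g, T.group g → v E = 0}

/-- A space-angle-energy mesh together with the polynomial degrees. -/
structure Discretisation {d : ℕ} (pb : Problem d) where
  spatial : SpatialMesh pb.Ω
  angular : AngularMesh d
  energy : EnergyMesh pb.Emin pb.Emax
  p : ℕ
  q : ℕ
  r : ℕ

namespace Discretisation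

variable {d : ℕ} {pb : Problem d} (D : Discretisation pb)

/-- The finite element space: the tensor product of the spatial, angular and energetic spaces. -/
def feSpace : Submodule ℝ (Phase d → ℝ) :=
  Submodule.span ℝ {v | ∃ a ∈ D.spatial.space D.p, ∃ b ∈ D.angular.space D.q,
    ∃ c ∈ D.energy.space D.r, v = fun y => a y.1 * b y.2.1 * c y.2.2}

/-- `|μ·n| g_D` is integrable on the inflow boundary. -/
def BoundaryDataIntegrable : Prop :=
  ∀ i, IntegrableOn
    (fun y : Phase d => |normalFlux (D.spatial.elem i) y.2.1 y.1| * pb.gD y)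
    {y | y.1 ∈ inflow (D.spatial.elem i) y.2.1}
    (((surfaceMeasure d).restrict (faces (D.spatial.elem i) ∩ frontier pb.Ω)).prod
      ((sphereMeasure d).prod (volume.restrict pb.energies)))

/-! ### The discontinuous Galerkin scheme -/

/-- The transport bilinear form `a(w, v)`. -/
def formA (w v : Phase d → ℝ) : ℝ :=
  ∫ E in pb.energies, ∫ μ : Direction d,
    (∑ i, ((∫ x in D.spatial.elem i,
          (-(w (x, μ, E) * inner ℝ (μ : Space d) (gradient (fun y => v (y, μ, E)) x))
            + (pb.α x E + pb.β x μ E) * w (x, μ, E) * v (x, μ, E)))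
        + (∫ x in outflow (D.spatial.elem i) μ,
            |normalFlux (D.spatial.elem i) μ x|
              * traceIn (D.spatial.elem i) w x μ E * traceIn (D.spatial.elem i) v x μ E
            ∂(surfaceMeasure d))
        - (∫ x in inflow (D.spatial.elem i) μ \ frontier pb.Ω,
            |normalFlux (D.spatial.elem i) μ x|
              * traceOut (D.spatial.elem i) w x μ E * traceIn (D.spatial.elem i) v x μ E
            ∂(surfaceMeasure d)))) ∂(sphereMeasure d)

/-- The scattering bilinear form `s(w, v)`. -/
def formS (pb : Problem d) (w v : Phase d → ℝ) : ℝ :=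
  ∫ E in pb.energies, ∫ μ : Direction d,
    (∫ x in pb.Ω, pb.scatter w x μ E * v (x, μ, E)) ∂(sphereMeasure d)

/-- The load functional `ℓ(v)`. -/
def load (v : Phase d → ℝ) : ℝ :=
  ∫ E in pb.energies, ∫ μ : Direction d,
    (∑ i, ((∫ x in D.spatial.elem i, pb.f (x, μ, E) * v (x, μ, E))
        + (∫ x in inflow (D.spatial.elem i) μ ∩ frontier pb.Ω,
            |normalFlux (D.spatial.elem i) μ x|
              * pb.gD (x, μ, E) * traceIn (D.spatial.elem i) v x μ E
            ∂(surfaceMeasure d)))) ∂(sphereMeasure d)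

/-- `u` solves the scheme: `a(u, v) = s(u, v) + ℓ(v)` for all finite element functions `v`. -/
def IsSolution (u : D.feSpace) : Prop :=
  ∀ v : D.feSpace, D.formA u v = formS pb u v + D.load v

/-- The weighted inner product `(ᾱ w, v)` in `L₂`. -/
def mass (pb : Problem d) (w v : Phase d → ℝ) : ℝ :=
  ∫ E in pb.energies, ∫ μ : Direction d,
    (∫ x in pb.Ω, pb.αbar x μ E * w (x, μ, E) * v (x, μ, E)) ∂(sphereMeasure d)

/-- The norm of `√ᾱ v` in `L₂(K × M × G)`. -/
def weightedNorm (pb : Problem d) (K : Set (Space d)) (M : Set (Direction d)) (G : Set ℝ)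
    (v : Phase d → ℝ) : ℝ :=
  √(∫ E in G, ∫ μ in M, (∫ x in K, (√(pb.αbar x μ E) * v (x, μ, E)) ^ 2) ∂(sphereMeasure d))

/-- The squared seminorm `‖g‖²_ω = ∫_ω |μ·n_κ| g² ds` for `ω ⊆ ∂κ`. -/
def faceNormSq (κ : Set (Space d)) (μ : Direction d) (ω : Set (Space d))
    (g : Space d → ℝ) : ℝ :=
  ∫ x in ω, |normalFlux κ μ x| * g x ^ 2 ∂(surfaceMeasure d)

/-- The DGFEM-energy norm. -/
def dgNorm (v : Phase d → ℝ) : ℝ :=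
  √(weightedNorm pb pb.Ω Set.univ pb.energies v ^ 2
    + (1 / 2) * ∫ E in pb.energies, ∫ μ : Direction d,
        (∑ i, (faceNormSq (D.spatial.elem i) μ (inflow (D.spatial.elem i) μ \ frontier pb.Ω)
              (fun x => traceIn (D.spatial.elem i) v x μ E - traceOut (D.spatial.elem i) v x μ E)
            + faceNormSq (D.spatial.elem i) μ (faces (D.spatial.elem i) ∩ frontier pb.Ω)
              (fun x => traceIn (D.spatial.elem i) v x μ E))) ∂(sphereMeasure d))

/-- The residual functional `R[w](v) = ℓ(v) - (a(w, v) - s(w, v))`. -/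
def residual (w v : Phase d → ℝ) : ℝ :=
  D.load v - (D.formA w v - formS pb w v)

/-- `r` is the Riesz representer of `R[w]`: `(ᾱ r, v) = R[w](v)` for all `v`. -/
def IsResidualFunction (w r : D.feSpace) : Prop :=
  ∀ v : D.feSpace, mass pb r v = D.residual w v

/-- The elementwise indicator `‖√ᾱ r‖_{L₂(κ)}` on the element `κ` with indices `(i, j, g)`. -/
def indicator (r : Phase d → ℝ)
    (i : Fin D.spatial.card) (j : Fin D.angular.card) (g : Fin D.energy.card) : ℝ :=
  weightedNorm pb (D.spatial.elem i) (D.angular.cell j).curved (D.energy.group g) r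

/-- The estimator `(∑_κ η_κ²)^(1/2)`. -/
def estimator (r : Phase d → ℝ) : ℝ :=
  √(∑ i, ∑ j, ∑ g, D.indicator r i j g ^ 2)

/-! ### Matrices of the scheme in a basis of the finite element space -/

variable {N : ℕ} (φ : Module.Basis (Fin N) ℝ D.feSpace)

/-- `A_ij = a(φ_j, φ_i)`. -/
def matA : Matrix (Fin N) (Fin N) ℝ := Matrix.of fun i j => D.formA (φ j) (φ i)

/-- `S_ij = s(φ_j, φ_i)`. -/
def matS : Matrix (Fin N) (Fin N) ℝ := Matrix.of fun i j => formS pb (φ j) (φ i)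

/-- The weighted mass matrix. -/
def matM : Matrix (Fin N) (Fin N) ℝ := Matrix.of fun i j => mass pb (φ i) (φ j)

/-- `F_i = ℓ(φ_i)`. -/
def vecF : Fin N → ℝ := fun i => D.load (φ i)

/-- The finite element function with coefficient vector `u`. -/
def expand (u : Fin N → ℝ) : D.feSpace := ∑ i, u i • φ i

end Discretisation

/-! ### Cholesky factorisation and GMRES -/

/-- `L` is the Cholesky factor of `M`: lower triangular, positive diagonal, `M = L L^*`. -/
def IsCholeskyFactor {N : ℕ} (M L : Matrix (Fin N) (Fin N) ℝ) : Prop :=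
  (∀ i j, i < j → L i j = 0) ∧ (∀ i, 0 < L i i) ∧ M = L * L.conjTranspose

/-- The Euclidean norm of a vector. -/
def euclNorm {N : ℕ} (v : Fin N → ℝ) : ℝ := ‖(WithLp.toLp 2 v : EuclideanSpace ℝ (Fin N))‖

/-- The Krylov space `span {r₀, B r₀, …, B^(n-1) r₀}`. -/
def krylov {N : ℕ} (B : Matrix (Fin N) (Fin N) ℝ) (r₀ : Fin N → ℝ) (n : ℕ) :
    Submodule ℝ (Fin N → ℝ) :=
  Submodule.span ℝ {v | ∃ k < n, v = (B ^ k).mulVec r₀}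

/-- `x` is an `n`-th GMRES iterate for `B x = b` with initial guess `x₀`: it minimises the Euclidean
residual over `x₀ + K_n`. -/
def IsGMRESIterate {N : ℕ} (B : Matrix (Fin N) (Fin N) ℝ) (b x₀ : Fin N → ℝ) (n : ℕ)
    (x : Fin N → ℝ) : Prop :=
  x - x₀ ∈ krylov B (b - B.mulVec x₀) n ∧
  ∀ y, y - x₀ ∈ krylov B (b - B.mulVec x₀) n →
    euclNorm (b - B.mulVec x) ≤ euclNorm (b - B.mulVec y)

/-- `x` is returned by GMRES with tolerance `tol`: it is an iterate with residual at most `tol`, and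
no earlier iterate has a residual at most `tol`. -/
def IsGMRESOutput {N : ℕ} (B : Matrix (Fin N) (Fin N) ℝ) (b x₀ : Fin N → ℝ) (tol : ℝ)
    (x : Fin N → ℝ) : Prop :=
  ∃ n, IsGMRESIterate B b x₀ n x ∧ euclNorm (b - B.mulVec x) ≤ tol ∧
    ∀ m < n, ∀ y, IsGMRESIterate B b x₀ m y → tol < euclNorm (b - B.mulVec y)

end Boltzmann

end

namespace Boltzmann

open MeasureTheory Filter Topology

/-! ### Cholesky factorisation and GMRES -/

/-! The estimate rests on coercivity with constant one: `dgNorm_sq_le` gives |||v|||² ≤ a(v,v) -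
s(v,v) on the discrete space. For e = u_h - û_h the scheme turns a(e,e) - s(e,e) into (ᾱ r_h, e).
The Cauchy–Schwarz (Young) argument in the ᾱ-weighted inner product, together with (ᾱ e, e) ≤
|||e|||², yields |||e||| ≤ ‖√ᾱ r_h‖ (`dgNorm_sub_le`). Coercivity also makes A - S invertible, hence
the discrete problem uniquely solvable.

Coercivity has two sources. Under the nonnegative kernel, w v ≤ (w² + v²)/2 gives s(v,v) ≤ ½∫(β+γ)v²
(`formS_self_le`), and α + β - ½(β+γ) = ᾱ. In the transport term v μ·∇v = μ·∇(v²/2) is integrated by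
parts on every element (`setIntegral_mul_dirDeriv`). The resulting face terms combine with the
upwind fluxes to half the squared jumps and half the squared boundary traces (`face_balance`).

The divergence theorem on non-convex polytopes (`setIntegral_fderiv_eq_faces`) is proved by slicing
along lines parallel to the direction m. On a line it is the fundamental theorem of calculus for a
set with finitely many jumps, and projecting a hyperplane along m produces exactly the factor |m·n|.
All boundaries lie in a finite arrangement of hyperplanes, and points on two of these are null for
the surface measure (`IsArrangement.ae_generic`). At any other boundary point an element is locally
a half-space (`isOutwardNormal_of_generic`), and an interior face point has exactly one element on
the other side (`SpatialMesh.exists_neighbour`).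

The forms are iterated integrals with merely integrable coefficients. Finite element functions,
their traces and their directional derivatives are bounded and measurable, so all integrands are
integrable. Fubini then gives integrals over product measures, from which linearity follows.

The rest is linear algebra. The coefficients ρ of r_h solve Mρ = F - (A-S)û. With M = LL^T the
preconditioned residual b - Bz equals L^Tρ, whose squared Euclidean norm is ρ^T M ρ = ‖√ᾱ r_h‖²
(`euclNorm_residual`). GMRES terminates because B is invertible and, by Cayley–Hamilton, the exact
solution lies in the N-th affine Krylov space. -/

theorem exists_isCholeskyFactor {N : ℕ} {M : Matrix (Fin N) (Fin N) ℝ} (hM : M.PosDef) :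
    ∃ L, IsCholeskyFactor M L := by
  classical
  have hlow : ∀ i j, i < j → LDL.lower hM i j = 0 := by
    have : Invertible (LDL.lowerInv hM) := LDL.invertibleLowerInv hM
    have htri : (LDL.lowerInv hM).BlockTriangular OrderDual.toDual :=
      fun i j hij => LDL.lowerInv_triangular hM hij
    intro i j hij
    exact Matrix.blockTriangular_inv_of_blockTriangular htri hij
  have hdet : (LDL.lower hM).det ≠ 0 := by
    intro h0
    have h := congrArg Matrix.det (LDL.lower_conj_diag hM)
    rw [Matrix.det_mul, Matrix.det_mul, h0, zero_mul, zero_mul] at h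
    exact hM.det_pos.ne h
  have hdiag : ∀ i, LDL.lower hM i i ≠ 0 := by
    rw [Matrix.det_of_isLowerTriangular (LDL.lower hM) (fun i j hij => hlow i j hij)] at hdet
    exact fun i => Finset.prod_ne_zero_iff.1 hdet i (Finset.mem_univ i)
  have hD : (LDL.diag hM).PosDef := by
    rw [LDL.diag_eq_lowerInv_conj]
    have : Invertible (LDL.lowerInv hM) := LDL.invertibleLowerInv hM
    refine hM.mul_mul_conjTranspose_same ?_
    exact Matrix.vecMul_injective_of_isUnit (isUnit_of_invertible _)
  have hd : ∀ i, 0 < LDL.diagEntries hM i := by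
    rw [LDL.diag, Matrix.posDef_diagonal_iff] at hD
    exact hD
  -- From M = l D l^*, the columns of l are scaled by √D_i times the sign of l_ii. The sign makes
  -- the diagonal positive and, since it squares to one, does not affect the product.
  set l := LDL.lower hM with hl
  set e : Fin N → ℝ := fun i => √(LDL.diagEntries hM i) * SignType.sign (l i i) with he
  refine ⟨l * Matrix.diagonal e, ?_, ?_, ?_⟩
  · intro i j hij
    rw [Matrix.mul_diagonal, hlow i j hij, zero_mul]
  · intro i
    rw [Matrix.mul_diagonal, he]
    have h1 : l i i * (√(LDL.diagEntries hM i) * SignType.sign (l i i))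
        = √(LDL.diagEntries hM i) * |l i i| := by
      rw [← self_mul_sign (l i i)]
      ring
    exact h1 ▸ mul_pos (Real.sqrt_pos.2 (hd i)) (abs_pos.2 (hdiag i))
  · conv_lhs => rw [← LDL.lower_conj_diag hM]
    rw [Matrix.conjTranspose_mul, ← Matrix.mul_assoc, Matrix.mul_assoc l (Matrix.diagonal e)]
    congr 2
    rw [Matrix.diagonal_conjTranspose, Matrix.diagonal_mul_diagonal, LDL.diag]
    congr 1
    funext i
    have hs : ((SignType.sign (l i i) : SignType) : ℝ) * (SignType.sign (l i i) : SignType) = 1 := by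
      rcases lt_or_gt_of_ne (hdiag i) with h | h
      · simp [sign_neg h]
      · simp [sign_pos h]
    simp only [he, Pi.star_apply, star_trivial]
    linear_combination (-LDL.diagEntries hM i) * hs - ((SignType.sign (l i i) : SignType) : ℝ) ^ 2 * Real.mul_self_sqrt (hd i).le

theorem IsCholeskyFactor.isUnit_det {N : ℕ} {M L : Matrix (Fin N) (Fin N) ℝ}
    (h : IsCholeskyFactor M L) : IsUnit L.det := by
  rw [Matrix.det_of_isLowerTriangular L (fun i j hij => h.1 i j hij), isUnit_iff_ne_zero]
  exact Finset.prod_ne_zero_iff.2 fun i _ => (h.2.1 i).ne'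

theorem euclNorm_nonneg {N : ℕ} (v : Fin N → ℝ) : 0 ≤ euclNorm v := norm_nonneg _

theorem euclNorm_zero {N : ℕ} : euclNorm (0 : Fin N → ℝ) = 0 := by
  simp [euclNorm]

theorem euclNorm_sq {N : ℕ} (v : Fin N → ℝ) : euclNorm v ^ 2 = v ⬝ᵥ v := by
  rw [euclNorm, EuclideanSpace.norm_sq_eq]
  simp [dotProduct, sq]

/-- Cayley–Hamilton: the characteristic polynomial is X q + c with c ≠ 0 by invertibility, so q(B) B
= -c and B⁻¹ = -c⁻¹ q(B), where q has degree N - 1. -/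
theorem solution_mem_krylov {N : ℕ} {B : Matrix (Fin N) (Fin N) ℝ} (hB : IsUnit B.det)
    (r : Fin N → ℝ) : B⁻¹.mulVec r ∈ krylov B r N := by
  classical
  -- For N = 0 the degree N - 1 truncates to 0, and the sum over powers would contain k = 0, which
  -- is not below N.
  rcases Nat.eq_zero_or_pos N with rfl | hN
  · rw [Subsingleton.elim (B⁻¹.mulVec r) 0]
    exact zero_mem _
  have hc : B.charpoly.coeff 0 ≠ 0 := by
    intro h0
    rw [Matrix.det_eq_sign_charpoly_coeff, h0, mul_zero] at hB
    exact not_isUnit_zero hB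
  have hdiv := congrArg (Polynomial.aeval B) (Polynomial.divX_mul_X_add B.charpoly)
  rw [Matrix.aeval_self_charpoly, map_add, map_mul, Polynomial.aeval_X, Polynomial.aeval_C,
    Algebra.algebraMap_eq_smul_one] at hdiv
  have hinv : B⁻¹ = (-(B.charpoly.coeff 0)⁻¹) • Polynomial.aeval B B.charpoly.divX := by
    have h2 : Polynomial.aeval B B.charpoly.divX * B = -(B.charpoly.coeff 0 • 1) :=
      eq_neg_of_add_eq_zero_left hdiv
    refine Matrix.inv_eq_left_inv ?_
    rw [Matrix.smul_mul, h2, smul_neg, neg_smul, neg_neg, smul_smul, inv_mul_cancel₀ hc, one_smul]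
  rw [hinv, Matrix.smul_mulVec]
  refine Submodule.smul_mem _ _ ?_
  rw [Polynomial.aeval_eq_sum_range, Matrix.sum_mulVec]
  refine Submodule.sum_mem _ fun k hk => ?_
  rw [Matrix.smul_mulVec]
  refine Submodule.smul_mem _ _ (Submodule.subset_span ⟨k, ?_, rfl⟩)
  rw [Finset.mem_range, Polynomial.natDegree_divX_eq_natDegree_tsub_one,
    Matrix.charpoly_natDegree_eq_dim, Fintype.card_fin] at hk
  omega

/-- The exact solution is an N-th iterate with residual zero, so the set of indices having an
iterate within the tolerance is nonempty. Its least element is the stopping index. -/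
theorem exists_isGMRESOutput {N : ℕ} {B : Matrix (Fin N) (Fin N) ℝ} (hB : IsUnit B.det)
    (b x₀ : Fin N → ℝ) {tol : ℝ} (htol : 0 ≤ tol) : ∃ x, IsGMRESOutput B b x₀ tol x := by
  classical
  have hex : ∃ n, ∃ x, IsGMRESIterate B b x₀ n x ∧ euclNorm (b - B.mulVec x) ≤ tol := by
    have h0 : b - B.mulVec (x₀ + B⁻¹.mulVec (b - B.mulVec x₀)) = 0 := by
      rw [Matrix.mulVec_add, Matrix.mulVec_mulVec, Matrix.mul_nonsing_inv _ hB,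
        Matrix.one_mulVec]
      abel
    refine ⟨N, x₀ + B⁻¹.mulVec (b - B.mulVec x₀), ⟨?_, fun y _ => ?_⟩, ?_⟩
    · rw [add_sub_cancel_left]
      exact solution_mem_krylov hB _
    · rw [h0, euclNorm_zero]
      exact euclNorm_nonneg _
    · rw [h0, euclNorm_zero]
      exact htol
  obtain ⟨x, hx, hxt⟩ := Nat.find_spec hex
  refine ⟨x, Nat.find hex, hx, hxt, fun m hm y hy => ?_⟩
  by_contra hle
  exact Nat.find_min hex hm ⟨y, hy, not_lt.1 hle⟩

end Boltzmann

namespace Boltzmann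

open MeasureTheory Filter Topology

/-! ### One-dimensional sets with finitely many jumps -/

/-- Subtracting the step functions with the prescribed jumps leaves a locally constant function on
the line, which vanishes far to the right because U is bounded. Here ε t is the drop of the
indicator across t, read from left to right. -/
theorem indicator_eq_sum_jumps {U : Set ℝ} (hb : Bornology.IsBounded U) (T : Finset ℝ)
    (ε : ℝ → ℝ) (hloc : ∀ s ∉ T, ∀ᶠ u in 𝓝 s, (u ∈ U ↔ s ∈ U))
    (hjump : ∀ t ∈ T, ∃ a : ℝ, (∀ᶠ u in 𝓝[<] t, U.indicator (fun _ => (1 : ℝ)) u = a) ∧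
      ∀ᶠ u in 𝓝[>] t, U.indicator (fun _ => (1 : ℝ)) u = a - ε t) :
    (∀ s ∉ T, U.indicator (fun _ => (1 : ℝ)) s = ∑ t ∈ T, if s ≤ t then ε t else 0) := by
  classical
  set χ : ℝ → ℝ := U.indicator (fun _ => (1 : ℝ)) with hχ
  set e : ℝ → ℝ := fun t => if t ∈ T then ε t else 0 with he
  have hχloc : ∀ s ∉ T, ∀ᶠ u in 𝓝 s, χ u = χ s := by
    intro s hs
    filter_upwards [hloc s hs] with u hu
    simp only [hχ, Set.indicator, hu]
  have hall : ∀ s, ∃ a : ℝ, (∀ᶠ u in 𝓝[<] s, χ u = a) ∧ (∀ᶠ u in 𝓝[>] s, χ u = a - e s) := by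
    intro s
    by_cases hs : s ∈ T
    · simpa [he, hs] using hjump s hs
    · refine ⟨χ s, (hχloc s hs).filter_mono nhdsWithin_le_nhds, ?_⟩
      simpa [he, hs] using (hχloc s hs).filter_mono nhdsWithin_le_nhds
  choose a hal har using hall
  have ha : ∀ s ∉ T, a s = χ s := by
    intro s hs
    obtain ⟨u, h1, h2⟩ := ((hal s).and ((hχloc s hs).filter_mono nhdsWithin_le_nhds)).exists
    exact h1.symm.trans h2
  -- Left limits a are used instead of values, so that the behaviour of U at the points of T is
  -- irrelevant; the steps `s ≤ t` are left-continuous to match.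
  set h : ℝ → ℝ := fun s => a s - ∑ t ∈ T, if s ≤ t then ε t else 0 with hh
  have hconst : IsLocallyConstant h := by
    rw [IsLocallyConstant.iff_eventually_eq]
    intro s
    have hne : ∀ᶠ u in 𝓝 s, ∀ t ∈ T, t ≠ s → (u ≤ t ↔ s ≤ t) := by
      refine (Finset.eventually_all T).2 fun t _ => ?_
      rcases lt_trichotomy t s with hts | hts | hts
      · filter_upwards [lt_mem_nhds hts] with u hu _
        exact ⟨fun h' => absurd h' (not_le.2 hu), fun h' => absurd h' (not_le.2 hts)⟩
      · exact Eventually.of_forall fun u hu => absurd hts hu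
      · filter_upwards [gt_mem_nhds hts] with u hu _
        exact ⟨fun _ => hts.le, fun _ => le_of_lt hu⟩
    have hl : ∀ᶠ u in 𝓝[<] s, h u = h s := by
      filter_upwards [eventually_eventually_nhdsWithin.2 (hal s), hal s, self_mem_nhdsWithin,
        hne.filter_mono nhdsWithin_le_nhds] with u h1 h2 h3 h4
      have hau : a u = a s := by
        have hmono : ∀ᶠ w in 𝓝[<] u, χ w = a s := by
          have h5 : Set.Iio u ⊆ Set.Iio s := Set.Iio_subset_Iio (le_of_lt h3)
          rw [IsOpen.nhdsWithin_eq isOpen_Iio h3] at h1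
          exact h1.filter_mono nhdsWithin_le_nhds
        obtain ⟨w, hw1, hw2⟩ := (hmono.and (hal u)).exists
        exact hw2.symm.trans hw1
      simp only [hh, hau]
      congr 1
      refine Finset.sum_congr rfl fun t ht => ?_
      by_cases hts : t = s
      · simp [hts, (show u < s from h3).le]
      · simp [h4 t ht hts]
    have hr : ∀ᶠ u in 𝓝[>] s, h u = h s := by
      filter_upwards [eventually_eventually_nhdsWithin.2 (har s), har s, self_mem_nhdsWithin,
        hne.filter_mono nhdsWithin_le_nhds] with u h1 h2 h3 h4
      have hau : a u = a s - e s := by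
        rw [IsOpen.nhdsWithin_eq isOpen_Ioi h3] at h1
        obtain ⟨w, hw1, hw2⟩ := ((h1.filter_mono nhdsWithin_le_nhds).and (hal u)).exists
        exact hw2.symm.trans hw1
      have hsum : (∑ t ∈ T, if s ≤ t then ε t else 0)
          = e s + ∑ t ∈ T, if u ≤ t then ε t else 0 := by
        have hes : e s = ∑ t ∈ T, if t = s then ε t else 0 := by
          simp [he, Finset.sum_ite_eq']
        rw [hes, ← Finset.sum_add_distrib]
        refine Finset.sum_congr rfl fun t ht => ?_
        by_cases hts : t = s
        · subst hts
          simp [not_le.2 (show t < u from h3)]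
        · simp [h4 t ht hts, hts]
      simp only [hh, hau, hsum]
      ring
    rw [← nhdsNE_sup_pure, ← nhdsLT_sup_nhdsGT]
    exact eventually_sup.2 ⟨eventually_sup.2 ⟨hl, hr⟩, eventually_pure.2 rfl⟩
  obtain ⟨M, hM⟩ := (hb.union T.finite_toSet.isBounded).subset_closedBall 0
  have hout : ∀ x, M < x → x ∉ U ∧ x ∉ T := by
    intro x hx
    have : x ∉ Metric.closedBall (0 : ℝ) M := by
      rw [Metric.mem_closedBall, Real.dist_eq, sub_zero, not_le]
      exact hx.trans_le (le_abs_self x)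
    exact ⟨fun h' => this (hM (Or.inl h')), fun h' => this (hM (Or.inr h'))⟩
  have h0 : ∀ s, h s = 0 := by
    intro s
    rw [hconst.apply_eq_of_isPreconnected isPreconnected_univ (Set.mem_univ s)
      (Set.mem_univ (M + 1))]
    simp only [hh]
    rw [ha _ (hout (M + 1) (by linarith)).2, hχ,
      Set.indicator_of_notMem (hout (M + 1) (by linarith)).1, zero_sub, neg_eq_zero]
    refine Finset.sum_eq_zero fun t ht => if_neg fun hle => ?_
    exact (hout t (by linarith)).2 ht
  intro s hs
  have := h0 s
  simp only [hh] at this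
  rw [← ha s hs]
  linarith

/-- The indicator of U is almost everywhere a sum of steps, and each step integrates g' from a base
point m to a jump. The contributions of g m cancel because the jumps of a bounded set sum to zero.
-/
theorem setIntegral_deriv_eq_sum_jumps {U : Set ℝ} (hU : MeasurableSet U)
    (hb : Bornology.IsBounded U) (T : Finset ℝ)
    (ε : ℝ → ℝ) (hloc : ∀ s ∉ T, ∀ᶠ u in 𝓝 s, (u ∈ U ↔ s ∈ U))
    (hjump : ∀ t ∈ T, ∃ a : ℝ, (∀ᶠ u in 𝓝[<] t, U.indicator (fun _ => (1 : ℝ)) u = a) ∧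
      ∀ᶠ u in 𝓝[>] t, U.indicator (fun _ => (1 : ℝ)) u = a - ε t)
    {g g' : ℝ → ℝ} (hg : ∀ x, HasDerivAt g (g' x) x) (hg' : Continuous g') :
    ∫ x in U, g' x = ∑ t ∈ T, ε t * g t := by
  classical
  have hsum := indicator_eq_sum_jumps hb T ε hloc hjump
  obtain ⟨M, hM⟩ := (hb.union T.finite_toSet.isBounded).subset_closedBall 0
  have hin : ∀ x, x ∈ U ∨ x ∈ T → -M ≤ x ∧ x ≤ M := by
    intro x hx
    have := hM (show x ∈ U ∪ ↑T from hx)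
    rw [Metric.mem_closedBall, Real.dist_eq, sub_zero] at this
    exact abs_le.1 this
  set m : ℝ := -(|M| + 1) with hm
  set m' : ℝ := |M| + 1 with hm'
  have hmM : m < -M := by have := le_abs_self M; linarith
  have hMm : M < m' := by have := le_abs_self M; linarith
  -- The step formula is read at m, to the left of U and T: the indicator is zero and every step is
  -- switched on.
  have hε : ∑ t ∈ T, ε t = 0 := by
    have hmT : m ∉ T := fun h => by have := (hin m (Or.inr h)).1; linarith
    have hmU : m ∉ U := fun h => by have := (hin m (Or.inl h)).1; linarith
    have h1 := hsum m hmT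
    rw [Set.indicator_of_notMem hmU] at h1
    rw [h1]
    refine Finset.sum_congr rfl fun t ht => (if_pos ?_).symm
    have := (hin t (Or.inr ht)).1
    linarith
  have hae : ∀ᵐ x ∂(volume : Measure ℝ), x ∉ T :=
    (Set.Finite.measure_zero T.finite_toSet volume : volume (T : Set ℝ) = 0) |> fun h =>
      measure_eq_zero_iff_ae_notMem.1 h
  have hmm : m ≤ m' := by have := abs_nonneg M; linarith
  have hint : ∀ t, IntegrableOn (fun x => if x ≤ t then ε t * g' x else 0)
      (Set.Ioc m m') := by
    intro t
    have h1 : IntegrableOn (fun x => ε t * g' x) (Set.Ioc m m') :=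
      (((continuous_const.mul hg').integrableOn_Icc).mono_set Set.Ioc_subset_Icc_self)
    exact (h1.indicator (measurableSet_Iic (a := t)))
  calc ∫ x in U, g' x = ∫ x in Set.Ioc m m', U.indicator g' x := by
        rw [setIntegral_indicator hU, Set.inter_eq_right.2]
        intro x hx
        have := hin x (Or.inl hx)
        exact ⟨by linarith [this.1], by linarith [this.2]⟩
    _ = ∫ x in Set.Ioc m m', ∑ t ∈ T, if x ≤ t then ε t * g' x else 0 := by
        refine integral_congr_ae (ae_restrict_of_ae ?_)
        filter_upwards [hae] with x hx
        have h1 : U.indicator g' x = U.indicator (fun _ => (1 : ℝ)) x * g' x := by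
          simp only [Set.indicator]
          split_ifs <;> simp
        rw [h1, hsum x hx, Finset.sum_mul]
        refine Finset.sum_congr rfl fun t _ => ?_
        split_ifs <;> simp
    _ = ∑ t ∈ T, ε t * (g t - g m) := by
        rw [integral_finsetSum _ fun t _ => hint t]
        refine Finset.sum_congr rfl fun t ht => ?_
        have htm := hin t (Or.inr ht)
        have h2 : (fun x => if x ≤ t then ε t * g' x else 0)
            = (Set.Iic t).indicator fun x => ε t * g' x := by
          funext x
          simp [Set.indicator]
        rw [h2, setIntegral_indicator measurableSet_Iic, Set.Ioc_inter_Iic,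
          min_eq_right (by linarith [htm.2]), integral_const_mul,
          ← intervalIntegral.integral_of_le (by linarith [htm.1]),
          intervalIntegral.integral_eq_sub_of_hasDerivAt (fun x _ => hg x)
            (hg'.intervalIntegrable _ _)]
    _ = ∑ t ∈ T, ε t * g t := by
        simp_rw [mul_sub]
        rw [Finset.sum_sub_distrib, ← Finset.sum_mul, hε, zero_mul, sub_zero]

end Boltzmann

namespace Boltzmann

open MeasureTheory Filter Topology

/-! ### Hyperplanes and their surface measure -/

/-- The hyperplane `{x | h.1 · x = h.2}`. -/
def hyp {d : ℕ} (h : Space d × ℝ) : Set (Space d) := {x | inner ℝ h.1 x = h.2}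

theorem isClosed_hyp {d : ℕ} (h : Space d × ℝ) : IsClosed (hyp h) :=
  isClosed_eq (continuous_const.inner continuous_id) continuous_const

theorem measurableSet_hyp {d : ℕ} (h : Space d × ℝ) : MeasurableSet (hyp h) :=
  (isClosed_hyp h).measurableSet

theorem finrank_orthogonal_unit {d : ℕ} {n : Space d} (hn : ‖n‖ = 1) :
    Module.finrank ℝ (ℝ ∙ n)ᗮ = d - 1 := by
  have h0 : n ≠ 0 := fun h => by simp [h] at hn
  have h1 := (ℝ ∙ n).finrank_add_finrank_orthogonal
  rw [finrank_span_singleton h0, finrank_euclideanSpace_fin] at h1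
  omega

theorem volume_level_set {F : Type*} [NormedAddCommGroup F] [InnerProductSpace ℝ F]
    [FiniteDimensional ℝ F] [MeasurableSpace F] [BorelSpace F] (φ : F →ₗ[ℝ] ℝ) (hφ : φ ≠ 0)
    (a : ℝ) : volume {y : F | φ y = a} = 0 := by
  rcases Set.eq_empty_or_nonempty {y : F | φ y = a} with h | ⟨y₀, hy₀⟩
  · rw [h, measure_empty]
  · have h1 : {y : F | φ y = a} = (fun y => y + -y₀) ⁻¹' (LinearMap.ker φ : Set F) := by
      ext y
      have hy₀' : φ y₀ = a := hy₀
      simp [← hy₀', ← sub_eq_add_neg, sub_eq_zero]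
    rw [h1, measure_preimage_add_right]
    exact Measure.addHaar_submodule volume _ fun h => hφ (LinearMap.ker_eq_top.1 h)

/-- The isometric parametrisation of a hyperplane by the orthogonal complement of its normal. -/
def hypParam {d : ℕ} (h : Space d × ℝ) (y : (ℝ ∙ h.1)ᗮ) : Space d := (y : Space d) + h.2 • h.1

theorem isometry_hypParam {d : ℕ} (h : Space d × ℝ) : Isometry (hypParam h) :=
  (isometry_add_right (h.2 • h.1)).comp isometry_subtype_coe

theorem range_hypParam {d : ℕ} {h : Space d × ℝ} (hn : ‖h.1‖ = 1) :
    Set.range (hypParam h) = hyp h := by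
  ext x
  constructor
  · rintro ⟨y, rfl⟩
    have := Submodule.mem_orthogonal_singleton_iff_inner_right.1 y.2
    simp [hyp, hypParam, inner_add_right, inner_smul_right, this, hn]
  · intro hx
    refine ⟨⟨x - h.2 • h.1, Submodule.mem_orthogonal_singleton_iff_inner_right.2 ?_⟩, ?_⟩
    · have hx' : inner ℝ h.1 x = h.2 := hx
      simp [inner_sub_right, inner_smul_right, hx', hn]
    · simp [hypParam]

theorem surfaceMeasure_inter_hyp {d : ℕ} {h : Space d × ℝ} (hn : ‖h.1‖ = 1) (s : Set (Space d)) :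
    surfaceMeasure d (s ∩ hyp h) = volume (hypParam h ⁻¹' s) := by
  rw [← range_hypParam hn, ← (isometry_hypParam h).euclideanHausdorffMeasure_preimage,
    ← finrank_orthogonal_unit hn, InnerProductSpace.euclideanHausdorffMeasure_eq_volume]

theorem surfaceMeasure_inter_hyp_lt_top {d : ℕ} {h : Space d × ℝ} (hn : ‖h.1‖ = 1)
    {s : Set (Space d)} (hs : Bornology.IsBounded s) : surfaceMeasure d (s ∩ hyp h) < ⊤ := by
  rw [surfaceMeasure_inter_hyp hn]
  exact ((isometry_hypParam h).antilipschitz.isBounded_preimage hs).measure_lt_top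

/-- A functional vanishing on the orthogonal complement of the first normal is a multiple of that
normal, so the planes are parallel; the common point fixes the offset. -/
theorem hyp_eq_hyp_of_inner_eq_zero {d : ℕ} {h h' : Space d × ℝ} (hn : ‖h.1‖ = 1)
    (hn' : h'.1 ≠ 0) (hpar : ∀ y : Space d, inner ℝ h.1 y = 0 → inner ℝ h'.1 y = 0)
    {x : Space d} (hx : x ∈ hyp h) (hx' : x ∈ hyp h') : hyp h = hyp h' := by
  have hx1 : inner ℝ h.1 x = h.2 := hx
  have hx2 : inner ℝ h'.1 x = h'.2 := hx'
  have hdec : ∀ y : Space d, inner ℝ h'.1 y = inner ℝ h.1 y * inner ℝ h'.1 h.1 := by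
    intro y
    have h1 := hpar (y - inner ℝ h.1 y • h.1) (by
      simp [inner_sub_right, inner_smul_right, hn])
    rw [inner_sub_right, inner_smul_right] at h1
    linarith
  have hne : inner ℝ h'.1 h.1 ≠ 0 := by
    intro h0
    have h1 := hdec h'.1
    rw [h0, mul_zero] at h1
    exact hn' (inner_self_eq_zero.1 h1)
  ext y
  simp only [hyp, Set.mem_ofPred_eq]
  rw [hdec y, ← hx2, hdec x, hx1]
  exact ⟨fun h => by rw [h], fun h => mul_right_cancel₀ hne h⟩

/-- In the isometric parametrisation of one hyperplane the other cuts out a level set of a linear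
functional. This is null unless the functional vanishes, and then the planes are parallel and either
disjoint or equal. -/
theorem surfaceMeasure_hyp_inter_hyp {d : ℕ} {h h' : Space d × ℝ} (hn : ‖h.1‖ = 1)
    (hn' : h'.1 ≠ 0) (hne : hyp h ≠ hyp h') : surfaceMeasure d (hyp h' ∩ hyp h) = 0 := by
  rw [surfaceMeasure_inter_hyp hn]
  set φ : (ℝ ∙ h.1)ᗮ →ₗ[ℝ] ℝ := (innerₛₗ ℝ h'.1).comp (Submodule.subtype _) with hφdef
  have hset : hypParam h ⁻¹' hyp h' = {y | φ y = h'.2 - h.2 * inner ℝ h'.1 h.1} := by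
    ext y
    simp [hyp, hypParam, hφdef, inner_add_right, inner_smul_right, eq_sub_iff_add_eq]
  by_cases hφ : φ = 0
  · rcases Set.eq_empty_or_nonempty (hypParam h ⁻¹' hyp h') with he | ⟨y, hy⟩
    · rw [he, measure_empty]
    · refine absurd (hyp_eq_hyp_of_inner_eq_zero hn hn' ?_ ?_ hy) hne
      · intro z hz
        have := LinearMap.congr_fun hφ
          ⟨z, Submodule.mem_orthogonal_singleton_iff_inner_right.2 hz⟩
        simpa [hφdef] using this
      · rw [← range_hypParam hn]
        exact ⟨y, rfl⟩
  · rw [hset]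
    exact volume_level_set φ hφ _

/-! ### Projection of a hyperplane along a transversal direction -/

/-- The point of the hyperplane `h` on the line through `y` with direction `m`. -/
noncomputable def hypLift {d : ℕ} (m : Space d) (h : Space d × ℝ) (y : (ℝ ∙ m)ᗮ) : Space d :=
  (y : Space d) + ((h.2 - inner ℝ h.1 (y : Space d)) / inner ℝ h.1 m) • m

/-- The linear part of `hypLift`. -/
noncomputable def liftLinear {d : ℕ} (m n : Space d) : (ℝ ∙ m)ᗮ →ₗ[ℝ] Space d :=
  Submodule.subtype _ -
    (((inner ℝ n m)⁻¹ • (innerₛₗ ℝ n).comp (Submodule.subtype _)).smulRight m)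

theorem hypLift_eq {d : ℕ} (m : Space d) (h : Space d × ℝ) (y : (ℝ ∙ m)ᗮ) :
    hypLift m h y = (h.2 / inner ℝ h.1 m) • m + liftLinear m h.1 y := by
  simp only [hypLift, liftLinear, LinearMap.sub_apply, Submodule.subtype_apply,
    LinearMap.smulRight_apply, LinearMap.smul_apply, LinearMap.comp_apply, innerₛₗ_apply_apply,
    smul_eq_mul]
  rw [sub_div, sub_smul, inv_mul_eq_div]
  abel

theorem continuous_hypLift {d : ℕ} (m : Space d) (h : Space d × ℝ) : Continuous (hypLift m h) := by
  unfold hypLift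
  fun_prop

theorem hypLift_mem_hyp {d : ℕ} {m : Space d} {h : Space d × ℝ} (hm : inner ℝ h.1 m ≠ 0)
    (y : (ℝ ∙ m)ᗮ) : hypLift m h y ∈ hyp h := by
  simp only [hyp, hypLift, Set.mem_ofPred_eq, inner_add_right, inner_smul_right]
  field_simp
  ring

theorem range_hypLift {d : ℕ} {m : Space d} {h : Space d × ℝ} (hm1 : ‖m‖ = 1)
    (hm : inner ℝ h.1 m ≠ 0) : Set.range (hypLift m h) = hyp h := by
  refine Set.Subset.antisymm (Set.range_subset_iff.2 (hypLift_mem_hyp hm)) fun x hx => ?_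
  have hx' : inner ℝ h.1 x = h.2 := hx
  refine ⟨⟨x - inner ℝ m x • m, Submodule.mem_orthogonal_singleton_iff_inner_right.2 ?_⟩, ?_⟩
  · simp [inner_sub_right, inner_smul_right, hm1]
  · simp only [hypLift, inner_sub_right, inner_smul_right, hx']
    have : (h.2 - (h.2 - inner ℝ m x * inner ℝ h.1 m)) / inner ℝ h.1 m = inner ℝ m x := by
      field_simp
      ring
    rw [this, sub_add_cancel]

theorem hypLift_injective {d : ℕ} {m : Space d} (hm1 : ‖m‖ = 1) (h : Space d × ℝ) :
    Function.Injective (hypLift m h) := by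
  intro y z hyz
  have h1 := congrArg (fun x : Space d => x - inner ℝ m x • m) hyz
  have hy := Submodule.mem_orthogonal_singleton_iff_inner_right.1 y.2
  have hz := Submodule.mem_orthogonal_singleton_iff_inner_right.1 z.2
  apply Subtype.ext
  simpa [hypLift, inner_add_right, inner_smul_right, hy, hz, hm1] using h1

/-- Put a = n·m and p = n - a m, the projection of n to m^⊥. The Gram operator T^*T is the identity
plus the rank-one map y ↦ a⁻²(n·y) p, a transvection with determinant 1 + a⁻²(1 - a²) = a⁻². The
area factor is its square root. -/
theorem normDet_liftLinear {d : ℕ} {m n : Space d} (hm1 : ‖m‖ = 1) (hn : ‖n‖ = 1)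
    (hm : inner ℝ n m ≠ 0) : (liftLinear m n).normDet = |inner ℝ n m|⁻¹ := by
  set a : ℝ := inner ℝ n m with ha
  have hp : n - a • m ∈ (ℝ ∙ m)ᗮ := by
    rw [Submodule.mem_orthogonal_singleton_iff_inner_right]
    simp [inner_sub_right, inner_smul_right, hm1, ha, real_inner_comm]
  set p : (ℝ ∙ m)ᗮ := ⟨n - a • m, hp⟩ with hpdef
  set φ : Module.Dual ℝ (ℝ ∙ m)ᗮ := (a⁻¹ ^ 2) • (innerₛₗ ℝ n).comp (Submodule.subtype _) with hφ
  have hcomp : (liftLinear m n).adjoint ∘ₗ liftLinear m n = LinearMap.transvection φ p := by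
    refine LinearMap.ext fun y => ext_inner_right ℝ fun z => ?_
    have hy := Submodule.mem_orthogonal_singleton_iff_inner_left.1 y.2
    have hz := Submodule.mem_orthogonal_singleton_iff_inner_right.1 z.2
    rw [LinearMap.comp_apply, LinearMap.adjoint_inner_left, LinearMap.transvection.apply]
    simp only [liftLinear, LinearMap.sub_apply, Submodule.subtype_apply, hpdef, hφ,
      LinearMap.smulRight_apply, LinearMap.smul_apply, LinearMap.comp_apply, innerₛₗ_apply_apply,
      smul_eq_mul, inner_sub_left, inner_sub_right, inner_add_left, inner_smul_left,
      inner_smul_right, Submodule.coe_inner, hy, hz, hm1,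
      real_inner_self_eq_norm_sq]
    simp
    ring
  have hsq := (liftLinear m n).normDet_sq
  rw [hcomp, LinearMap.transvection.det] at hsq
  have hval : 1 + φ p = (|a|⁻¹) ^ 2 := by
    simp only [hφ, hpdef, LinearMap.smul_apply, LinearMap.comp_apply, innerₛₗ_apply_apply,
      Submodule.subtype_apply, inner_sub_right, inner_smul_right, real_inner_self_eq_norm_sq, hn,
      smul_eq_mul, ← ha]
    rw [inv_pow |a|, sq_abs]
    field_simp
    ring
  rw [hval] at hsq
  exact (pow_left_inj₀ (LinearMap.normDet_nonneg _) (by positivity) two_ne_zero).1 hsq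

/-- A hyperplane transversal to m is an affine graph over m^⊥. This is the identity |m·n| ds = dy
that turns an integral over lines into one over faces. -/
theorem surfaceMeasure_restrict_hyp {d : ℕ} {m : Space d} {h : Space d × ℝ} (hm1 : ‖m‖ = 1)
    (hn : ‖h.1‖ = 1) (hm : inner ℝ h.1 m ≠ 0) :
    (surfaceMeasure d).restrict (hyp h)
      = ENNReal.ofReal |inner ℝ h.1 m|⁻¹ • (volume : Measure (ℝ ∙ m)ᗮ).map (hypLift m h) := by
  ext s hs
  rw [Measure.restrict_apply hs, Measure.smul_apply,
    Measure.map_apply (continuous_hypLift m h).measurable hs, ← range_hypLift hm1 hm,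
    ← Set.image_preimage_eq_inter_range, smul_eq_mul]
  have himg : ∀ t : Set (ℝ ∙ m)ᗮ, hypLift m h '' t
      = (fun x => (h.2 / inner ℝ h.1 m) • m + x) '' (liftLinear m h.1 '' t) := by
    intro t
    rw [Set.image_image]
    exact Set.image_congr fun y _ => hypLift_eq m h y
  rw [himg, (isometry_add_left _).euclideanHausdorffMeasure_image, ← finrank_orthogonal_unit hm1,
    LinearMap.euclideanHausdorffMeasure_image_eq_normDet_mul_volume,
    normDet_liftLinear hm1 hn hm]

theorem setIntegral_hyp {d : ℕ} {m : Space d} {h : Space d × ℝ} (hm1 : ‖m‖ = 1)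
    (hn : ‖h.1‖ = 1) (hm : inner ℝ h.1 m ≠ 0) (F : Space d → ℝ) :
    ∫ x in hyp h, F x ∂(surfaceMeasure d)
      = |inner ℝ h.1 m|⁻¹ * ∫ y : (ℝ ∙ m)ᗮ, F (hypLift m h y) := by
  rw [surfaceMeasure_restrict_hyp hm1 hn hm, integral_smul_measure,
    ENNReal.toReal_ofReal (by positivity), smul_eq_mul]
  congr 1
  exact ((continuous_hypLift m h).measurableEmbedding (hypLift_injective hm1 h)).integral_map F

end Boltzmann

namespace Boltzmann

open MeasureTheory Filter Topology

/-! ### Hyperplane arrangements and their generic points -/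

/-- A finite family of pairwise distinct hyperplanes, given by unit normals. -/
structure IsArrangement {d : ℕ} (A : Finset (Space d × ℝ)) : Prop where
  norm_eq : ∀ h ∈ A, ‖h.1‖ = 1
  inj : ∀ h ∈ A, ∀ h' ∈ A, hyp h = hyp h' → h = h'

/-- `x` lies on at most one hyperplane of the arrangement. -/
def Generic {d : ℕ} (A : Finset (Space d × ℝ)) (x : Space d) : Prop :=
  ∀ h ∈ A, ∀ h' ∈ A, x ∈ hyp h → x ∈ hyp h' → h = h'

/-- The normals are scaled to unit length. One plane still has two unit descriptions, so a single
one is kept for each plane regarded as a set. -/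
theorem exists_arrangement {d : ℕ} (H : Finset (Space d × ℝ)) (hH : ∀ h ∈ H, h.1 ≠ 0) :
    ∃ A : Finset (Space d × ℝ), IsArrangement A ∧
      (⋃ h ∈ H, {x | inner ℝ h.1 x = h.2}) ⊆ ⋃ h ∈ A, hyp h := by
  classical
  have hunit : ∀ h ∈ H, ∃ k : Space d × ℝ, ‖k.1‖ = 1 ∧ hyp k = hyp h := by
    intro h hh
    have h0 : ‖h.1‖ ≠ 0 := norm_ne_zero_iff.2 (hH h hh)
    refine ⟨(‖h.1‖⁻¹ • h.1, ‖h.1‖⁻¹ * h.2), ?_, ?_⟩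
    · rw [norm_smul, norm_inv, norm_norm, inv_mul_cancel₀ h0]
    · ext x
      simp [hyp, inner_smul_left, h0]
  -- Choosing the representative as a function of the point set forces equal planes to receive the
  -- same pair. The value (0, 0) on other sets is a dummy.
  have hrep : ∀ S : Set (Space d), ∃ k : Space d × ℝ,
      (∃ h ∈ H, S = hyp h) → ‖k.1‖ = 1 ∧ hyp k = S := by
    intro S
    by_cases hS : ∃ h ∈ H, S = hyp h
    · obtain ⟨h, hh, rfl⟩ := hS
      obtain ⟨k, hk⟩ := hunit h hh
      exact ⟨k, fun _ => hk⟩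
    · exact ⟨(0, 0), fun h => absurd h hS⟩
  choose rep hrep using hrep
  have hmem : ∀ h ∈ H, ‖(rep (hyp h)).1‖ = 1 ∧ hyp (rep (hyp h)) = hyp h :=
    fun h hh => hrep _ ⟨h, hh, rfl⟩
  refine ⟨H.image fun h => rep (hyp h), ⟨?_, ?_⟩, ?_⟩
  · intro k hk
    obtain ⟨h, hh, rfl⟩ := Finset.mem_image.1 hk
    exact (hmem h hh).1
  · intro k hk k' hk' heq
    obtain ⟨h, hh, rfl⟩ := Finset.mem_image.1 hk
    obtain ⟨h', hh', rfl⟩ := Finset.mem_image.1 hk'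
    rw [(hmem h hh).2, (hmem h' hh').2] at heq
    rw [heq]
  · intro x hx
    obtain ⟨h, hh, hxh⟩ := Set.mem_iUnion₂.1 hx
    refine Set.mem_iUnion₂.2 ⟨rep (hyp h), Finset.mem_image_of_mem _ hh, ?_⟩
    rw [(hmem h hh).2]
    exact hxh

/-- The exceptional points lie in finitely many intersections of two distinct hyperplanes, each of
surface measure zero. -/
theorem IsArrangement.ae_generic {d : ℕ} {A : Finset (Space d × ℝ)} (hA : IsArrangement A) :
    ∀ᵐ x ∂(surfaceMeasure d), Generic A x := by
  have h0 : surfaceMeasure d (⋃ h ∈ A, ⋃ h' ∈ A, ⋃ _ : h ≠ h', hyp h' ∩ hyp h) = 0 := by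
    refine (measure_biUnion_null_iff A.countable_toSet).2 fun h hh =>
      (measure_biUnion_null_iff A.countable_toSet).2 fun h' hh' => ?_
    refine measure_iUnion_null fun hne => ?_
    refine surfaceMeasure_hyp_inter_hyp (hA.norm_eq h hh) ?_ fun he => hne (hA.inj h hh h' hh' he)
    intro hz
    have := hA.norm_eq h' hh'
    simp [hz] at this
  filter_upwards [measure_eq_zero_iff_ae_notMem.1 h0] with x hx h hh h' hh' hxh hxh'
  by_contra hne
  exact hx (Set.mem_iUnion₂.2 ⟨h, hh, Set.mem_iUnion₂.2 ⟨h', hh', Set.mem_iUnion.2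
    ⟨hne, hxh', hxh⟩⟩⟩)

theorem Generic.exists_ball {d : ℕ} {A : Finset (Space d × ℝ)} {x : Space d}
    (hx : Generic A x) {h : Space d × ℝ} (hh : h ∈ A) (hxh : x ∈ hyp h) :
    ∃ r > 0, ∀ y ∈ Metric.ball x r, y ∈ (⋃ h ∈ A, hyp h) → y ∈ hyp h := by
  have hev : ∀ᶠ y in 𝓝 x, ∀ h' ∈ A, h' ≠ h → y ∉ hyp h' := by
    refine (Finset.eventually_all A).2 fun h' hh' => ?_
    by_cases hne : h' = h
    · exact Eventually.of_forall fun y h0 => absurd hne h0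
    · have : x ∉ hyp h' := fun hx' => hne (hx h' hh' h hh hx' hxh)
      filter_upwards [(isClosed_hyp h').isOpen_compl.mem_nhds this] with y hy _
      exact hy
  obtain ⟨r, hr, hball⟩ := Metric.eventually_nhds_iff_ball.1 hev
  refine ⟨r, hr, fun y hy hyA => ?_⟩
  obtain ⟨h', hh', hyh'⟩ := Set.mem_iUnion₂.1 hyA
  by_contra hcon
  exact hball y hy h' hh' (fun he => hcon (he ▸ hyh')) hyh'

/-! ### Faces and normals -/

theorem exists_add_smul_mem {d : ℕ} (n : Space d) {y : Space d}
    {W : Set (Space d)} (hW : W ∈ 𝓝 y) :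
    ∃ t > (0 : ℝ), y + t • n ∈ W := by
  have hc : Tendsto (fun t : ℝ => y + t • n) (𝓝[>] 0) (𝓝 y) := by
    have : Continuous fun t : ℝ => y + t • n := by fun_prop
    have h1 := this.tendsto 0
    simp only [zero_smul, add_zero] at h1
    exact h1.mono_left nhdsWithin_le_nhds
  obtain ⟨t, h1, h2⟩ := ((hc.eventually hW).and self_mem_nhdsWithin).exists
  exact ⟨t, h2, h1⟩

theorem IsOutwardNormal.unique {d : ℕ} {κ : Set (Space d)} {x n n' : Space d}
    (h : IsOutwardNormal κ x n) (h' : IsOutwardNormal κ x n') : n = n' := by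
  obtain ⟨hn, r, hr, hb⟩ := h
  obtain ⟨hn', r', hr', hb'⟩ := h'
  by_contra hne
  have hlt : inner ℝ n n' < 1 := by
    have h1 := (inner_lt_one_iff_real_of_norm_eq_one hn hn').2 hne
    exact h1
  -- Moving from x along n - n' leaves the half-space of n and enters that of n', so the two local
  -- descriptions of κ contradict each other.
  set w := n - n' with hw
  have hsmall : ∀ᶠ t : ℝ in 𝓝[>] 0, x + t • w ∈ Metric.ball x r ∩ Metric.ball x r' := by
    have : Continuous fun t : ℝ => x + t • w := by fun_prop
    have h1 := this.tendsto 0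
    simp only [zero_smul, add_zero] at h1
    exact (h1.mono_left nhdsWithin_le_nhds).eventually
      (inter_mem (Metric.ball_mem_nhds x hr) (Metric.ball_mem_nhds x hr'))
  obtain ⟨t, ⟨h1, h2⟩, h3⟩ := (hsmall.and self_mem_nhdsWithin).exists
  have h3' : 0 < t := h3
  have e1 := hb _ h1
  have e2 := hb' _ h2
  rw [add_sub_cancel_left, inner_smul_right] at e1 e2
  have i1 : inner ℝ n w = 1 - inner ℝ n n' := by
    simp [hw, inner_sub_right, hn]
  have i2 : inner ℝ n' w = inner ℝ n n' - 1 := by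
    simp [hw, inner_sub_right, hn', real_inner_comm]
  rw [i1] at e1
  rw [i2] at e2
  have := e1.1 (e2.2 (mul_neg_of_pos_of_neg h3' (by linarith)))
  nlinarith

theorem IsOutwardNormal.normal_eq {d : ℕ} {κ : Set (Space d)} {x n : Space d}
    (h : IsOutwardNormal κ x n) : normal κ x = n := by
  have hex : ∃ n, IsOutwardNormal κ x n := ⟨n, h⟩
  rw [normal, dif_pos hex]
  exact hex.choose_spec.unique h

theorem isOutwardNormal_normal {d : ℕ} {κ : Set (Space d)} {x : Space d} (hx : x ∈ faces κ) :
    IsOutwardNormal κ x (normal κ x) := by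
  obtain ⟨n, hn⟩ := hx
  rw [hn.normal_eq]
  exact hn

theorem norm_normal_le {d : ℕ} (κ : Set (Space d)) (x : Space d) : ‖normal κ x‖ ≤ 1 := by
  by_cases hx : x ∈ faces κ
  · exact (isOutwardNormal_normal hx).1.le
  · have : ¬ ∃ n, IsOutwardNormal κ x n := hx
    rw [normal, dif_neg this]
    simp

theorem IsOutwardNormal.nhdsWithin_eq {d : ℕ} {κ : Set (Space d)} {x n : Space d}
    (h : IsOutwardNormal κ x n) : 𝓝[κ] x = 𝓝[{y | inner ℝ n (y - x) < 0}] x := by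
  obtain ⟨-, r, hr, hb⟩ := h
  refine nhdsWithin_eq_nhdsWithin (Metric.mem_ball_self hr) Metric.isOpen_ball ?_
  ext y
  exact ⟨fun hy => ⟨(hb y hy.2).1 hy.1, hy.2⟩, fun hy => ⟨(hb y hy.2).2 hy.1, hy.2⟩⟩

theorem IsOutwardNormal.notMem {d : ℕ} {κ : Set (Space d)} {x n : Space d}
    (h : IsOutwardNormal κ x n) : x ∉ κ := by
  obtain ⟨-, r, hr, hb⟩ := h
  intro hx
  have := (hb x (Metric.mem_ball_self hr)).1 hx
  simp at this

theorem IsOutwardNormal.mem_closure {d : ℕ} {κ : Set (Space d)} {x n : Space d}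
    (h : IsOutwardNormal κ x n) : x ∈ closure κ := by
  obtain ⟨hn, r, hr, hb⟩ := h
  rw [mem_closure_iff_nhds]
  intro W hW
  obtain ⟨t, ht, hmem⟩ := exists_add_smul_mem (-n)
    (inter_mem hW (Metric.ball_mem_nhds x hr))
  refine ⟨x + t • -n, hmem.1, (hb _ hmem.2).2 ?_⟩
  rw [add_sub_cancel_left, inner_smul_right, inner_neg_right, real_inner_self_eq_norm_sq, hn]
  linarith

theorem faces_subset_frontier {d : ℕ} {κ : Set (Space d)} : faces κ ⊆ frontier κ :=
  fun _ ⟨_, hn⟩ => ⟨hn.mem_closure, fun hi => hn.notMem (interior_subset hi)⟩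

theorem IsOutwardNormal.of_inner_eq_zero {d : ℕ} {κ : Set (Space d)} {x n : Space d} {r : ℝ}
    (hn : ‖n‖ = 1) (hb : ∀ y ∈ Metric.ball x r, y ∈ κ ↔ inner ℝ n (y - x) < 0) {y : Space d}
    (hy : y ∈ Metric.ball x r) (h0 : inner ℝ n (y - x) = 0) : IsOutwardNormal κ y n := by
  obtain ⟨s, hs, hsub⟩ := Metric.isOpen_iff.1 Metric.isOpen_ball y hy
  refine ⟨hn, s, hs, fun z hz => ?_⟩
  rw [hb z (hsub hz), show z - x = (z - y) + (y - x) by abel, inner_add_right, h0, add_zero]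

theorem IsOutwardNormal.inner_eq_zero_of_mem_frontier {d : ℕ} {κ : Set (Space d)} {x n : Space d}
    {r : ℝ} (hb : ∀ y ∈ Metric.ball x r, y ∈ κ ↔ inner ℝ n (y - x) < 0)
    {y : Space d} (hy : y ∈ Metric.ball x r) (hfr : y ∈ frontier κ) : inner ℝ n (y - x) = 0 := by
  have hcont : Continuous fun z : Space d => inner ℝ n (z - x) := by fun_prop
  have hball : Metric.ball x r ∈ 𝓝 y := Metric.isOpen_ball.mem_nhds hy
  rcases lt_trichotomy (inner ℝ n (y - x)) 0 with h | h | h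
  · refine absurd ?_ hfr.2
    rw [mem_interior_iff_mem_nhds]
    filter_upwards [hball, hcont.continuousAt.eventually (gt_mem_nhds h)] with z hz hz'
    exact (hb z hz).2 hz'
  · exact h
  · obtain ⟨z, hz, hzκ⟩ := mem_closure_iff_nhds.1 hfr.1 _
      (inter_mem hball (hcont.continuousAt.eventually (lt_mem_nhds h)))
    exact absurd ((hb z hz.1).1 hzκ) (not_lt.2 (le_of_lt hz.2))

/-- Faces are relatively open in the frontier: a ball on which κ is a half-space serves every
frontier point inside it, with the same normal. Measurability of the faces and of the normal field
follows. -/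
theorem exists_isOpen_faces {d : ℕ} (κ : Set (Space d)) :
    ∃ W, IsOpen W ∧ faces κ = frontier κ ∩ W := by
  refine ⟨{x | ∃ x₀ n r, x ∈ Metric.ball x₀ r ∧ ‖n‖ = 1 ∧
    ∀ y ∈ Metric.ball x₀ r, y ∈ κ ↔ inner ℝ n (y - x₀) < 0}, ?_, ?_⟩
  · rw [isOpen_iff_mem_nhds]
    rintro x ⟨x₀, n, r, hx, hn, hb⟩
    filter_upwards [Metric.isOpen_ball.mem_nhds hx] with y hy
    exact ⟨x₀, n, r, hy, hn, hb⟩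
  · ext x
    constructor
    · intro hx
      refine ⟨faces_subset_frontier hx, ?_⟩
      obtain ⟨n, hn, r, hr, hb⟩ := hx
      exact ⟨x, n, r, Metric.mem_ball_self hr, hn, hb⟩
    · rintro ⟨hfr, x₀, n, r, hx, hn, hb⟩
      exact ⟨n, .of_inner_eq_zero hn hb hx
        (IsOutwardNormal.inner_eq_zero_of_mem_frontier hb hx hfr)⟩

theorem measurableSet_faces {d : ℕ} (κ : Set (Space d)) : MeasurableSet (faces κ) := by
  obtain ⟨W, hW, h⟩ := exists_isOpen_faces κ
  rw [h]
  exact isClosed_frontier.measurableSet.inter hW.measurableSet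

theorem continuousOn_normal {d : ℕ} (κ : Set (Space d)) : ContinuousOn (normal κ) (faces κ) := by
  intro x hx
  obtain ⟨hn, r, hr, hb⟩ := isOutwardNormal_normal hx
  refine (continuousWithinAt_const (b := normal κ x)).congr_of_eventuallyEq ?_ rfl
  filter_upwards [self_mem_nhdsWithin, mem_nhdsWithin_of_mem_nhds (Metric.ball_mem_nhds x hr)]
    with y hy hyr
  exact (IsOutwardNormal.of_inner_eq_zero hn hb hyr
    (IsOutwardNormal.inner_eq_zero_of_mem_frontier hb hyr (faces_subset_frontier hy))).normal_eq

theorem measurable_normal {d : ℕ} (κ : Set (Space d)) : Measurable (normal κ) := by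
  classical
  have h : normal κ = (faces κ).piecewise (normal κ) fun _ => 0 := by
    funext x
    by_cases hx : x ∈ faces κ
    · simp [hx]
    · have h' : ¬ ∃ n, IsOutwardNormal κ x n := hx
      simp [hx, normal, h']
  rw [h]
  exact (continuousOn_normal κ).measurable_piecewise continuousOn_const (measurableSet_faces κ)

/-- Otherwise κ and the complement of its closure would disconnect t. -/
theorem inter_frontier_nonempty_of_isOpen {X : Type*} [TopologicalSpace X]
    {t κ : Set X} (ht : IsPreconnected t) (hκ : IsOpen κ) (h1 : (t ∩ κ).Nonempty)
    (h2 : ∃ y ∈ t, y ∉ κ) : ∃ y ∈ t, y ∈ frontier κ := by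
  by_contra! hcon
  have hcl : ∀ y ∈ t, y ∉ κ → y ∈ (closure κ)ᶜ := fun y hy hyκ hyc =>
    hcon y hy ⟨hyc, fun hi => hyκ (interior_subset hi)⟩
  obtain ⟨y, hy, hyκ⟩ := h2
  obtain ⟨z, -, hz1, hz2⟩ := ht κ (closure κ)ᶜ hκ isClosed_closure.isOpen_compl
    (fun y hy => (em (y ∈ κ)).imp id (hcl y hy)) h1 ⟨y, hy, hcl y hy hyκ⟩
  exact hz2 (subset_closure hz1)

/-- Near a generic point the frontier lies in one hyperplane, so each of the two open half-balls,
being connected, lies in κ or misses it. Exactly one lies in κ, and regularity of κ excludes the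
case of both. -/
theorem isOutwardNormal_of_generic {d : ℕ} {A : Finset (Space d × ℝ)} (hA : IsArrangement A)
    {κ : Set (Space d)} (hκo : IsOpen κ) (hκi : interior (closure κ) = κ)
    (hfr : frontier κ ⊆ ⋃ h ∈ A, hyp h) {x : Space d} (hx : Generic A x) (hxf : x ∈ frontier κ)
    {h : Space d × ℝ} (hh : h ∈ A) (hxh : x ∈ hyp h) :
    IsOutwardNormal κ x h.1 ∨ IsOutwardNormal κ x (-h.1) := by
  obtain ⟨r, hr, hball⟩ := hx.exists_ball hh hxh
  have hn := hA.norm_eq h hh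
  have hxh' : inner ℝ h.1 x = h.2 := hxh
  have hside : ∀ n : Space d, (n = h.1 ∨ n = -h.1) →
      (Metric.ball x r ∩ {y | inner ℝ n (y - x) < 0} ⊆ κ) ∨
      Disjoint (Metric.ball x r ∩ {y | inner ℝ n (y - x) < 0}) κ := by
    intro n hn'
    by_contra! hcon
    obtain ⟨h1, h2⟩ := hcon
    have hconv : Convex ℝ (Metric.ball x r ∩ {y | inner ℝ n (y - x) < 0}) := by
      refine (convex_ball x r).inter ?_
      have h3 : {y : Space d | inner ℝ n (y - x) < 0} = {y | innerₛₗ ℝ n y < inner ℝ n x} := by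
        ext y
        simp [inner_sub_right]
      rw [h3]
      exact convex_halfSpace_lt (innerₛₗ ℝ n).isLinear _
    obtain ⟨y, hy, hyf⟩ := inter_frontier_nonempty_of_isOpen hconv.isPreconnected hκo
      (Set.not_disjoint_iff_nonempty_inter.1 h2) (Set.not_subset.1 h1)
    have hyh : inner ℝ h.1 y = h.2 := hball y hy.1 (hfr hyf)
    have hy2 : inner ℝ n (y - x) < 0 := hy.2
    rcases hn' with rfl | rfl <;>
      simp [inner_sub_right, hyh, hxh'] at hy2
  -- Since κ is open, a point of κ on the hyperplane can be moved slightly into the half-ball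
  -- towards which n points. This lets the half-balls decide about the hyperplane itself.
  have hpush : ∀ n : Space d, (n = h.1 ∨ n = -h.1) → ∀ y ∈ Metric.ball x r, y ∈ κ →
      0 ≤ inner ℝ n (y - x) → ∃ z ∈ Metric.ball x r ∩ {y | inner ℝ (-n) (y - x) < 0}, z ∈ κ := by
    intro n hn' y hy hyκ hpos
    have hnn : ‖n‖ = 1 := by rcases hn' with rfl | rfl <;> simp [hn]
    obtain ⟨t, ht, hmem⟩ := exists_add_smul_mem n
      (inter_mem (hκo.mem_nhds hyκ) (Metric.isOpen_ball.mem_nhds hy))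
    refine ⟨y + t • n, ⟨hmem.2, ?_⟩, hmem.1⟩
    have : y + t • n - x = (y - x) + t • n := by abel
    simp only [Set.mem_ofPred_eq]
    rw [this, inner_neg_left, inner_add_right, inner_smul_right, real_inner_self_eq_norm_sq, hnn]
    linarith
  have hone : ∀ n : Space d, (n = h.1 ∨ n = -h.1) →
      (Metric.ball x r ∩ {y | inner ℝ n (y - x) < 0} ⊆ κ) →
      Disjoint (Metric.ball x r ∩ {y | inner ℝ (-n) (y - x) < 0}) κ → IsOutwardNormal κ x n := by
    intro n hn' h1 h2
    refine ⟨by rcases hn' with rfl | rfl <;> simp [hn], r, hr, fun y hy => ⟨fun hyκ => ?_,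
      fun hlt => h1 ⟨hy, hlt⟩⟩⟩
    by_contra hcon
    obtain ⟨z, hz, hzκ⟩ := hpush n hn' y hy hyκ (not_lt.1 hcon)
    exact Set.disjoint_left.1 h2 hz hzκ
  rcases hside h.1 (Or.inl rfl) with h1 | h1 <;> rcases hside (-h.1) (Or.inr rfl) with h2 | h2
  -- Both half-balls in κ: the ball lies in the closure of κ, so x is in the interior of the
  -- closure, which is κ, contradicting that x is on the frontier.
  · exfalso
    have hsub : Metric.ball x r ⊆ closure κ := by
      intro y hy
      rcases lt_trichotomy (inner ℝ h.1 (y - x)) 0 with hlt | heq | hgt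
      · exact subset_closure (h1 ⟨hy, hlt⟩)
      · rw [mem_closure_iff_nhds]
        intro W hW
        obtain ⟨t, ht, hmem⟩ := exists_add_smul_mem h.1
          (inter_mem hW (Metric.isOpen_ball.mem_nhds hy))
        refine ⟨y + t • h.1, hmem.1, h2 ⟨hmem.2, ?_⟩⟩
        have : y + t • h.1 - x = (y - x) + t • h.1 := by abel
        simp only [Set.mem_ofPred_eq]
        rw [this, inner_neg_left, inner_add_right, heq, inner_smul_right,
          real_inner_self_eq_norm_sq, hn]
        linarith
      · refine subset_closure (h2 ⟨hy, ?_⟩)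
        simp only [Set.mem_ofPred_eq, inner_neg_left]
        linarith
    have hxκ : x ∈ κ := by
      rw [← hκi]
      exact mem_interior.2 ⟨_, hsub, Metric.isOpen_ball, Metric.mem_ball_self hr⟩
    exact hxf.2 (hκo.interior_eq.symm ▸ hxκ)
  · exact Or.inl (hone _ (Or.inl rfl) h1 h2)
  · refine Or.inr (hone _ (Or.inr rfl) h2 ?_)
    rwa [neg_neg]
  -- Both half-balls miss κ: points of κ near x could lie only on the hyperplane, but then they
  -- could be pushed off it.
  · exfalso
    obtain ⟨y, hy, hyκ⟩ := mem_closure_iff_nhds.1 hxf.1 _ (Metric.ball_mem_nhds x hr)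
    rcases le_or_gt 0 (inner ℝ h.1 (y - x)) with hge | hlt
    · obtain ⟨z, hz, hzκ⟩ := hpush h.1 (Or.inl rfl) y hy hyκ hge
      exact Set.disjoint_left.1 h2 hz hzκ
    · exact Set.disjoint_left.1 h1 ⟨hy, hlt⟩ hyκ

theorem normal_eq_or_of_generic {d : ℕ} {A : Finset (Space d × ℝ)} (hA : IsArrangement A)
    {κ : Set (Space d)} (hκo : IsOpen κ) (hκi : interior (closure κ) = κ)
    (hfr : frontier κ ⊆ ⋃ h ∈ A, hyp h) {x : Space d} (hx : Generic A x) (hxf : x ∈ faces κ)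
    {h : Space d × ℝ} (hh : h ∈ A) (hxh : x ∈ hyp h) :
    normal κ x = h.1 ∨ normal κ x = -h.1 :=
  (isOutwardNormal_of_generic hA hκo hκi hfr hx (faces_subset_frontier hxf) hh hxh).imp
    (fun h => h.normal_eq) fun h => h.normal_eq

theorem surfaceMeasure_lt_top {d : ℕ} {A : Finset (Space d × ℝ)} (hA : IsArrangement A)
    {s : Set (Space d)} (hs : Bornology.IsBounded s) (hsA : s ⊆ ⋃ h ∈ A, hyp h) :
    surfaceMeasure d s < ⊤ := by
  have h1 : s ⊆ ⋃ h ∈ A, s ∩ hyp h := by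
    intro x hx
    obtain ⟨h, hh, hxh⟩ := Set.mem_iUnion₂.1 (hsA hx)
    exact Set.mem_iUnion₂.2 ⟨h, hh, hx, hxh⟩
  refine (measure_mono h1).trans_lt ((measure_biUnion_finset_le _ _).trans_lt ?_)
  exact ENNReal.sum_lt_top.2 fun h hh => surfaceMeasure_inter_hyp_lt_top (hA.norm_eq h hh) hs

end Boltzmann

namespace Boltzmann

open MeasureTheory Filter Topology

/-! ### The divergence theorem on polytopes -/

theorem measurePreserving_line {d : ℕ} {m : Space d} (hm : ‖m‖ = 1) :
    MeasurePreserving (fun p : ℝ × (ℝ ∙ m)ᗮ => (p.2 : Space d) + p.1 • m)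
      ((volume : Measure ℝ).prod volume) volume := by
  have h1 := ((ℝ ∙ m).measurePreserving_measurableEquivProd (0 : Space d)).symm
  rw [InnerProductSpace.euclideanHausdorffMeasure_eq_volume] at h1
  have h2 := (LinearIsometryEquiv.toSpanUnitSingleton m hm).measurePreserving.prod
    (MeasurePreserving.id (volume : Measure (ℝ ∙ m)ᗮ))
  have h3 := h1.comp h2
  refine h3.congr (by fun_prop) (ae_of_all _ fun p => ?_)
  simp [add_comm]

theorem integral_eq_integral_line {d : ℕ} {m : Space d} (hm : ‖m‖ = 1) {F : Space d → ℝ}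
    (hF : Integrable F) : ∫ x, F x = ∫ y : (ℝ ∙ m)ᗮ, ∫ t : ℝ, F ((y : Space d) + t • m) := by
  have hmp := measurePreserving_line hm
  have hint : Integrable (fun p : ℝ × (ℝ ∙ m)ᗮ => F ((p.2 : Space d) + p.1 • m))
      ((volume : Measure ℝ).prod volume) := hmp.integrable_comp_of_integrable hF
  rw [← integral_prod_symm _ hint, ← hmp.map_eq,
    integral_map hmp.measurable.aemeasurable (hmp.map_eq.symm ▸ hF.aestronglyMeasurable)]

/-- Lifting pulls null sets back to null sets, since the surface measure on the hyperplane is a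
positive multiple of the image measure. -/
theorem ae_generic_hypLift {d : ℕ} {A : Finset (Space d × ℝ)} (hA : IsArrangement A)
    {m : Space d} (hm : ‖m‖ = 1) {h : Space d × ℝ} (hh : h ∈ A) (hne : inner ℝ h.1 m ≠ 0) :
    ∀ᵐ y : (ℝ ∙ m)ᗮ, Generic A (hypLift m h y) := by
  have h1 : ∀ᵐ x ∂((surfaceMeasure d).restrict (hyp h)), Generic A x :=
    ae_restrict_of_ae hA.ae_generic
  rw [surfaceMeasure_restrict_hyp hm (hA.norm_eq h hh) hne] at h1
  have hc : ENNReal.ofReal |inner ℝ h.1 m|⁻¹ ≠ 0 := by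
    rw [Ne, ENNReal.ofReal_eq_zero, not_le]
    positivity
  rw [Measure.ae_ennreal_smul_measure_iff hc] at h1
  exact ae_of_ae_map (continuous_hypLift m h).measurable.aemeasurable h1

theorem ae_notMem_hyp {d : ℕ} {m : Space d} {h : Space d × ℝ} (hn : ‖h.1‖ = 1)
    (h0 : inner ℝ h.1 m = 0) : ∀ᵐ y : (ℝ ∙ m)ᗮ, inner ℝ h.1 (y : Space d) ≠ h.2 := by
  refine measure_eq_zero_iff_ae_notMem.1
    (volume_level_set ((innerₛₗ ℝ h.1).comp (Submodule.subtype (ℝ ∙ m)ᗮ)) ?_ h.2)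
  intro hz
  have hmem : h.1 ∈ (ℝ ∙ m)ᗮ := Submodule.mem_orthogonal_singleton_iff_inner_left.2 h0
  have := LinearMap.congr_fun hz ⟨h.1, hmem⟩
  simp [hn] at this

/-- On the line y + t m the set κ can change only where a hyperplane transversal to m is crossed. At
a face it drops by the sign of m·n: leaving counts +1, entering -1. -/
theorem integral_line_eq_sum {d : ℕ} {A : Finset (Space d × ℝ)} (hA : IsArrangement A)
    {κ : Set (Space d)} (hκo : IsOpen κ) (hκb : Bornology.IsBounded κ)
    (hκi : interior (closure κ) = κ) (hfr : frontier κ ⊆ ⋃ h ∈ A, hyp h)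
    {m : Space d} (hm : ‖m‖ = 1) {g : Space d → ℝ} (hg : ContDiff ℝ 1 g) {y : (ℝ ∙ m)ᗮ}
    (hgen : ∀ h ∈ A, inner ℝ h.1 m ≠ 0 → Generic A (hypLift m h y))
    (hpar : ∀ h ∈ A, inner ℝ h.1 m = 0 → inner ℝ h.1 (y : Space d) ≠ h.2) :
    ∫ t : ℝ, κ.indicator (fun x => fderiv ℝ g x m) ((y : Space d) + t • m)
      = ∑ h ∈ A with inner ℝ h.1 m ≠ 0, inner ℝ m (normal κ (hypLift m h y))
          / |inner ℝ m (normal κ (hypLift m h y))| * g (hypLift m h y) := by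
  classical
  set γ : ℝ → Space d := fun t => (y : Space d) + t • m with hγ
  have hγc : Continuous γ := by fun_prop
  set τ : Space d × ℝ → ℝ := fun h => (h.2 - inner ℝ h.1 (y : Space d)) / inner ℝ h.1 m with hτ
  have hγτ : ∀ h, γ (τ h) = hypLift m h y := fun h => rfl
  set B : Finset (Space d × ℝ) := A.filter fun h => inner ℝ h.1 m ≠ 0 with hB
  -- The quotient is the sign of m·n. Off the faces the normal is 0 and the quotient 0/0 = 0, so
  -- crossings of a hyperplane away from the frontier contribute nothing.
  set ε : ℝ → ℝ := fun t => inner ℝ m (normal κ (γ t)) / |inner ℝ m (normal κ (γ t))| with hε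
  have hnot : ∀ t ∉ B.image τ, γ t ∉ frontier κ := by
    intro t ht hfrt
    obtain ⟨h, hh, hmem⟩ := Set.mem_iUnion₂.1 (hfr hfrt)
    have hmem' : inner ℝ h.1 (y : Space d) + t * inner ℝ h.1 m = h.2 := by
      have : inner ℝ h.1 (γ t) = h.2 := hmem
      rwa [hγ, inner_add_right, inner_smul_right] at this
    by_cases h0 : inner ℝ h.1 m = 0
    · rw [h0, mul_zero, add_zero] at hmem'
      exact hpar h hh h0 hmem'
    · refine ht (Finset.mem_image.2 ⟨h, Finset.mem_filter.2 ⟨hh, h0⟩, ?_⟩)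
      simp only [hτ]
      rw [← hmem']
      field_simp
      ring
  have hlocal : ∀ t, γ t ∉ frontier κ → ∀ᶠ u in 𝓝 t, (γ u ∈ κ ↔ γ t ∈ κ) := by
    intro t ht
    by_cases hin : γ t ∈ κ
    · filter_upwards [hγc.continuousAt.eventually (hκo.mem_nhds hin)] with u hu
      exact ⟨fun _ => hin, fun _ => hu⟩
    · have hcl : γ t ∈ (closure κ)ᶜ := fun hc => ht ⟨hc, fun hi => hin (interior_subset hi)⟩
      filter_upwards [hγc.continuousAt.eventually (isClosed_closure.isOpen_compl.mem_nhds hcl)]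
        with u hu
      exact ⟨fun h => absurd (subset_closure h) hu, fun h => absurd h hin⟩
  -- Two hyperplanes crossed at the same parameter would share a generic point and hence coincide.
  have hinj : Set.InjOn τ B := by
    intro h hh h' hh' heq
    have hh1 := Finset.mem_filter.1 hh
    have hh2 := Finset.mem_filter.1 hh'
    have e : hypLift m h y = hypLift m h' y := by rw [← hγτ, ← hγτ, heq]
    exact hgen h hh1.1 hh1.2 h hh1.1 h' hh2.1 (hypLift_mem_hyp hh1.2 y)
      (e ▸ hypLift_mem_hyp hh2.2 y)
  have hderiv : ∀ t, HasDerivAt (fun t => g (γ t)) (fderiv ℝ g (γ t) m) t := by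
    intro t
    have h1 : HasDerivAt γ m t := by
      simpa [hγ] using ((hasDerivAt_id t).smul_const m).const_add (y : Space d)
    exact ((hg.differentiable one_ne_zero).differentiableAt.hasFDerivAt).comp_hasDerivAt t h1
  have hcont : Continuous fun t => fderiv ℝ g (γ t) m :=
    ((hg.continuous_fderiv one_ne_zero).comp hγc).clm_apply continuous_const
  have hmain := setIntegral_deriv_eq_sum_jumps (U := γ ⁻¹' κ) (hκo.preimage hγc).measurableSet
    ?_ (B.image τ) ε ?_ ?_ hderiv hcont
  · rw [Finset.sum_image hinj] at hmain
    rw [← integral_indicator (hκo.preimage hγc).measurableSet] at hmain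
    exact hmain
  · have hiso : Isometry γ := by
      refine Isometry.of_dist_eq fun s t => ?_
      simp [hγ, dist_eq_norm, ← sub_smul, norm_smul, hm]
    exact hiso.antilipschitz.isBounded_preimage hκb
  · intro s hs
    exact hlocal s (hnot s hs)
  · intro t ht
    obtain ⟨h, hhB, rfl⟩ := Finset.mem_image.1 ht
    obtain ⟨hh, h0⟩ := Finset.mem_filter.1 hhB
    have hxh : γ (τ h) ∈ hyp h := hypLift_mem_hyp h0 y
    have hxg : Generic A (γ (τ h)) := hgen h hh h0
    set t := τ h with ht'
    by_cases hxf : γ t ∈ frontier κ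
    · have hface : γ t ∈ faces κ := by
        rcases isOutwardNormal_of_generic hA hκo hκi hfr hxg hxf hh hxh with h1 | h1
        · exact ⟨_, h1⟩
        · exact ⟨_, h1⟩
      have hnz : inner ℝ m (normal κ (γ t)) ≠ 0 := by
        rcases normal_eq_or_of_generic hA hκo hκi hfr hxg hface hh hxh with h1 | h1
        · rwa [h1, real_inner_comm]
        · rw [h1, inner_neg_right, neg_ne_zero, real_inner_comm]
          exact h0
      obtain ⟨-, r, hr, hb⟩ := isOutwardNormal_normal hface
      set a := inner ℝ m (normal κ (γ t)) with ha
      have hnear : ∀ᶠ u in 𝓝 t, (γ u ∈ κ ↔ (u - t) * a < 0) := by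
        filter_upwards [hγc.continuousAt.eventually (Metric.ball_mem_nhds _ hr)] with u hu
        rw [hb _ hu]
        have : γ u - γ t = (u - t) • m := by simp [hγ, sub_smul]
        rw [this, inner_smul_right, real_inner_comm]
      rcases lt_or_gt_of_ne hnz with hneg | hpos
      -- Here m·n < 0: the line enters κ, and the indicator passes from 0 to 1 = 0 - (-1).
      · refine ⟨0, ?_, ?_⟩
        · filter_upwards [hnear.filter_mono nhdsWithin_le_nhds, self_mem_nhdsWithin] with u hu hlt
          refine Set.indicator_of_notMem (fun hmem => ?_) _
          have h1 := hu.1 hmem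
          have h2 : u < t := hlt
          nlinarith
        · filter_upwards [hnear.filter_mono nhdsWithin_le_nhds, self_mem_nhdsWithin] with u hu hlt
          have h2 : t < u := hlt
          have hmem : γ u ∈ κ := hu.2 (mul_neg_of_pos_of_neg (by linarith) hneg)
          rw [Set.indicator_of_mem (show u ∈ γ ⁻¹' κ from hmem)]
          simp only [hε]
          rw [← ha, abs_of_neg hneg, div_neg, div_self hnz]
          norm_num
      · refine ⟨1, ?_, ?_⟩
        · filter_upwards [hnear.filter_mono nhdsWithin_le_nhds, self_mem_nhdsWithin] with u hu hlt
          have h2 : u < t := hlt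
          have hmem : γ u ∈ κ := hu.2 (mul_neg_of_neg_of_pos (by linarith) hpos)
          rw [Set.indicator_of_mem (show u ∈ γ ⁻¹' κ from hmem)]
        · filter_upwards [hnear.filter_mono nhdsWithin_le_nhds, self_mem_nhdsWithin] with u hu hlt
          have h2 : t < u := hlt
          have hnm : u ∉ γ ⁻¹' κ := fun hmem => by
            have h1 := hu.1 hmem
            nlinarith
          rw [Set.indicator_of_notMem hnm]
          simp only [hε]
          rw [← ha, abs_of_pos hpos, div_self hnz, sub_self]
    · have hn0 : ¬ ∃ n, IsOutwardNormal κ (γ t) n := fun hf => hxf (faces_subset_frontier hf)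
      have hε0 : ε t = 0 := by simp [hε, normal, hn0]
      have hconst : ∀ᶠ u in 𝓝 t, (γ ⁻¹' κ).indicator (fun _ => (1 : ℝ)) u
          = (γ ⁻¹' κ).indicator (fun _ => (1 : ℝ)) t := by
        filter_upwards [hlocal t hxf] with u hu
        simp only [Set.indicator, Set.mem_preimage, hu]
      simp only [hε0, sub_zero]
      exact ⟨_, hconst.filter_mono nhdsWithin_le_nhds, hconst.filter_mono nhdsWithin_le_nhds⟩

theorem integrable_of_bounded_faces {d : ℕ} {A : Finset (Space d × ℝ)} (hA : IsArrangement A)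
    {κ : Set (Space d)} (hκb : Bornology.IsBounded κ) (hfr : frontier κ ⊆ ⋃ h ∈ A, hyp h)
    {F : Space d → ℝ} (hF : Measurable F) {C : ℝ} (hC : ∀ x ∈ faces κ, |F x| ≤ C)
    (h0 : ∀ x ∉ faces κ, F x = 0) : Integrable F (surfaceMeasure d) := by
  have hfin : surfaceMeasure d (faces κ) < ⊤ :=
    surfaceMeasure_lt_top hA (hκb.closure.subset (faces_subset_frontier.trans frontier_subset_closure))
      (faces_subset_frontier.trans hfr)
  have h1 : IntegrableOn F (faces κ) (surfaceMeasure d) :=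
    Measure.integrableOn_of_bounded hfin.ne hF.aestronglyMeasurable
      (M := C) ((ae_restrict_iff' (measurableSet_faces κ)).2 (ae_of_all _ hC))
  exact (integrableOn_iff_integrable_of_support_subset fun x hx => by
    by_contra hxf
    exact hx (h0 x hxf)).1 h1

theorem normal_eq_zero {d : ℕ} {κ : Set (Space d)} {x : Space d} (hx : x ∉ faces κ) :
    normal κ x = 0 := dif_neg hx

/-- The divergence theorem for the constant field m: Fubini along lines parallel to m reduces it to
signed values of g at the crossings. The change of variables on each transversal hyperplane restores
the weight m·n. -/
theorem setIntegral_fderiv_eq_faces {d : ℕ} {A : Finset (Space d × ℝ)} (hA : IsArrangement A)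
    {κ : Set (Space d)} (hκo : IsOpen κ) (hκb : Bornology.IsBounded κ)
    (hκi : interior (closure κ) = κ) (hfr : frontier κ ⊆ ⋃ h ∈ A, hyp h)
    {m : Space d} (hm : ‖m‖ = 1) {g : Space d → ℝ} (hg : ContDiff ℝ 1 g) :
    ∫ x in κ, fderiv ℝ g x m
      = ∫ x in faces κ, inner ℝ m (normal κ x) * g x ∂(surfaceMeasure d) := by
  classical
  obtain ⟨C, hC⟩ := hκb.isCompact_closure.exists_bound_of_continuousOn hg.continuous.continuousOn
  have hcl : faces κ ⊆ closure κ := faces_subset_frontier.trans frontier_subset_closure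
  have hmn : Measurable fun x => inner ℝ m (normal κ x) :=
    (measurable_normal κ).const_inner
  have hF : Integrable (fun x => inner ℝ m (normal κ x) * g x) (surfaceMeasure d) := by
    refine integrable_of_bounded_faces hA hκb hfr (hmn.mul hg.continuous.measurable) (C := C)
      (fun x hx => ?_) fun x hx => by simp [normal_eq_zero hx]
    rw [abs_mul]
    have h1 : |inner ℝ m (normal κ x)| ≤ 1 := by
      refine (abs_real_inner_le_norm _ _).trans ?_
      rw [hm, one_mul]
      exact norm_normal_le κ x
    have h2 : |g x| ≤ C := hC x (hcl hx)
    nlinarith [abs_nonneg (g x), abs_nonneg (inner ℝ m (normal κ x))]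
  -- The flux density divided by |m·n|, which is the density seen after projecting along m.
  set G : Space d → ℝ := fun x => inner ℝ m (normal κ x) / |inner ℝ m (normal κ x)| * g x with hGdef
  have hG : Integrable G (surfaceMeasure d) := by
    refine integrable_of_bounded_faces hA hκb hfr ((hmn.div hmn.abs).mul hg.continuous.measurable)
      (C := C) (fun x hx => ?_) fun x hx => by simp [hGdef, normal_eq_zero hx]
    rw [hGdef, abs_mul, abs_div, abs_abs]
    have h1 : |inner ℝ m (normal κ x)| / |inner ℝ m (normal κ x)| ≤ 1 := div_self_le_one _
    have h2 : |g x| ≤ C := hC x (hcl hx)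
    nlinarith [abs_nonneg (g x)]
  have hterm : ∀ h ∈ A, inner ℝ h.1 m ≠ 0 → Integrable (fun y => G (hypLift m h y)) ∧
      ∫ y, G (hypLift m h y)
        = ∫ x in hyp h, inner ℝ m (normal κ x) * g x ∂(surfaceMeasure d) := by
    intro h hh h0
    have hn := hA.norm_eq h hh
    constructor
    · have h1 : Integrable G ((surfaceMeasure d).restrict (hyp h)) := hG.restrict
      rw [surfaceMeasure_restrict_hyp hm hn h0, integrable_smul_measure
        (by rw [Ne, ENNReal.ofReal_eq_zero, not_le]; positivity) ENNReal.ofReal_ne_top] at h1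
      exact (((continuous_hypLift m h).measurableEmbedding
        (hypLift_injective hm h)).integrable_map_iff).1 h1
    · have h1 := setIntegral_hyp hm hn h0 G
      have h2 : ∫ y, G (hypLift m h y) = |inner ℝ h.1 m| * ∫ x in hyp h, G x ∂(surfaceMeasure d) := by
        rw [h1, ← mul_assoc, mul_inv_cancel₀ (abs_ne_zero.2 h0), one_mul]
      rw [h2, ← integral_const_mul]
      refine integral_congr_ae ?_
      filter_upwards [ae_restrict_of_ae hA.ae_generic, ae_restrict_mem (measurableSet_hyp h)]
        with x hx hxh
      by_cases hxf : x ∈ faces κ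
      · have h3 : |inner ℝ m (normal κ x)| = |inner ℝ h.1 m| := by
          rcases normal_eq_or_of_generic hA hκo hκi hfr hx hxf hh hxh with h4 | h4 <;>
            simp [h4, real_inner_comm]
        simp only [hGdef]
        rw [h3, ← mul_assoc, mul_div_cancel₀ _ (abs_ne_zero.2 h0)]
      · simp [hGdef, normal_eq_zero hxf]
  -- Hyperplanes parallel to m are invisible to the slicing, but their faces carry no flux either,
  -- so they may be added back to the sum.
  have hpar0 : ∀ h ∈ A, inner ℝ h.1 m = 0 →
      ∫ x in hyp h, inner ℝ m (normal κ x) * g x ∂(surfaceMeasure d) = 0 := by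
    intro h hh h0
    refine integral_eq_zero_of_ae ?_
    filter_upwards [ae_restrict_of_ae hA.ae_generic, ae_restrict_mem (measurableSet_hyp h)]
      with x hx hxh
    by_cases hxf : x ∈ faces κ
    · have h0' : inner ℝ m h.1 = 0 := by rw [real_inner_comm]; exact h0
      rcases normal_eq_or_of_generic hA hκo hκi hfr hx hxf hh hxh with h4 | h4 <;> simp [h4, h0']
    · simp [normal_eq_zero hxf]
  have hint : Integrable (κ.indicator fun x => fderiv ℝ g x m) := by
    have hc : Continuous fun x => fderiv ℝ g x m :=
      (hg.continuous_fderiv one_ne_zero).clm_apply continuous_const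
    exact ((hc.continuousOn.integrableOn_compact hκb.isCompact_closure).mono_set
      subset_closure).integrable_indicator hκo.measurableSet
  calc ∫ x in κ, fderiv ℝ g x m
      = ∫ x, κ.indicator (fun x => fderiv ℝ g x m) x := (integral_indicator hκo.measurableSet).symm
    _ = ∫ y : (ℝ ∙ m)ᗮ, ∑ h ∈ A with inner ℝ h.1 m ≠ 0, G (hypLift m h y) := by
        rw [integral_eq_integral_line hm hint]
        refine integral_congr_ae ?_
        have hgen : ∀ᵐ y : (ℝ ∙ m)ᗮ, ∀ h ∈ A, inner ℝ h.1 m ≠ 0 → Generic A (hypLift m h y) := by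
          refine (Finset.eventually_all A).2 fun h hh => ?_
          by_cases h0 : inner ℝ h.1 m = 0
          · exact Eventually.of_forall fun y hy => absurd h0 hy
          · filter_upwards [ae_generic_hypLift hA hm hh h0] with y hy _
            exact hy
        have hpar : ∀ᵐ y : (ℝ ∙ m)ᗮ, ∀ h ∈ A, inner ℝ h.1 m = 0 →
            inner ℝ h.1 (y : Space d) ≠ h.2 := by
          refine (Finset.eventually_all A).2 fun h hh => ?_
          by_cases h0 : inner ℝ h.1 m = 0
          · filter_upwards [ae_notMem_hyp (hA.norm_eq h hh) h0] with y hy _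
            exact hy
          · exact Eventually.of_forall fun y hy => absurd hy h0
        filter_upwards [hgen, hpar] with y h1 h2
        exact integral_line_eq_sum hA hκo hκb hκi hfr hm hg h1 h2
    _ = ∑ h ∈ A with inner ℝ h.1 m ≠ 0,
          ∫ x in hyp h, inner ℝ m (normal κ x) * g x ∂(surfaceMeasure d) := by
        rw [integral_finsetSum _ fun h hh => (hterm h (Finset.mem_filter.1 hh).1
          (Finset.mem_filter.1 hh).2).1]
        exact Finset.sum_congr rfl fun h hh => (hterm h (Finset.mem_filter.1 hh).1
          (Finset.mem_filter.1 hh).2).2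
    _ = ∑ h ∈ A, ∫ x in hyp h, inner ℝ m (normal κ x) * g x ∂(surfaceMeasure d) := by
        rw [Finset.sum_filter]
        refine Finset.sum_congr rfl fun h hh => ?_
        by_cases h0 : inner ℝ h.1 m = 0
        · simp [h0, hpar0 h hh h0]
        · simp [h0]
    _ = ∫ x, ∑ h ∈ A, (hyp h).indicator (fun x => inner ℝ m (normal κ x) * g x) x
          ∂(surfaceMeasure d) := by
        rw [integral_finsetSum _ fun h _ => hF.indicator (measurableSet_hyp h)]
        exact Finset.sum_congr rfl fun h _ => (integral_indicator (measurableSet_hyp h)).symm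
    _ = ∫ x, inner ℝ m (normal κ x) * g x ∂(surfaceMeasure d) := by
        refine integral_congr_ae ?_
        -- A generic face point lies on exactly one hyperplane, so exactly one indicator in the sum
        -- is active.
        filter_upwards [hA.ae_generic] with x hx
        by_cases hxf : x ∈ faces κ
        · obtain ⟨h, hh, hxh⟩ := Set.mem_iUnion₂.1 (hfr (faces_subset_frontier hxf))
          rw [Finset.sum_eq_single h, Set.indicator_of_mem hxh]
          · intro h' hh' hne
            exact Set.indicator_of_notMem (fun hx' => hne (hx h' hh' h hh hx' hxh)) _
          · exact fun hn => absurd hh hn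
        · simp [normal_eq_zero hxf, Set.indicator]
    _ = ∫ x in faces κ, inner ℝ m (normal κ x) * g x ∂(surfaceMeasure d) :=
        (setIntegral_eq_integral_of_forall_compl_eq_zero fun x hx => by
          simp [normal_eq_zero hx]).symm

end Boltzmann

namespace Boltzmann

open MeasureTheory Filter Topology

/-! ### Neighbouring elements of a mesh -/

theorem IsOutwardNormal.inter_nonempty {d : ℕ} {κ κ' : Set (Space d)} {x n : Space d}
    (h : IsOutwardNormal κ x n) (h' : IsOutwardNormal κ' x n) : (κ ∩ κ').Nonempty := by
  obtain ⟨-, r, hr, hb⟩ := h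
  obtain ⟨-, r', hr', hb'⟩ := id h'
  obtain ⟨y, hy, hyκ⟩ := mem_closure_iff_nhds.1 h'.mem_closure _
    (inter_mem (Metric.ball_mem_nhds x hr) (Metric.ball_mem_nhds x hr'))
  exact ⟨y, (hb y hy.1).2 ((hb' y hy.2).1 hyκ), hyκ⟩

/-- Near a face point the exterior is the opposite open half-ball: points of the hyperplane belong
to the closure of κ. This identifies the exterior trace with the trace from a neighbour. -/
theorem IsOutwardNormal.nhdsWithin_compl_closure {d : ℕ} {κ : Set (Space d)} {x n : Space d}
    (h : IsOutwardNormal κ x n) :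
    𝓝[(closure κ)ᶜ] x = 𝓝[{y | inner ℝ (-n) (y - x) < 0}] x := by
  obtain ⟨hn, r, hr, hb⟩ := h
  refine nhdsWithin_eq_nhdsWithin (Metric.mem_ball_self hr) Metric.isOpen_ball ?_
  have key : ∀ y ∈ Metric.ball x r, y ∉ closure κ ↔ inner ℝ (-n) (y - x) < 0 := by
    intro y hy
    rw [inner_neg_left, neg_lt_zero]
    constructor
    · intro hyc
      by_contra hcon
      rcases lt_or_eq_of_le (not_lt.1 hcon) with hlt | heq
      · exact hyc (subset_closure ((hb y hy).2 hlt))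
      · exact hyc (IsOutwardNormal.of_inner_eq_zero hn hb hy heq).mem_closure
    · intro hpos hyc
      have hcont : Continuous fun z : Space d => inner ℝ n (z - x) := by fun_prop
      obtain ⟨z, hz, hzκ⟩ := mem_closure_iff_nhds.1 hyc _
        (inter_mem (Metric.isOpen_ball.mem_nhds hy)
          (hcont.continuousAt.eventually (lt_mem_nhds hpos)))
      exact absurd ((hb z hz.1).1 hzκ) (not_lt.2 (le_of_lt hz.2))
  ext y
  exact ⟨fun hy => ⟨(key y hy.2).1 hy.1, hy.2⟩, fun hy => ⟨(key y hy.2).2 hy.1, hy.2⟩⟩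

theorem SpatialMesh.exists_arrangement {d : ℕ} {Ω : Set (Space d)} (T : SpatialMesh Ω) :
    ∃ A : Finset (Space d × ℝ), IsArrangement A ∧
      ∀ i, frontier (T.elem i) ⊆ ⋃ h ∈ A, hyp h := by
  classical
  choose H hH hfr using fun i => (T.isPolytope i).frontier_subset
  obtain ⟨A, hA, hsub⟩ := Boltzmann.exists_arrangement (Finset.univ.biUnion H) (by
    intro h hh
    obtain ⟨i, -, hi⟩ := Finset.mem_biUnion.1 hh
    exact hH i h hi)
  refine ⟨A, hA, fun i x hx => hsub ?_⟩
  obtain ⟨h, hh, hxh⟩ := Set.mem_iUnion₂.1 (hfr i hx)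
  exact Set.mem_iUnion₂.2 ⟨h, Finset.mem_biUnion.2 ⟨i, Finset.mem_univ i, hh⟩, hxh⟩

theorem SpatialMesh.closure_elem_subset {d : ℕ} {Ω : Set (Space d)} (T : SpatialMesh Ω)
    (i : Fin T.card) : closure (T.elem i) ⊆ closure Ω := closure_mono (T.subset i)

/-- Every other element touching x must fill the half-ball opposite to element i. The covering of Ω
supplies one such element and disjointness forbids a second. -/
theorem SpatialMesh.exists_neighbour {d : ℕ} {Ω : Set (Space d)} (T : SpatialMesh Ω)
    (hΩ : IsOpen Ω) {A : Finset (Space d × ℝ)} (hA : IsArrangement A)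
    (hfr : ∀ i, frontier (T.elem i) ⊆ ⋃ h ∈ A, hyp h) {x : Space d} (hx : Generic A x)
    {i : Fin T.card} (hxi : x ∈ faces (T.elem i)) (hxΩ : x ∉ frontier Ω) :
    ∃ j, j ≠ i ∧ x ∈ faces (T.elem j) ∧ normal (T.elem j) x = -normal (T.elem i) x ∧
      𝓝[(closure (T.elem i))ᶜ] x = 𝓝[T.elem j] x ∧
      ∀ k, x ∈ faces (T.elem k) → k = i ∨ k = j := by
  have hn := isOutwardNormal_normal hxi
  set n := normal (T.elem i) x with hndef
  have hcl : ∀ k, x ∈ faces (T.elem k) → x ∈ closure (T.elem k) := fun k hk =>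
    frontier_subset_closure (faces_subset_frontier hk)
  have hxΩ' : x ∈ Ω := by
    by_contra hcon
    exact hxΩ ⟨T.closure_elem_subset i (hcl i hxi), fun hi => hcon (interior_subset hi)⟩
  -- At a generic point both elements are half-spaces bounded by the same plane; equal normals would
  -- make them overlap.
  have hopp : ∀ k, k ≠ i → x ∈ closure (T.elem k) → IsOutwardNormal (T.elem k) x (-n) := by
    intro k hki hxk
    have hnm : x ∉ T.elem k := by
      intro hmem
      obtain ⟨y, hyk, hyi⟩ := mem_closure_iff_nhds.1 (hcl i hxi) _
        ((T.isPolytope k).isOpen.mem_nhds hmem)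
      exact Set.disjoint_left.1 (T.disjoint k i hki) hyk hyi
    have hxf : x ∈ frontier (T.elem k) := ⟨hxk, fun hi => hnm (interior_subset hi)⟩
    obtain ⟨h, hh, hxh⟩ := Set.mem_iUnion₂.1 (hfr k hxf)
    have hni : n = h.1 ∨ n = -h.1 := normal_eq_or_of_generic hA (T.isPolytope i).isOpen
      (T.isPolytope i).interior_closure (hfr i) hx hxi hh hxh
    have hnk : IsOutwardNormal (T.elem k) x n ∨ IsOutwardNormal (T.elem k) x (-n) := by
      have h1 := isOutwardNormal_of_generic hA (T.isPolytope k).isOpen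
        (T.isPolytope k).interior_closure (hfr k) hx hxf hh hxh
      rcases hni with h2 | h2
      · rwa [h2]
      · rw [h2, neg_neg]
        exact h1.symm
    rcases hnk with h1 | h1
    · exact absurd (T.disjoint k i hki) (Set.not_disjoint_iff_nonempty_inter.2
        (h1.inter_nonempty hn))
    · exact h1
  -- Otherwise a neighbourhood of x meets no other closed element, whereas points of Ω just outside
  -- element i must be covered.
  have hex : ∃ j, j ≠ i ∧ x ∈ closure (T.elem j) := by
    by_contra! hcon
    have hev : ∀ᶠ y in 𝓝 x, ∀ k, k ≠ i → y ∉ closure (T.elem k) := by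
      refine eventually_all.2 fun k => ?_
      by_cases hki : k = i
      · exact Eventually.of_forall fun y h => absurd hki h
      · filter_upwards [isClosed_closure.isOpen_compl.mem_nhds (hcon k hki)] with y hy _
        exact hy
    obtain ⟨-, r, hr, hb⟩ := id hn
    obtain ⟨y, hy1, hy2, hy3⟩ : ∃ y, y ∈ (closure (T.elem i))ᶜ ∧ y ∈ Ω ∧
        ∀ k, k ≠ i → y ∉ closure (T.elem k) := by
      have hne : (𝓝[(closure (T.elem i))ᶜ] x).NeBot := by
        rw [hn.nhdsWithin_compl_closure, ← mem_closure_iff_nhdsWithin_neBot,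
          mem_closure_iff_nhds]
        intro W hW
        obtain ⟨t, ht, hmem⟩ := exists_add_smul_mem n hW
        refine ⟨x + t • n, hmem, ?_⟩
        simp [inner_smul_right, hn.1, ht]
      have hΩx : ∀ᶠ y in 𝓝 x, y ∈ Ω := hΩ.mem_nhds hxΩ'
      obtain ⟨y, h1, h2, h3⟩ := ((eventually_mem_nhdsWithin (a := x)
        (s := (closure (T.elem i))ᶜ)).and ((hΩx.and hev).filter_mono
          nhdsWithin_le_nhds)).exists
      exact ⟨y, h1, h2, h3⟩
    have hmem : y ∈ ⋃ k, closure (T.elem k) := T.cover ▸ subset_closure hy2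
    obtain ⟨k, hk⟩ := Set.mem_iUnion.1 hmem
    by_cases hki : k = i
    · exact hy1 (hki ▸ hk)
    · exact hy3 k hki hk
  obtain ⟨j, hji, hxj⟩ := hex
  have hnj := hopp j hji hxj
  refine ⟨j, hji, ⟨_, hnj⟩, hnj.normal_eq, ?_, fun k hk => ?_⟩
  · rw [hn.nhdsWithin_compl_closure, hnj.nhdsWithin_eq]
  · by_contra! hcon
    exact absurd (T.disjoint k j hcon.2) (Set.not_disjoint_iff_nonempty_inter.2
      ((hopp k hcon.1 (hcl k hk)).inter_nonempty hnj))

end Boltzmann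

namespace Boltzmann

open MeasureTheory Filter Topology

/-! ### Regularity of finite element functions -/

theorem measurable_of_piecewise {X ι : Type*} [MeasurableSpace X] [Countable ι] {f : X → ℝ}
    {S : ι → Set X} (hS : ∀ i, MeasurableSet (S i))
    (hf : ∀ i, ∃ F : X → ℝ, Measurable F ∧ ∀ x ∈ S i, f x = F x)
    (h0 : ∀ x ∉ ⋃ i, S i, f x = 0) : Measurable f := by
  choose F hF hfF using hf
  intro B hB
  have h : f ⁻¹' B = (⋃ i, S i ∩ F i ⁻¹' B) ∪ ((⋃ i, S i)ᶜ ∩ (fun _ => (0 : ℝ)) ⁻¹' B) := by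
    ext x
    simp only [Set.mem_preimage, Set.mem_union, Set.mem_iUnion, Set.mem_inter_iff,
      Set.mem_compl_iff]
    constructor
    · intro hx
      by_cases hxS : ∃ i, x ∈ S i
      · obtain ⟨i, hi⟩ := hxS
        exact Or.inl ⟨i, hi, hfF i x hi ▸ hx⟩
      · refine Or.inr ⟨hxS, ?_⟩
        rwa [h0 x (by simpa using hxS)] at hx
    · rintro (⟨i, hi, hx⟩ | ⟨hxS, hx⟩)
      · rwa [hfF i x hi]
      · rwa [h0 x (by simpa using hxS)]
  rw [h]
  exact (MeasurableSet.iUnion fun i => (hS i).inter (hF i hB)).union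
    ((MeasurableSet.iUnion hS).compl.inter (measurable_const hB))

theorem bounded_of_piecewise {X ι : Type*} [Fintype ι] {f : X → ℝ} {S : ι → Set X}
    (hf : ∀ i, ∃ C, ∀ x ∈ S i, |f x| ≤ C) (h0 : ∀ x ∉ ⋃ i, S i, f x = 0) :
    ∃ C, ∀ x, |f x| ≤ C := by
  choose C hC using hf
  refine ⟨∑ i, |C i|, fun x => ?_⟩
  by_cases hx : x ∈ ⋃ i, S i
  · obtain ⟨i, hi⟩ := Set.mem_iUnion.1 hx
    exact ((hC i x hi).trans (le_abs_self _)).trans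
      (Finset.single_le_sum (f := fun i => |C i|) (fun i _ => abs_nonneg _) (Finset.mem_univ i))
  · rw [h0 x hx, abs_zero]
    exact Finset.sum_nonneg fun i _ => abs_nonneg _

theorem ofLp_direction_ne_zero {d : ℕ} (μ : Direction d) :
    (WithLp.ofLp (μ : Space d) : Fin d → ℝ) ≠ 0 := by
  intro h
  have h1 : ‖(μ : Space d)‖ = 1 := by simp
  have h2 : (μ : Space d) = 0 := by
    ext k
    exact congrFun h k
  rw [h2, norm_zero] at h1
  exact zero_ne_one h1

theorem continuous_toCube {d : ℕ} : Continuous (toCube : Direction d → Fin d → ℝ) := by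
  have h1 : Continuous fun μ : Direction d => (WithLp.ofLp (μ : Space d) : Fin d → ℝ) := by
    fun_prop
  refine continuous_pi fun k => Continuous.div ?_ h1.norm fun μ =>
    norm_ne_zero_iff.2 (ofLp_direction_ne_zero μ)
  exact (continuous_apply k).comp h1

theorem norm_toCube {d : ℕ} (μ : Direction d) : ‖toCube μ‖ = 1 := by
  have h : toCube μ = ‖(WithLp.ofLp (μ : Space d) : Fin d → ℝ)‖⁻¹ •
      (WithLp.ofLp (μ : Space d) : Fin d → ℝ) := by
    funext k
    simp [toCube, div_eq_inv_mul]
  rw [h, norm_smul, norm_inv, norm_norm,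
    inv_mul_cancel₀ (norm_ne_zero_iff.2 (ofLp_direction_ne_zero μ))]

/-- The equation for the coordinate `dir` looks closed, but `toCube` has maximum norm one and the
other coordinates are strictly inside (-1, 1). Hence the coordinate `dir` has modulus one, and the
equation amounts to an open sign condition. -/
theorem CubeCell.isOpen_curved {d : ℕ} (c : CubeCell d) : IsOpen c.curved := by
  have hs : c.sgn * c.sgn = 1 := by rcases c.sgn_eq with h | h <;> simp [h]
  have h : c.curved = toCube ⁻¹' ({x | 0 < c.sgn * x c.dir} ∩
      ⋂ k, {x | k ≠ c.dir → c.lo k < x k ∧ x k < c.hi k}) := by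
    ext μ
    simp only [CubeCell.curved, CubeCell.openCell, Set.mem_ofPred_eq, Set.mem_preimage,
      Set.mem_inter_iff, Set.mem_iInter]
    refine and_congr_left fun hk => ⟨fun hd => by rw [hd, hs]; exact one_pos, fun hpos => ?_⟩
    have hle : |toCube μ c.dir| ≤ 1 := by
      have := norm_le_pi_norm (toCube μ) c.dir
      rwa [norm_toCube] at this
    have hge : 1 ≤ |toCube μ c.dir| := by
      by_contra! hlt
      have hn : ‖toCube μ‖ < 1 := (pi_norm_lt_iff one_pos).2 fun k => by
        by_cases hkd : k = c.dir
        · rw [hkd]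
          exact hlt
        · rw [Real.norm_eq_abs, abs_lt]
          exact ⟨(c.le_lo k hkd).trans_lt (hk k hkd).1, (hk k hkd).2.trans_le (c.hi_le k hkd)⟩
      rw [norm_toCube] at hn
      exact lt_irrefl _ hn
    have habs := le_antisymm hle hge
    rcases c.sgn_eq with h1 | h1 <;> rw [h1] at hpos ⊢
    · rw [← habs, abs_of_pos (by linarith)]
    · rw [abs_of_neg (by linarith)] at habs
      linarith
  rw [h]
  refine IsOpen.preimage continuous_toCube (IsOpen.inter ?_ (isOpen_iInter_of_finite fun k => ?_))
  · exact isOpen_lt continuous_const (by fun_prop)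
  · by_cases hk : k = c.dir
    · simp [hk]
    · simp only [ne_eq, hk, not_false_eq_true, forall_true_left]
      exact (isOpen_lt continuous_const (continuous_apply k)).inter
        (isOpen_lt (continuous_apply k) continuous_const)

theorem contDiff_eval {d : ℕ} (P : MvPolynomial (Fin d) ℝ) :
    ContDiff ℝ 1 fun x : Space d => MvPolynomial.eval (fun k => x k) P := by
  induction P using MvPolynomial.induction_on with
  | C a => simpa using contDiff_const
  | add p q hp hq => simpa using hp.add hq
  | mul_X p k hp =>
    have hk : ContDiff ℝ 1 fun x : Space d => x k := by fun_prop
    simpa using hp.mul hk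

/-- `V` is jointly measurable, continuously differentiable in the space variable, and bounded
together with its derivative along the direction variable on `K`. -/
structure SmoothRep {d : ℕ} (K : Set (Space d)) (V : Phase d → ℝ) : Prop where
  measurable : Measurable V
  contDiff : ∀ μ E, ContDiff ℝ 1 fun x => V (x, μ, E)
  measurable_deriv : Measurable fun p : Phase d =>
    fderiv ℝ (fun x => V (x, p.2.1, p.2.2)) p.1 (p.2.1 : Space d)
  bound : ∃ C, ∀ x ∈ K, ∀ (μ : Direction d) (E : ℝ), |V (x, μ, E)| ≤ C ∧
    |fderiv ℝ (fun x => V (x, μ, E)) x (μ : Space d)| ≤ C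

theorem SmoothRep.zero {d : ℕ} (K : Set (Space d)) : SmoothRep K (0 : Phase d → ℝ) where
  measurable := measurable_const
  contDiff μ E := contDiff_const
  measurable_deriv := by simp
  bound := ⟨0, fun x _ μ E => by simp⟩

theorem SmoothRep.add {d : ℕ} {K : Set (Space d)} {V W : Phase d → ℝ} (hV : SmoothRep K V)
    (hW : SmoothRep K W) : SmoothRep K (V + W) := by
  have hd : ∀ x μ E, fderiv ℝ (fun x => (V + W) (x, μ, E)) x
      = fderiv ℝ (fun x => V (x, μ, E)) x + fderiv ℝ (fun x => W (x, μ, E)) x := fun x μ E =>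
    fderiv_add ((hV.contDiff μ E).differentiable one_ne_zero x)
      ((hW.contDiff μ E).differentiable one_ne_zero x)
  obtain ⟨C, hC⟩ := hV.bound
  obtain ⟨C', hC'⟩ := hW.bound
  refine ⟨hV.measurable.add hW.measurable, fun μ E => (hV.contDiff μ E).add (hW.contDiff μ E),
    ?_, C + C', fun x hx μ E => ⟨?_, ?_⟩⟩
  · simp only [hd]
    exact hV.measurable_deriv.add hW.measurable_deriv
  · exact (abs_add_le _ _).trans (add_le_add (hC x hx μ E).1 (hC' x hx μ E).1)
  · rw [hd]
    exact (abs_add_le _ _).trans (add_le_add (hC x hx μ E).2 (hC' x hx μ E).2)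

theorem SmoothRep.smul {d : ℕ} {K : Set (Space d)} {V : Phase d → ℝ} (hV : SmoothRep K V)
    (c : ℝ) : SmoothRep K (c • V) := by
  have hd : ∀ x μ E, fderiv ℝ (fun x => (c • V) (x, μ, E)) x
      = c • fderiv ℝ (fun x => V (x, μ, E)) x := fun x μ E =>
    fderiv_const_smul ((hV.contDiff μ E).differentiable one_ne_zero x) c
  obtain ⟨C, hC⟩ := hV.bound
  refine ⟨hV.measurable.const_smul c, fun μ E => (hV.contDiff μ E).const_smul c,
    ?_, |c| * C, fun x hx μ E => ⟨?_, ?_⟩⟩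
  · simp only [hd]
    exact hV.measurable_deriv.const_smul c
  · rw [Pi.smul_apply, smul_eq_mul, abs_mul]
    exact mul_le_mul_of_nonneg_left (hC x hx μ E).1 (abs_nonneg c)
  · rw [hd, smul_apply, smul_eq_mul, abs_mul]
    exact mul_le_mul_of_nonneg_left (hC x hx μ E).2 (abs_nonneg c)

theorem SmoothRep.product {d : ℕ} {K : Set (Space d)} (hK : IsCompact K) {a : Space d → ℝ}
    (ha : ContDiff ℝ 1 a) {b : Direction d → ℝ} (hb : Measurable b) (hbb : ∃ C, ∀ μ, |b μ| ≤ C)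
    {c : ℝ → ℝ} (hc : Measurable c) (hcb : ∃ C, ∀ E, |c E| ≤ C) :
    SmoothRep K fun p : Phase d => a p.1 * b p.2.1 * c p.2.2 := by
  have hd : ∀ x (μ : Direction d) E, fderiv ℝ (fun x => a x * b μ * c E) x
      = (b μ * c E) • fderiv ℝ a x := by
    intro x μ E
    simp only [mul_assoc]
    rw [fderiv_mul_const (ha.differentiable one_ne_zero x)]
  have hac := ha.continuous
  have hdc : Continuous fun p : Phase d => fderiv ℝ a p.1 (p.2.1 : Space d) :=
    ((ha.continuous_fderiv one_ne_zero).comp continuous_fst).clm_apply (by fun_prop)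
  obtain ⟨B, hB⟩ := hbb
  obtain ⟨C, hC⟩ := hcb
  obtain ⟨A, hA⟩ := hK.exists_bound_of_continuousOn hac.continuousOn
  obtain ⟨A', hA'⟩ := hK.exists_bound_of_continuousOn
    (ha.continuous_fderiv one_ne_zero).continuousOn
  have hprod : ∀ μ E, |b μ * c E| ≤ |B| * |C| := fun μ E => by
    rw [abs_mul]
    exact mul_le_mul ((hB μ).trans (le_abs_self B)) ((hC E).trans (le_abs_self C))
      (abs_nonneg _) (abs_nonneg _)
  refine ⟨(((hac.measurable.comp measurable_fst).mul
      (hb.comp (measurable_fst.comp measurable_snd))).mul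
      (hc.comp (measurable_snd.comp measurable_snd))),
    fun μ E => (ha.mul (contDiff_const (c := b μ))).mul (contDiff_const (c := c E)), ?_,
    max |A| |A'| * (|B| * |C|), fun x hx μ E => ⟨?_, ?_⟩⟩
  · simp only [hd, smul_apply, smul_eq_mul]
    exact ((hb.comp (measurable_fst.comp measurable_snd)).mul
      (hc.comp (measurable_snd.comp measurable_snd))).mul hdc.measurable
  · simp only
    rw [mul_assoc, abs_mul]
    exact mul_le_mul (((hA x hx).trans (le_abs_self A)).trans (le_max_left _ _)) (hprod μ E)
      (abs_nonneg _) ((abs_nonneg A).trans (le_max_left _ _))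
  · rw [hd, smul_apply, smul_eq_mul, abs_mul, mul_comm]
    refine mul_le_mul ?_ (hprod μ E) (abs_nonneg _) ((abs_nonneg A).trans (le_max_left _ _))
    have h1 := (fderiv ℝ a x).le_opNorm (μ : Space d)
    rw [show ‖(μ : Space d)‖ = 1 by simp, mul_one] at h1
    exact ((h1.trans (hA' x hx)).trans (le_abs_self A')).trans (le_max_right _ _)

theorem AngularMesh.measurable_of_mem_space {d : ℕ} (T : AngularMesh d) {q : ℕ}
    {b : Direction d → ℝ} (hb : b ∈ T.space q) : Measurable b :=
  measurable_of_piecewise (fun j => (T.cell j).isOpen_curved.measurableSet) (fun j => by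
    obtain ⟨Q, -, -, hQ⟩ := hb.1 j
    exact ⟨fun μ => MvPolynomial.eval (toCube μ) Q,
      (Q.continuous_eval.comp continuous_toCube).measurable, hQ⟩) hb.2

theorem AngularMesh.bounded_of_mem_space {d : ℕ} (T : AngularMesh d) {q : ℕ}
    {b : Direction d → ℝ} (hb : b ∈ T.space q) : ∃ C, ∀ μ, |b μ| ≤ C :=
  bounded_of_piecewise (fun j => by
    obtain ⟨Q, -, -, hQ⟩ := hb.1 j
    obtain ⟨C, hC⟩ := (isCompact_closedBall (0 : Fin d → ℝ) 1).exists_bound_of_continuousOn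
      Q.continuous_eval.continuousOn
    refine ⟨C, fun μ hμ => ?_⟩
    rw [hQ μ hμ]
    exact hC _ (by simp [norm_toCube])) hb.2

theorem EnergyMesh.group_subset {Emin Emax : ℝ} (T : EnergyMesh Emin Emax) (g : Fin T.card) :
    T.group g ⊆ Set.Icc Emin Emax := by
  intro E hE
  have h1 := T.anti.antitone (Fin.le_last g.succ)
  have h2 := T.anti.antitone (Fin.zero_le g.castSucc)
  rw [T.node_last] at h1
  rw [T.node_zero] at h2
  exact ⟨h1.trans hE.1.le, hE.2.le.trans h2⟩

theorem EnergyMesh.measurable_of_mem_space {Emin Emax : ℝ} (T : EnergyMesh Emin Emax) {r : ℕ}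
    {c : ℝ → ℝ} (hc : c ∈ T.space r) : Measurable c :=
  measurable_of_piecewise (fun _ => measurableSet_Ioo) (fun g => by
    obtain ⟨R, -, hR⟩ := hc.1 g
    exact ⟨fun E => R.eval E, R.continuous.measurable, hR⟩) hc.2

theorem EnergyMesh.bounded_of_mem_space {Emin Emax : ℝ} (T : EnergyMesh Emin Emax) {r : ℕ}
    {c : ℝ → ℝ} (hc : c ∈ T.space r) : ∃ C, ∀ E, |c E| ≤ C :=
  bounded_of_piecewise (fun g => by
    obtain ⟨R, -, hR⟩ := hc.1 g
    obtain ⟨C, hC⟩ := (isCompact_Icc (a := Emin) (b := Emax)).exists_bound_of_continuousOn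
      R.continuous.continuousOn
    refine ⟨C, fun E hE => ?_⟩
    rw [hR E hE]
    exact hC E (T.group_subset g hE)) hc.2

theorem SpatialMesh.measurable_of_mem_space {d : ℕ} {Ω : Set (Space d)} (T : SpatialMesh Ω)
    {p : ℕ} {a : Space d → ℝ} (ha : a ∈ T.space p) : Measurable a :=
  measurable_of_piecewise (fun i => (T.isPolytope i).isOpen.measurableSet) (fun i => by
    obtain ⟨P, -, hP⟩ := ha.1 i
    exact ⟨_, (contDiff_eval P).continuous.measurable, hP⟩) ha.2

namespace Discretisation

variable {d : ℕ} {pb : Problem d} (D : Discretisation pb)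

theorem isCompact_closure_domain (pb : Problem d) : IsCompact (closure pb.Ω) :=
  pb.isBounded_Ω.isCompact_closure

/-- On one element the spatial polynomials extend to all of space. The representative depends on the
element; its values on the faces are the interior traces. -/
theorem exists_smoothRep {v : Phase d → ℝ} (hv : v ∈ D.feSpace) (i : Fin D.spatial.card) :
    ∃ V, SmoothRep (closure pb.Ω) V ∧ ∀ x ∈ D.spatial.elem i, ∀ μ E, v (x, μ, E) = V (x, μ, E) := by
  induction hv using Submodule.span_induction with
  | mem v hv =>
    obtain ⟨a, ha, b, hb, c, hc, rfl⟩ := hv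
    obtain ⟨P, -, hP⟩ := ha.1 i
    refine ⟨_, SmoothRep.product (isCompact_closure_domain pb) (contDiff_eval P)
      (D.angular.measurable_of_mem_space hb) (D.angular.bounded_of_mem_space hb)
      (D.energy.measurable_of_mem_space hc) (D.energy.bounded_of_mem_space hc),
      fun x hx μ E => ?_⟩
    simp only [hP x hx]
  | zero => exact ⟨0, .zero _, fun _ _ _ _ => rfl⟩
  | add v w _ _ hv hw =>
    obtain ⟨V, hV, hVv⟩ := hv
    obtain ⟨W, hW, hWw⟩ := hw
    exact ⟨V + W, hV.add hW, fun x hx μ E => by simp [hVv x hx, hWw x hx]⟩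
  | smul c v _ hv =>
    obtain ⟨V, hV, hVv⟩ := hv
    exact ⟨c • V, hV.smul c, fun x hx μ E => by simp [hVv x hx]⟩

theorem measurable_of_mem_feSpace {v : Phase d → ℝ} (hv : v ∈ D.feSpace) : Measurable v := by
  induction hv using Submodule.span_induction with
  | mem v hv =>
    obtain ⟨a, ha, b, hb, c, hc, rfl⟩ := hv
    exact (((D.spatial.measurable_of_mem_space ha).comp measurable_fst).mul
      ((D.angular.measurable_of_mem_space hb).comp (measurable_fst.comp measurable_snd))).mul
      ((D.energy.measurable_of_mem_space hc).comp (measurable_snd.comp measurable_snd))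
  | zero => exact measurable_const
  | add v w _ _ hv hw => exact hv.add hw
  | smul c v _ hv => exact hv.const_smul c

theorem eq_zero_of_mem_feSpace {v : Phase d → ℝ} (hv : v ∈ D.feSpace) {y : Phase d}
    (hy : y.1 ∉ (⋃ i, D.spatial.elem i) ∨ y.2.1 ∉ (⋃ j, (D.angular.cell j).curved) ∨
      y.2.2 ∉ ⋃ g, D.energy.group g) : v y = 0 := by
  induction hv using Submodule.span_induction with
  | mem v hv =>
    obtain ⟨a, ha, b, hb, c, hc, rfl⟩ := hv
    rcases hy with h | h | h
    · simp [ha.2 _ h]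
    · simp [hb.2 _ h]
    · simp [hc.2 _ h]
  | zero => rfl
  | add v w _ _ hv hw => simp [hv, hw]
  | smul c v _ hv => simp [hv]

theorem bounded_of_mem_feSpace {v : Phase d → ℝ} (hv : v ∈ D.feSpace) : ∃ C, ∀ y, |v y| ≤ C := by
  refine bounded_of_piecewise (S := fun i => {y : Phase d | y.1 ∈ D.spatial.elem i})
    (fun i => ?_) fun y hy => D.eq_zero_of_mem_feSpace hv (Or.inl ?_)
  · obtain ⟨V, hV, hVv⟩ := D.exists_smoothRep hv i
    obtain ⟨C, hC⟩ := hV.bound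
    refine ⟨C, fun y hy => ?_⟩
    rw [show v y = V y from hVv y.1 hy y.2.1 y.2.2]
    exact (hC y.1 (subset_closure (D.spatial.subset i hy)) y.2.1 y.2.2).1
  · simpa using hy

theorem continuousOn_of_mem_feSpace {v : Phase d → ℝ} (hv : v ∈ D.feSpace)
    (i : Fin D.spatial.card) (j : Fin D.angular.card) (g : Fin D.energy.card) :
    ContinuousOn v (D.spatial.elem i ×ˢ (D.angular.cell j).curved ×ˢ D.energy.group g) := by
  induction hv using Submodule.span_induction with
  | mem v hv =>
    obtain ⟨a, ha, b, hb, c, hc, rfl⟩ := hv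
    obtain ⟨P, -, hP⟩ := ha.1 i
    obtain ⟨Q, -, -, hQ⟩ := hb.1 j
    obtain ⟨R, -, hR⟩ := hc.1 g
    have h1 : Continuous fun y : Phase d => MvPolynomial.eval (fun k => y.1 k) P :=
      (contDiff_eval P).continuous.comp continuous_fst
    have h2 : Continuous fun y : Phase d => MvPolynomial.eval (toCube y.2.1) Q :=
      (Q.continuous_eval.comp continuous_toCube).comp (continuous_fst.comp continuous_snd)
    have h3 : Continuous fun y : Phase d => R.eval y.2.2 :=
      R.continuous.comp (continuous_snd.comp continuous_snd)
    refine ((h1.mul h2).mul h3).continuousOn.congr fun y hy => ?_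
    simp only [hP _ hy.1, hQ _ hy.2.1, hR _ hy.2.2, Pi.mul_apply]
  | zero => exact continuousOn_const
  | add v w _ _ hv hw => exact hv.add hw
  | smul c v _ hv => exact hv.const_smul c

/-- The product of Lebesgue measure on the domain, surface measure on the sphere and Lebesgue
measure on the energy domain. -/
noncomputable abbrev phaseMeasure (pb : Problem d) : Measure (Phase d) :=
  (volume.restrict pb.Ω).prod ((sphereMeasure d).prod (volume.restrict pb.energies))

/-- On each open mesh element v is continuous, so a nonzero value would persist on an open set of
positive measure; elsewhere the canonical representative is zero. This makes the mass form definite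
on pointwise functions. -/
theorem eq_zero_of_ae_eq_zero {v : Phase d → ℝ} (hv : v ∈ D.feSpace)
    (h0 : ∀ᵐ y ∂(phaseMeasure pb), v y = 0) : v = 0 := by
  funext y
  by_cases hy : y.1 ∉ (⋃ i, D.spatial.elem i) ∨ y.2.1 ∉ (⋃ j, (D.angular.cell j).curved) ∨
      y.2.2 ∉ ⋃ g, D.energy.group g
  · exact D.eq_zero_of_mem_feSpace hv hy
  push Not at hy
  obtain ⟨hi, hj, hg⟩ := hy
  obtain ⟨i, hi⟩ := Set.mem_iUnion.1 hi
  obtain ⟨j, hj⟩ := Set.mem_iUnion.1 hj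
  obtain ⟨g, hg⟩ := Set.mem_iUnion.1 hg
  by_contra hne
  set O : Set (Phase d) := D.spatial.elem i ×ˢ (D.angular.cell j).curved ×ˢ D.energy.group g
  have hO : IsOpen O := (D.spatial.isPolytope i).isOpen.prod
    ((D.angular.cell j).isOpen_curved.prod isOpen_Ioo)
  have hO' : IsOpen (O ∩ v ⁻¹' {0}ᶜ) :=
    (D.continuousOn_of_mem_feSpace hv i j g).isOpen_inter_preimage hO isOpen_compl_singleton
  have hσ : ((sphereMeasure d).prod (volume : Measure ℝ)).IsOpenPosMeasure :=
    Measure.prod.instIsOpenPosMeasure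
  have hpm : ((volume : Measure (Space d)).prod
      ((sphereMeasure d).prod (volume : Measure ℝ))).IsOpenPosMeasure :=
    Measure.prod.instIsOpenPosMeasure
  have hpos : 0 < (volume.prod ((sphereMeasure d).prod volume) : Measure (Phase d))
      (O ∩ v ⁻¹' {0}ᶜ) := hO'.measure_pos _ ⟨y, ⟨hi, hj, hg⟩, hne⟩
  have hm : phaseMeasure pb = (volume.prod ((sphereMeasure d).prod volume)).restrict
      (pb.Ω ×ˢ Set.univ ×ˢ pb.energies) := by
    rw [← Measure.prod_restrict, ← Measure.prod_restrict, Measure.restrict_univ]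
  have hsub : O ∩ v ⁻¹' {0}ᶜ ⊆ pb.Ω ×ˢ Set.univ ×ˢ pb.energies := fun z hz =>
    ⟨D.spatial.subset i hz.1.1, Set.mem_univ _, D.energy.group_subset g hz.1.2.2⟩
  have hz : phaseMeasure pb (O ∩ v ⁻¹' {0}ᶜ) = 0 :=
    measure_mono_null (fun z hz => hz.2) (ae_iff.1 h0)
  rw [hm, Measure.restrict_apply hO'.measurableSet, Set.inter_eq_left.2 hsub] at hz
  exact hpos.ne' hz

end Discretisation

end Boltzmann

namespace Boltzmann

open MeasureTheory Filter Topology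

/-! ### Bounded measurable functions and weighted bilinear forms -/

/-- Bounded measurable real functions. -/
structure BddMeas {X : Type*} [MeasurableSpace X] (f : X → ℝ) : Prop where
  measurable : Measurable f
  bound : ∃ C, ∀ x, |f x| ≤ C

namespace BddMeas

variable {X Y : Type*} [MeasurableSpace X] [MeasurableSpace Y] {f g : X → ℝ}

theorem const (c : ℝ) : BddMeas fun _ : X => c := ⟨measurable_const, |c|, fun _ => le_rfl⟩

theorem mul (hf : BddMeas f) (hg : BddMeas g) : BddMeas fun x => f x * g x := by
  obtain ⟨C, hC⟩ := hf.bound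
  obtain ⟨C', hC'⟩ := hg.bound
  refine ⟨hf.measurable.mul hg.measurable, C * C', fun x => ?_⟩
  rw [abs_mul]
  exact mul_le_mul (hC x) (hC' x) (abs_nonneg _) ((abs_nonneg _).trans (hC x))

theorem add (hf : BddMeas f) (hg : BddMeas g) : BddMeas fun x => f x + g x := by
  obtain ⟨C, hC⟩ := hf.bound
  obtain ⟨C', hC'⟩ := hg.bound
  exact ⟨hf.measurable.add hg.measurable, C + C', fun x =>
    (abs_add_le _ _).trans (add_le_add (hC x) (hC' x))⟩

theorem neg (hf : BddMeas f) : BddMeas fun x => -f x := by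
  simpa using (BddMeas.const (-1 : ℝ)).mul hf

theorem sub (hf : BddMeas f) (hg : BddMeas g) : BddMeas fun x => f x - g x := by
  simpa [sub_eq_add_neg] using hf.add hg.neg

theorem sum {ι : Type*} (s : Finset ι) {f : ι → X → ℝ} (hf : ∀ i ∈ s, BddMeas (f i)) :
    BddMeas fun x => ∑ i ∈ s, f i x := by
  classical
  induction s using Finset.induction_on with
  | empty => simpa using BddMeas.const (0 : ℝ)
  | insert i s hi ih =>
    simp only [Finset.sum_insert hi]
    exact (hf i (Finset.mem_insert_self i s)).add
      (ih fun j hj => hf j (Finset.mem_insert_of_mem hj))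

theorem comp (hf : BddMeas f) {u : Y → X} (hu : Measurable u) : BddMeas fun y => f (u y) := by
  obtain ⟨C, hC⟩ := hf.bound
  exact ⟨hf.measurable.comp hu, C, fun y => hC (u y)⟩

theorem indicator (hf : BddMeas f) {s : Set X} (hs : MeasurableSet s) :
    BddMeas (s.indicator f) := by
  obtain ⟨C, hC⟩ := hf.bound
  refine ⟨hf.measurable.indicator hs, C, fun x => ?_⟩
  by_cases hx : x ∈ s
  · rw [Set.indicator_of_mem hx]
    exact hC x
  · rw [Set.indicator_of_notMem hx, abs_zero]
    exact (abs_nonneg _).trans (hC x)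

theorem integrable_mul (hf : BddMeas f) {m : Measure X} {k : X → ℝ} (hk : Integrable k m) :
    Integrable (fun x => k x * f x) m := by
  obtain ⟨C, hC⟩ := hf.bound
  exact hk.mul_bdd hf.measurable.aestronglyMeasurable (ae_of_all _ hC)

theorem integrable (hf : BddMeas f) (m : Measure X) [IsFiniteMeasure m] : Integrable f m := by
  simpa using hf.integrable_mul (integrable_const (1 : ℝ) : Integrable (fun _ => (1 : ℝ)) m)

end BddMeas

/-- The bilinear form `(w, v) ↦ ∫ k (L₁ w) (L₂ v)`. -/
noncomputable def weightedForm {F X : Type*} [AddCommGroup F] [Module ℝ F] [MeasurableSpace X]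
    {m : Measure X} {k : X → ℝ} (hk : Integrable k m) (L₁ L₂ : F →ₗ[ℝ] X → ℝ)
    (h₁ : ∀ w, BddMeas (L₁ w)) (h₂ : ∀ v, BddMeas (L₂ v)) : F →ₗ[ℝ] F →ₗ[ℝ] ℝ :=
  have hint : ∀ w v, Integrable (fun x => k x * L₁ w x * L₂ v x) m := fun w v =>
    (h₂ v).integrable_mul ((h₁ w).integrable_mul hk)
  LinearMap.mk₂ ℝ (fun w v => ∫ x, k x * L₁ w x * L₂ v x ∂m)
    (fun w w' v => by
      rw [← integral_add (hint w v) (hint w' v)]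
      refine integral_congr_ae (ae_of_all _ fun x => ?_)
      simp only [map_add, Pi.add_apply]
      ring)
    (fun c w v => by
      rw [smul_eq_mul, ← integral_const_mul]
      refine integral_congr_ae (ae_of_all _ fun x => ?_)
      simp only [map_smul, Pi.smul_apply, smul_eq_mul]
      ring)
    (fun w v v' => by
      rw [← integral_add (hint w v) (hint w v')]
      refine integral_congr_ae (ae_of_all _ fun x => ?_)
      simp only [map_add, Pi.add_apply]
      ring)
    (fun c w v => by
      rw [smul_eq_mul, ← integral_const_mul]
      refine integral_congr_ae (ae_of_all _ fun x => ?_)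
      simp only [map_smul, Pi.smul_apply, smul_eq_mul]
      ring)

theorem weightedForm_apply {F X : Type*} [AddCommGroup F] [Module ℝ F] [MeasurableSpace X]
    {m : Measure X} {k : X → ℝ} (hk : Integrable k m) (L₁ L₂ : F →ₗ[ℝ] X → ℝ)
    (h₁ : ∀ w, BddMeas (L₁ w)) (h₂ : ∀ v, BddMeas (L₂ v)) (w v : F) :
    weightedForm hk L₁ L₂ h₁ h₂ w v = ∫ x, k x * L₁ w x * L₂ v x ∂m := rfl

/-- The linear form `v ↦ ∫ k (L v)`. -/
noncomputable def weightedFunctional {F X : Type*} [AddCommGroup F] [Module ℝ F]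
    [MeasurableSpace X] {m : Measure X} {k : X → ℝ} (hk : Integrable k m) (L : F →ₗ[ℝ] X → ℝ)
    (h : ∀ v, BddMeas (L v)) : F →ₗ[ℝ] ℝ where
  toFun v := ∫ x, k x * L v x ∂m
  map_add' v v' := by
    rw [← integral_add ((h v).integrable_mul hk) ((h v').integrable_mul hk)]
    refine integral_congr_ae (ae_of_all _ fun x => ?_)
    simp only [map_add, Pi.add_apply]
    ring
  map_smul' c v := by
    rw [RingHom.id_apply, smul_eq_mul, ← integral_const_mul]
    refine integral_congr_ae (ae_of_all _ fun x => ?_)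
    simp only [map_smul, Pi.smul_apply, smul_eq_mul]
    ring

/-! ### Iterated integrals -/

section Iterated

variable {X Y Z : Type*} [MeasurableSpace X] [MeasurableSpace Y] [MeasurableSpace Z]
  {τ τ' : Measure X} {σ : Measure Y} {e : Measure Z} [SFinite τ] [SFinite τ'] [SFinite σ]
  [SFinite e]

theorem integral_integral_congr_of_ae {F : Y → Z → ℝ} {G : Y × Z → ℝ}
    (h : ∀ᵐ p ∂(σ.prod e), F p.1 p.2 = G p) (hG : Integrable G (σ.prod e)) :
    ∫ z, ∫ y, F y z ∂σ ∂e = ∫ p, G p ∂(σ.prod e) := by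
  have h1 : Integrable (fun p : Y × Z => F p.1 p.2) (σ.prod e) :=
    hG.congr (h.mono fun _ hp => hp.symm)
  rw [← integral_congr_ae h, integral_prod_symm _ h1]

/-- It merges a volume and a surface contribution, living on different spatial measures, into
product integrals. The inner identity is needed only for almost every direction and energy. -/
theorem iterated_integral_add_eq {F : Y → Z → ℝ} {f₁ f₂ : X × Y × Z → ℝ}
    (hf₁ : Integrable f₁ (τ.prod (σ.prod e))) (hf₂ : Integrable f₂ (τ'.prod (σ.prod e)))
    (h : ∀ᵐ p ∂(σ.prod e), F p.1 p.2 = ∫ x, f₁ (x, p) ∂τ + ∫ x, f₂ (x, p) ∂τ') :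
    ∫ z, ∫ y, F y z ∂σ ∂e
      = ∫ q, f₁ q ∂(τ.prod (σ.prod e)) + ∫ q, f₂ q ∂(τ'.prod (σ.prod e)) := by
  rw [integral_integral_congr_of_ae h (hf₁.integral_prod_right.add hf₂.integral_prod_right),
    integral_add hf₁.integral_prod_right hf₂.integral_prod_right, integral_prod_symm _ hf₁,
    integral_prod_symm _ hf₂]

theorem iterated_integral_eq {F : Y → Z → ℝ} {f : X × Y × Z → ℝ}
    (hf : Integrable f (τ.prod (σ.prod e)))
    (h : ∀ᵐ p ∂(σ.prod e), F p.1 p.2 = ∫ x, f (x, p) ∂τ) :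
    ∫ z, ∫ y, F y z ∂σ ∂e = ∫ q, f q ∂(τ.prod (σ.prod e)) := by
  rw [integral_integral_congr_of_ae h hf.integral_prod_right, integral_prod_symm _ hf]

variable {ν : Measure Y} [SFinite ν]

theorem integrable_assoc {H : X × Y × Y → ℝ} (hH : Integrable H (τ.prod (ν.prod ν))) :
    Integrable (fun r : (X × Y) × Y => H (r.1.1, r.1.2, r.2)) ((τ.prod ν).prod ν) :=
  (measurePreserving_prodAssoc τ ν ν).integrable_comp_of_integrable hH

theorem integral_assoc {H : X × Y × Y → ℝ} (hH : Integrable H (τ.prod (ν.prod ν))) :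
    ∫ r, ∫ q, H (r.1, r.2, q) ∂ν ∂(τ.prod ν) = ∫ z, H z ∂(τ.prod (ν.prod ν)) := by
  rw [← (measurePreserving_prodAssoc τ ν ν).integral_comp' H]
  exact (integral_prod _ (integrable_assoc hH)).symm

theorem measurePreserving_swap_snd :
    MeasurePreserving (fun z : X × Y × Y => (z.1, z.2.2, z.2.1)) (τ.prod (ν.prod ν))
      (τ.prod (ν.prod ν)) :=
  (MeasurePreserving.id τ).prod (Measure.measurePreserving_swap (μ := ν) (ν := ν))

theorem integrable_swap_snd {H : X × Y × Y → ℝ} (hH : Integrable H (τ.prod (ν.prod ν))) :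
    Integrable (fun z : X × Y × Y => H (z.1, z.2.2, z.2.1)) (τ.prod (ν.prod ν)) :=
  measurePreserving_swap_snd.integrable_comp_of_integrable hH

theorem integral_swap_snd {H : X × Y × Y → ℝ} (hH : Integrable H (τ.prod (ν.prod ν))) :
    ∫ z : X × Y × Y, H (z.1, z.2.2, z.2.1) ∂(τ.prod (ν.prod ν)) = ∫ z, H z ∂(τ.prod (ν.prod ν)) := by
  have hmp := measurePreserving_swap_snd (τ := τ) (ν := ν)
  rw [← integral_map hmp.measurable.aemeasurable (hmp.map_eq.symm ▸ hH.aestronglyMeasurable),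
    hmp.map_eq]

end Iterated

end Boltzmann

namespace Boltzmann

open MeasureTheory Filter Topology

/-! ### The cross-sections and the scattering form as integrals over product spaces -/

theorem ae_ae_of_ae_prod_swap {X Y : Type*} [MeasurableSpace X] [MeasurableSpace Y]
    {τ : Measure X} {ν : Measure Y} [SFinite τ] [SFinite ν] {p : X × Y → Prop}
    (h : ∀ᵐ z ∂(τ.prod ν), p z) : ∀ᵐ y ∂ν, ∀ᵐ x ∂τ, p (x, y) := by
  have h1 : ∀ᵐ z ∂(ν.prod τ), p z.swap :=
    (Measure.measurePreserving_swap (μ := ν) (ν := τ)).quasiMeasurePreserving.ae h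
  exact Measure.ae_ae_of_ae_prod h1

/-- The kernel is integrable only jointly, so Fubini on its sections holds almost everywhere. This
is why β, γ and the scattering operator are identified only almost everywhere. -/
theorem ae_iterated_eq {X Y Z : Type*} [MeasurableSpace X] [MeasurableSpace Y] [MeasurableSpace Z]
    {τ : Measure X} {σ : Measure Y} {e : Measure Z} [SFinite τ] [SFinite σ] [SFinite e]
    {H : X × (Y × Z) × (Y × Z) → ℝ} (hH : Integrable H (τ.prod ((σ.prod e).prod (σ.prod e)))) :
    ∀ᵐ r ∂(τ.prod (σ.prod e)), ∫ z, ∫ y, H (r.1, r.2, (y, z)) ∂σ ∂e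
      = ∫ q, H (r.1, r.2, q) ∂(σ.prod e) := by
  filter_upwards [(integrable_assoc hH).prod_right_ae] with r hr
  exact (integral_prod_symm _ hr).symm

namespace Problem

variable {d : ℕ} (pb : Problem d)

/-- The product measure on directions and energies. -/
noncomputable abbrev angleEnergy : Measure (Direction d × ℝ) :=
  (sphereMeasure d).prod (volume.restrict pb.energies)

/-- The product measure on pairs of states at a common position. -/
noncomputable abbrev scatterMeasure :
    Measure (Space d × (Direction d × ℝ) × (Direction d × ℝ)) :=
  (volume.restrict pb.Ω).prod (pb.angleEnergy.prod pb.angleEnergy)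

/-- The scattering kernel as a function of the position and of the states before and after. -/
noncomputable def kernel (z : Space d × (Direction d × ℝ) × (Direction d × ℝ)) : ℝ :=
  pb.θ z.1 (inner ℝ (z.2.1.1 : Space d) (z.2.2.1 : Space d)) z.2.1.2 z.2.2.2

instance isFiniteMeasure_energies : IsFiniteMeasure (volume.restrict pb.energies) :=
  ⟨by simp [energies]⟩

instance isFiniteMeasure_domain : IsFiniteMeasure (volume.restrict pb.Ω) :=
  ⟨by simpa using pb.isBounded_Ω.measure_lt_top⟩

theorem measurableSet_energies : MeasurableSet pb.energies := measurableSet_Icc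

theorem integrable_kernel : Integrable pb.kernel pb.scatterMeasure := pb.θ_integrable

theorem ae_mem : ∀ᵐ y ∂(Discretisation.phaseMeasure pb), y.1 ∈ pb.Ω ∧ y.2.2 ∈ pb.energies := by
  have h1 : ∀ᵐ y ∂(Discretisation.phaseMeasure pb), y.1 ∈ pb.Ω :=
    Measure.quasiMeasurePreserving_fst.ae (ae_restrict_mem pb.isOpen_Ω.measurableSet)
  have h2 : ∀ᵐ y ∂(Discretisation.phaseMeasure pb), y.2.2 ∈ pb.energies :=
    (Measure.quasiMeasurePreserving_snd.comp Measure.quasiMeasurePreserving_snd).ae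
      (ae_restrict_mem pb.measurableSet_energies)
  exact h1.and h2

theorem ae_kernel_nonneg : ∀ᵐ z ∂pb.scatterMeasure, 0 ≤ pb.kernel z := by
  have h1 : ∀ᵐ z ∂pb.scatterMeasure, z.1 ∈ pb.Ω :=
    Measure.quasiMeasurePreserving_fst.ae (ae_restrict_mem pb.isOpen_Ω.measurableSet)
  have h2 : ∀ᵐ z ∂pb.scatterMeasure, z.2.1.2 ∈ pb.energies :=
    (Measure.quasiMeasurePreserving_snd.comp (Measure.quasiMeasurePreserving_fst.comp
      Measure.quasiMeasurePreserving_snd)).ae (ae_restrict_mem pb.measurableSet_energies)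
  have h3 : ∀ᵐ z ∂pb.scatterMeasure, z.2.2.2 ∈ pb.energies :=
    (Measure.quasiMeasurePreserving_snd.comp (Measure.quasiMeasurePreserving_snd.comp
      Measure.quasiMeasurePreserving_snd)).ae (ae_restrict_mem pb.measurableSet_energies)
  filter_upwards [h1, h2, h3] with z hz1 hz2 hz3
  refine pb.θ_nonneg _ hz1 _ ?_ _ hz2 _ hz3
  have := abs_real_inner_le_norm (z.2.1.1 : Space d) (z.2.2.1 : Space d)
  rw [show ‖(z.2.1.1 : Space d)‖ = 1 by simp, show ‖(z.2.2.1 : Space d)‖ = 1 by simp,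
    mul_one] at this
  exact abs_le.1 this

theorem ae_β_eq : ∀ᵐ y ∂(Discretisation.phaseMeasure pb),
    pb.β y.1 y.2.1 y.2.2 = ∫ q, pb.kernel (y.1, y.2, q) ∂pb.angleEnergy :=
  ae_iterated_eq pb.integrable_kernel

theorem ae_γ_eq : ∀ᵐ y ∂(Discretisation.phaseMeasure pb),
    pb.γ y.1 y.2.1 y.2.2 = ∫ p, pb.kernel (y.1, p, y.2) ∂pb.angleEnergy :=
  ae_iterated_eq (integrable_swap_snd pb.integrable_kernel)

theorem integrable_β : Integrable (fun y : Phase d => pb.β y.1 y.2.1 y.2.2)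
    (Discretisation.phaseMeasure pb) :=
  (integrable_assoc pb.integrable_kernel).integral_prod_left.congr
    (pb.ae_β_eq.mono fun _ h => h.symm)

theorem integrable_γ : Integrable (fun y : Phase d => pb.γ y.1 y.2.1 y.2.2)
    (Discretisation.phaseMeasure pb) :=
  (integrable_assoc (integrable_swap_snd pb.integrable_kernel)).integral_prod_left.congr
    (pb.ae_γ_eq.mono fun _ h => h.symm)

theorem integrable_α : Integrable (fun y : Phase d => pb.α y.1 y.2.2)
    (Discretisation.phaseMeasure pb) := by
  have h1 : Integrable (fun r : (Space d × ℝ) × Direction d => pb.α r.1.1 r.1.2)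
      (((volume.restrict pb.Ω).prod (volume.restrict pb.energies)).prod (sphereMeasure d)) :=
    pb.α_integrable.comp_fst _
  have h2 := (MeasurePreserving.symm _ (measurePreserving_prodAssoc (volume.restrict pb.Ω)
    (volume.restrict pb.energies) (sphereMeasure d))).integrable_comp_of_integrable h1
  exact ((MeasurePreserving.id (volume.restrict pb.Ω)).prod (Measure.measurePreserving_swap
    (μ := sphereMeasure d) (ν := volume.restrict pb.energies))).integrable_comp_of_integrable h2

theorem integrable_αbar : Integrable (fun y : Phase d => pb.αbar y.1 y.2.1 y.2.2)
    (Discretisation.phaseMeasure pb) :=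
  pb.integrable_α.add ((pb.integrable_β.sub pb.integrable_γ).const_mul _)

variable {pb}

theorem Coercive.ae_pos (h : pb.Coercive) :
    ∀ᵐ y ∂(Discretisation.phaseMeasure pb), 0 < pb.αbar y.1 y.2.1 y.2.2 := by
  obtain ⟨a, ha, hle⟩ := h
  filter_upwards [pb.ae_mem] with y hy
  exact ha.trans_le (hle _ hy.1 _ _ hy.2)

end Problem

namespace Discretisation

variable {d : ℕ} {pb : Problem d}

theorem formS_eq {w v : Phase d → ℝ} (hw : BddMeas w) (hv : BddMeas v) :
    formS pb w v = ∫ z, pb.kernel z * w (z.1, z.2.1) * v (z.1, z.2.2) ∂pb.scatterMeasure := by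
  have h1 : Integrable (fun z => pb.kernel z * w (z.1, z.2.1)) pb.scatterMeasure :=
    (hw.comp (by fun_prop)).integrable_mul pb.integrable_kernel
  have h2 : Integrable (fun z => pb.kernel z * w (z.1, z.2.1) * v (z.1, z.2.2)) pb.scatterMeasure :=
    (hv.comp (by fun_prop)).integrable_mul h1
  have h1' := integrable_swap_snd h1
  have h2' := integrable_swap_snd h2
  have hsc := ae_iterated_eq h1'
  -- The scattering operator integrates over the incoming state with the outgoing one fixed, so the
  -- two states are exchanged before Fubini is applied.
  rw [← integral_swap_snd h2, ← integral_assoc h2']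
  refine iterated_integral_eq (integrable_assoc h2').integral_prod_left ?_
  filter_upwards [ae_ae_of_ae_prod_swap hsc] with q hq
  refine integral_congr_ae (hq.mono fun x hx => ?_)
  simp only at hx ⊢
  rw [integral_mul_const, ← hx]
  rfl

theorem mass_eq {w v : Phase d → ℝ} (hw : BddMeas w) (hv : BddMeas v) :
    mass pb w v = ∫ y, pb.αbar y.1 y.2.1 y.2.2 * w y * v y ∂(phaseMeasure pb) :=
  iterated_integral_eq (hv.integrable_mul (hw.integrable_mul pb.integrable_αbar))
    (ae_of_all _ fun _ => rfl)

/-- Young's inequality is applied under the kernel to the values of v before and after scattering.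
Integrating out the outgoing state gives β, integrating out the incoming one gives γ. -/
theorem formS_self_le {v : Phase d → ℝ} (hv : BddMeas v) :
    formS pb v v ≤ (1 / 2) * ∫ y, pb.β y.1 y.2.1 y.2.2 * v y * v y ∂(phaseMeasure pb)
      + (1 / 2) * ∫ y, pb.γ y.1 y.2.1 y.2.2 * v y * v y ∂(phaseMeasure pb) := by
  have hp : BddMeas fun z : Space d × (Direction d × ℝ) × (Direction d × ℝ) => v (z.1, z.2.1) :=
    hv.comp (by fun_prop)
  have hq : BddMeas fun z : Space d × (Direction d × ℝ) × (Direction d × ℝ) => v (z.1, z.2.2) :=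
    hv.comp (by fun_prop)
  have hpp : Integrable (fun z => pb.kernel z * v (z.1, z.2.1) * v (z.1, z.2.1))
      pb.scatterMeasure := hp.integrable_mul (hp.integrable_mul pb.integrable_kernel)
  have hqq : Integrable (fun z => pb.kernel z * v (z.1, z.2.2) * v (z.1, z.2.2))
      pb.scatterMeasure := hq.integrable_mul (hq.integrable_mul pb.integrable_kernel)
  have hβ : ∫ y, pb.β y.1 y.2.1 y.2.2 * v y * v y ∂(phaseMeasure pb)
      = ∫ z, pb.kernel z * v (z.1, z.2.1) * v (z.1, z.2.1) ∂pb.scatterMeasure := by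
    rw [← integral_assoc hpp]
    refine integral_congr_ae (pb.ae_β_eq.mono fun y hy => ?_)
    simp only at hy ⊢
    rw [integral_mul_const, integral_mul_const, hy]
  have hγ : ∫ y, pb.γ y.1 y.2.1 y.2.2 * v y * v y ∂(phaseMeasure pb)
      = ∫ z, pb.kernel z * v (z.1, z.2.2) * v (z.1, z.2.2) ∂pb.scatterMeasure := by
    rw [← integral_swap_snd hqq, ← integral_assoc (integrable_swap_snd hqq)]
    refine integral_congr_ae (pb.ae_γ_eq.mono fun y hy => ?_)
    simp only at hy ⊢
    rw [integral_mul_const, integral_mul_const, hy]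
  rw [formS_eq hv hv, hβ, hγ, ← integral_const_mul, ← integral_const_mul,
    ← integral_add (hpp.const_mul _) (hqq.const_mul _)]
  refine integral_mono_ae (hq.integrable_mul (hp.integrable_mul pb.integrable_kernel))
    ((hpp.const_mul _).add (hqq.const_mul _)) (pb.ae_kernel_nonneg.mono fun z hz => ?_)
  simp only
  nlinarith [mul_nonneg hz (sq_nonneg (v (z.1, z.2.1) - v (z.1, z.2.2)))]

theorem weightedNorm_sq (hα : pb.Coercive) {K : Set (Space d)} {M : Set (Direction d)} {G : Set ℝ}
    (hK : K ⊆ pb.Ω) (hKm : MeasurableSet K) (hG : G ⊆ pb.energies)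
    (hGm : MeasurableSet G) {v : Phase d → ℝ} (hv : BddMeas v) :
    weightedNorm pb K M G v ^ 2
      = ∫ y in K ×ˢ M ×ˢ G, pb.αbar y.1 y.2.1 y.2.2 * v y * v y ∂(phaseMeasure pb) := by
  rw [weightedNorm, Real.sq_sqrt (integral_nonneg fun _ => integral_nonneg fun _ =>
    integral_nonneg fun _ => sq_nonneg _)]
  have hm : (phaseMeasure pb).restrict (K ×ˢ M ×ˢ G)
      = (volume.restrict K).prod (((sphereMeasure d).restrict M).prod (volume.restrict G)) := by
    rw [phaseMeasure, ← Measure.prod_restrict, ← Measure.prod_restrict,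
      Measure.restrict_restrict hKm, Measure.restrict_restrict hGm, Set.inter_eq_left.2 hK,
      Set.inter_eq_left.2 hG]
  have hae : ∀ᵐ y ∂((phaseMeasure pb).restrict (K ×ˢ M ×ˢ G)),
      (√(pb.αbar y.1 y.2.1 y.2.2) * v y) ^ 2 = pb.αbar y.1 y.2.1 y.2.2 * v y * v y := by
    refine ae_restrict_of_ae (hα.ae_pos.mono fun y hy => ?_)
    rw [mul_pow, Real.sq_sqrt hy.le]
    ring
  have hint : Integrable (fun y : Phase d => (√(pb.αbar y.1 y.2.1 y.2.2) * v y) ^ 2)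
      ((phaseMeasure pb).restrict (K ×ˢ M ×ˢ G)) :=
    ((hv.integrable_mul (hv.integrable_mul pb.integrable_αbar)).restrict).congr
      (hae.mono fun _ h => h.symm)
  rw [← integral_congr_ae hae]
  rw [hm] at hint ⊢
  exact iterated_integral_eq hint (ae_of_all _ fun _ => rfl)

end Discretisation

end Boltzmann

namespace Boltzmann

open MeasureTheory Filter Topology

namespace Discretisation

variable {d : ℕ} {pb : Problem d} (D : Discretisation pb)

/-! ### Traces and directional derivatives as linear maps -/

theorem bddMeas (v : D.feSpace) : BddMeas (v : Phase d → ℝ) :=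
  ⟨D.measurable_of_mem_feSpace v.2, D.bounded_of_mem_feSpace v.2⟩

variable {D} in
theorem tendsto_trace {v : Phase d → ℝ} {i : Fin D.spatial.card}
    {V : Phase d → ℝ} (hV : SmoothRep (closure pb.Ω) V)
    (hvV : ∀ x ∈ D.spatial.elem i, ∀ μ E, v (x, μ, E) = V (x, μ, E)) (x : Space d)
    (μ : Direction d) (E : ℝ) :
    Tendsto (fun y => v (y, μ, E)) (𝓝[D.spatial.elem i] x) (𝓝 (V (x, μ, E))) := by
  have h1 : Tendsto (fun y => V (y, μ, E)) (𝓝[D.spatial.elem i] x) (𝓝 (V (x, μ, E))) :=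
    ((hV.contDiff μ E).continuous.tendsto x).mono_left nhdsWithin_le_nhds
  refine h1.congr' ?_
  filter_upwards [self_mem_nhdsWithin] with y hy
  exact (hvV y hy μ E).symm

theorem mem_closure_of_mem_faces {κ : Set (Space d)} {x : Space d} (hx : x ∈ faces κ) :
    x ∈ closure κ := frontier_subset_closure (faces_subset_frontier hx)

variable {D} in
theorem traceIn_eq {v : Phase d → ℝ} {i : Fin D.spatial.card}
    {V : Phase d → ℝ} (hV : SmoothRep (closure pb.Ω) V)
    (hvV : ∀ x ∈ D.spatial.elem i, ∀ μ E, v (x, μ, E) = V (x, μ, E)) {x : Space d}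
    (hx : x ∈ faces (D.spatial.elem i)) (μ : Direction d) (E : ℝ) :
    traceIn (D.spatial.elem i) v x μ E = V (x, μ, E) := by
  have : (𝓝[D.spatial.elem i] x).NeBot :=
    mem_closure_iff_nhdsWithin_neBot.1 (mem_closure_of_mem_faces hx)
  exact (tendsto_trace hV hvV x μ E).limUnder_eq

theorem tendsto_traceIn (v : D.feSpace) {i : Fin D.spatial.card} {x : Space d}
    (hx : x ∈ faces (D.spatial.elem i)) (μ : Direction d) (E : ℝ) :
    Tendsto (fun y => (v : Phase d → ℝ) (y, μ, E)) (𝓝[D.spatial.elem i] x)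
      (𝓝 (traceIn (D.spatial.elem i) v x μ E)) := by
  obtain ⟨V, hV, hvV⟩ := D.exists_smoothRep v.2 i
  rw [traceIn_eq hV hvV hx]
  exact tendsto_trace hV hvV x μ E

theorem differentiableAt (v : D.feSpace) {i : Fin D.spatial.card} {x : Space d}
    (hx : x ∈ D.spatial.elem i) (μ : Direction d) (E : ℝ) :
    DifferentiableAt ℝ (fun y => (v : Phase d → ℝ) (y, μ, E)) x := by
  obtain ⟨V, hV, hvV⟩ := D.exists_smoothRep v.2 i
  refine ((hV.contDiff μ E).differentiable one_ne_zero x).congr_of_eventuallyEq ?_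
  filter_upwards [(D.spatial.isPolytope i).isOpen.mem_nhds hx] with y hy
  exact hvV y hy μ E

/-- The phase points whose position lies on a face of the element `i`. -/
def faceSet (i : Fin D.spatial.card) : Set (Phase d) := {y | y.1 ∈ faces (D.spatial.elem i)}

theorem measurableSet_faceSet (i : Fin D.spatial.card) : MeasurableSet (D.faceSet i) :=
  measurable_fst (measurableSet_faces _)

open Classical in
/-- The interior trace on the faces of the element `i`. -/
noncomputable def trace (i : Fin D.spatial.card) : D.feSpace →ₗ[ℝ] (Phase d → ℝ) where
  toFun v := (D.faceSet i).indicator fun y => traceIn (D.spatial.elem i) v y.1 y.2.1 y.2.2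
  map_add' v w := by
    funext y
    by_cases hy : y ∈ D.faceSet i
    · have : (𝓝[D.spatial.elem i] y.1).NeBot :=
        mem_closure_iff_nhdsWithin_neBot.1 (mem_closure_of_mem_faces hy)
      simp only [Pi.add_apply, Set.indicator_of_mem hy]
      exact ((D.tendsto_traceIn v hy _ _).add (D.tendsto_traceIn w hy _ _)).limUnder_eq
    · simp only [Pi.add_apply, Set.indicator_of_notMem hy, add_zero]
  map_smul' c v := by
    funext y
    by_cases hy : y ∈ D.faceSet i
    · have : (𝓝[D.spatial.elem i] y.1).NeBot :=
        mem_closure_iff_nhdsWithin_neBot.1 (mem_closure_of_mem_faces hy)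
      simp only [Pi.smul_apply, Set.indicator_of_mem hy, RingHom.id_apply]
      exact ((D.tendsto_traceIn v hy _ _).const_smul c).limUnder_eq
    · simp only [Pi.smul_apply, Set.indicator_of_notMem hy, smul_zero]

theorem trace_apply (i : Fin D.spatial.card) (v : D.feSpace) : D.trace i v =
    (D.faceSet i).indicator fun y => traceIn (D.spatial.elem i) v y.1 y.2.1 y.2.2 := rfl

theorem trace_of_mem {i : Fin D.spatial.card} (v : D.feSpace) {x : Space d}
    (hx : x ∈ faces (D.spatial.elem i)) (μ : Direction d) (E : ℝ) :
    D.trace i v (x, μ, E) = traceIn (D.spatial.elem i) v x μ E := by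
  rw [trace_apply, Set.indicator_of_mem (show (x, μ, E) ∈ D.faceSet i from hx)]

theorem trace_of_notMem {i : Fin D.spatial.card} (v : D.feSpace) {y : Phase d}
    (hy : y.1 ∉ faces (D.spatial.elem i)) : D.trace i v y = 0 := by
  rw [trace_apply, Set.indicator_of_notMem (show y ∉ D.faceSet i from hy)]

theorem bddMeas_trace (i : Fin D.spatial.card) (v : D.feSpace) : BddMeas (D.trace i v) := by
  obtain ⟨V, hV, hvV⟩ := D.exists_smoothRep v.2 i
  obtain ⟨C, hC⟩ := hV.bound
  have h : D.trace i v = (D.faceSet i).indicator V := by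
    funext y
    by_cases hy : y ∈ D.faceSet i
    · rw [Set.indicator_of_mem hy]
      exact (D.trace_of_mem v hy _ _).trans (traceIn_eq hV hvV hy _ _)
    · rw [Set.indicator_of_notMem hy]
      exact D.trace_of_notMem v hy
  rw [h]
  refine ⟨hV.measurable.indicator (D.measurableSet_faceSet i), |C|, fun y => ?_⟩
  by_cases hy : y ∈ D.faceSet i
  · rw [Set.indicator_of_mem hy]
    exact ((hC y.1 (D.spatial.closure_elem_subset i (mem_closure_of_mem_faces hy)) y.2.1
      y.2.2).1).trans (le_abs_self C)
  · rw [Set.indicator_of_notMem hy, abs_zero]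
    exact abs_nonneg C

open Classical in
/-- The sum of the traces from the neighbouring elements on the faces of the element `i`. -/
noncomputable def traceNbr (i : Fin D.spatial.card) : D.feSpace →ₗ[ℝ] (Phase d → ℝ) where
  toFun v := (D.faceSet i).indicator fun y => ∑ j ∈ Finset.univ.erase i, D.trace j v y
  map_add' v w := by
    funext y
    by_cases hy : y ∈ D.faceSet i
    · simp only [Pi.add_apply, Set.indicator_of_mem hy, map_add, Finset.sum_add_distrib]
    · simp only [Pi.add_apply, Set.indicator_of_notMem hy, add_zero]
  map_smul' c v := by
    funext y
    by_cases hy : y ∈ D.faceSet i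
    · simp only [Pi.smul_apply, Set.indicator_of_mem hy, map_smul, RingHom.id_apply,
        Finset.smul_sum]
    · simp only [Pi.smul_apply, Set.indicator_of_notMem hy, smul_zero]

open Classical in
theorem traceNbr_apply (i : Fin D.spatial.card) (v : D.feSpace) : D.traceNbr i v =
    (D.faceSet i).indicator fun y => ∑ j ∈ Finset.univ.erase i, D.trace j v y := rfl

theorem bddMeas_traceNbr (i : Fin D.spatial.card) (v : D.feSpace) : BddMeas (D.traceNbr i v) := by
  classical
  exact (BddMeas.sum _ fun j _ => D.bddMeas_trace j v).indicator (D.measurableSet_faceSet i)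

/-- The directional derivative `μ · ∇ v` on the elements. -/
noncomputable def dirDeriv : D.feSpace →ₗ[ℝ] (Phase d → ℝ) where
  toFun v := {y : Phase d | y.1 ∈ ⋃ i, D.spatial.elem i}.indicator fun y =>
    fderiv ℝ (fun x => (v : Phase d → ℝ) (x, y.2.1, y.2.2)) y.1 (y.2.1 : Space d)
  map_add' v w := by
    funext y
    by_cases hy : y ∈ {y : Phase d | y.1 ∈ ⋃ i, D.spatial.elem i}
    · obtain ⟨i, hi⟩ := Set.mem_iUnion.1 (show y.1 ∈ ⋃ i, D.spatial.elem i from hy)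
      simp only [Pi.add_apply, Set.indicator_of_mem hy, Submodule.coe_add]
      rw [← add_apply]
      exact congrArg (fun L => L (y.2.1 : Space d))
        (fderiv_add (D.differentiableAt v hi y.2.1 y.2.2) (D.differentiableAt w hi y.2.1 y.2.2))
    · simp only [Pi.add_apply, Set.indicator_of_notMem hy, add_zero]
  map_smul' c v := by
    funext y
    by_cases hy : y ∈ {y : Phase d | y.1 ∈ ⋃ i, D.spatial.elem i}
    · obtain ⟨i, hi⟩ := Set.mem_iUnion.1 (show y.1 ∈ ⋃ i, D.spatial.elem i from hy)
      simp only [Pi.smul_apply, Set.indicator_of_mem hy, Submodule.coe_smul, RingHom.id_apply]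
      rw [← smul_apply]
      exact congrArg (fun L => L (y.2.1 : Space d))
        (fderiv_const_smul (D.differentiableAt v hi y.2.1 y.2.2) c)
    · simp only [Pi.smul_apply, Set.indicator_of_notMem hy, smul_zero]

theorem dirDeriv_apply (v : D.feSpace) : D.dirDeriv v =
    {y : Phase d | y.1 ∈ ⋃ i, D.spatial.elem i}.indicator fun y =>
      fderiv ℝ (fun x => (v : Phase d → ℝ) (x, y.2.1, y.2.2)) y.1 (y.2.1 : Space d) := rfl

theorem dirDeriv_of_mem {i : Fin D.spatial.card} (v : D.feSpace) {x : Space d}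
    (hx : x ∈ D.spatial.elem i) (μ : Direction d) (E : ℝ) :
    D.dirDeriv v (x, μ, E) = fderiv ℝ (fun x => (v : Phase d → ℝ) (x, μ, E)) x (μ : Space d) := by
  rw [dirDeriv_apply, Set.indicator_of_mem
    (show (x, μ, E) ∈ {y : Phase d | y.1 ∈ ⋃ i, D.spatial.elem i} from Set.mem_iUnion.2 ⟨i, hx⟩)]

theorem dirDeriv_eq {i : Fin D.spatial.card} (v : D.feSpace) {V : Phase d → ℝ}
    (hvV : ∀ x ∈ D.spatial.elem i, ∀ μ E, (v : Phase d → ℝ) (x, μ, E) = V (x, μ, E)) {x : Space d}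
    (hx : x ∈ D.spatial.elem i) (μ : Direction d) (E : ℝ) :
    D.dirDeriv v (x, μ, E) = fderiv ℝ (fun x => V (x, μ, E)) x (μ : Space d) := by
  rw [D.dirDeriv_of_mem v hx]
  congr 1
  refine Filter.EventuallyEq.fderiv_eq ?_
  filter_upwards [(D.spatial.isPolytope i).isOpen.mem_nhds hx] with y hy
  exact hvV y hy μ E

theorem bddMeas_dirDeriv (v : D.feSpace) : BddMeas (D.dirDeriv v) := by
  have h0 : ∀ y ∉ ⋃ i, {y : Phase d | y.1 ∈ D.spatial.elem i}, D.dirDeriv v y = 0 := by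
    intro y hy
    rw [dirDeriv_apply, Set.indicator_of_notMem]
    simpa using hy
  refine ⟨measurable_of_piecewise
    (fun i => measurable_fst (D.spatial.isPolytope i).isOpen.measurableSet) (fun i => ?_) h0,
    bounded_of_piecewise (fun i => ?_) h0⟩
  · obtain ⟨V, hV, hvV⟩ := D.exists_smoothRep v.2 i
    exact ⟨_, hV.measurable_deriv, fun y hy => D.dirDeriv_eq v hvV hy y.2.1 y.2.2⟩
  · obtain ⟨V, hV, hvV⟩ := D.exists_smoothRep v.2 i
    obtain ⟨C, hC⟩ := hV.bound
    refine ⟨C, fun y hy => ?_⟩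
    rw [show D.dirDeriv v y = _ from D.dirDeriv_eq v hvV hy y.2.1 y.2.2]
    exact (hC y.1 (subset_closure (D.spatial.subset i hy)) y.2.1 y.2.2).2

/-! ### The skeleton and the flux weights -/

/-- The union of the faces of all elements. -/
def skeleton : Set (Space d) := ⋃ i, faces (D.spatial.elem i)

theorem measurableSet_skeleton : MeasurableSet D.skeleton :=
  MeasurableSet.iUnion fun _ => measurableSet_faces _

/-- The surface measure on the skeleton. -/
noncomputable def skeletonMeasure : Measure (Space d) :=
  (surfaceMeasure d).restrict D.skeleton

instance isFiniteMeasure_skeletonMeasure : IsFiniteMeasure D.skeletonMeasure := by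
  obtain ⟨A, hA, hfr⟩ := D.spatial.exists_arrangement
  refine ⟨?_⟩
  rw [skeletonMeasure, Measure.restrict_apply_univ]
  refine surfaceMeasure_lt_top hA (pb.isBounded_Ω.closure.subset ?_) ?_
  · exact Set.iUnion_subset fun i x hx =>
      D.spatial.closure_elem_subset i (mem_closure_of_mem_faces hx)
  · exact Set.iUnion_subset fun i x hx => hfr i (faces_subset_frontier hx)

/-- The product measure on the skeleton, the directions and the energies. -/
noncomputable abbrev faceMeasure : Measure (Phase d) := D.skeletonMeasure.prod pb.angleEnergy

/-- The modulus of the normal flux on a set of phase points. -/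
noncomputable def fluxWeight (i : Fin D.spatial.card) (s : Set (Phase d)) : Phase d → ℝ :=
  s.indicator fun y => |normalFlux (D.spatial.elem i) y.2.1 y.1|

theorem measurable_normalFlux (κ : Set (Space d)) :
    Measurable fun y : Phase d => normalFlux κ y.2.1 y.1 := by
  unfold normalFlux
  exact Measurable.inner (by fun_prop) ((measurable_normal κ).comp measurable_fst)

theorem abs_normalFlux_le (κ : Set (Space d)) (μ : Direction d) (x : Space d) :
    |normalFlux κ μ x| ≤ 1 := by
  refine (abs_real_inner_le_norm _ _).trans ?_
  rw [show ‖(μ : Space d)‖ = 1 by simp, one_mul]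
  exact norm_normal_le κ x

theorem bddMeas_fluxWeight (i : Fin D.spatial.card) {s : Set (Phase d)} (hs : MeasurableSet s) :
    BddMeas (D.fluxWeight i s) :=
  BddMeas.indicator ⟨(measurable_normalFlux _).abs, 1, fun y => by
    rw [abs_abs]
    exact abs_normalFlux_le _ _ _⟩ hs

/-- The outflow faces of the element `i`. -/
def outSet (i : Fin D.spatial.card) : Set (Phase d) :=
  {y | y.1 ∈ outflow (D.spatial.elem i) y.2.1}

/-- The inflow faces of the element `i` off the boundary of the domain. -/
def inSet (i : Fin D.spatial.card) : Set (Phase d) :=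
  {y | y.1 ∈ inflow (D.spatial.elem i) y.2.1 \ frontier pb.Ω}

/-- The inflow faces of the element `i` on the boundary of the domain. -/
def inBdSet (i : Fin D.spatial.card) : Set (Phase d) :=
  {y | y.1 ∈ inflow (D.spatial.elem i) y.2.1 ∩ frontier pb.Ω}

/-- The faces of the element `i` on the boundary of the domain. -/
def bdSet (i : Fin D.spatial.card) : Set (Phase d) :=
  {y | y.1 ∈ faces (D.spatial.elem i) ∩ frontier pb.Ω}

theorem measurableSet_outSet (i : Fin D.spatial.card) : MeasurableSet (D.outSet i) :=
  (D.measurableSet_faceSet i).inter (measurableSet_le measurable_const (measurable_normalFlux _))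

theorem measurableSet_inflow (i : Fin D.spatial.card) :
    MeasurableSet {y : Phase d | y.1 ∈ inflow (D.spatial.elem i) y.2.1} :=
  (D.measurableSet_faceSet i).inter (measurableSet_lt (measurable_normalFlux _) measurable_const)

theorem measurableSet_inSet (i : Fin D.spatial.card) : MeasurableSet (D.inSet i) :=
  (D.measurableSet_inflow i).diff (measurable_fst isClosed_frontier.measurableSet)

theorem measurableSet_inBdSet (i : Fin D.spatial.card) : MeasurableSet (D.inBdSet i) :=
  (D.measurableSet_inflow i).inter (measurable_fst isClosed_frontier.measurableSet)

theorem measurableSet_bdSet (i : Fin D.spatial.card) : MeasurableSet (D.bdSet i) :=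
  (D.measurableSet_faceSet i).inter (measurable_fst isClosed_frontier.measurableSet)

/-- Integrals over measurable pieces of the faces of one element as integrals over the skeleton. -/
theorem setIntegral_face_eq (i : Fin D.spatial.card) {s : Set (Phase d)} (hs : MeasurableSet s)
    (hsub : s ⊆ D.faceSet i) (p : Direction d × ℝ) (h : Space d → ℝ) :
    ∫ x in {x | (x, p) ∈ s}, |normalFlux (D.spatial.elem i) p.1 x| * h x ∂(surfaceMeasure d)
      = ∫ x, D.fluxWeight i s (x, p) * h x ∂D.skeletonMeasure := by
  set S : Set (Space d) := {x | (x, p) ∈ s} with hS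
  have hm : MeasurableSet S := measurable_prodMk_right hs
  have h1 : (fun x => D.fluxWeight i s (x, p) * h x) = S.indicator
      fun x => |normalFlux (D.spatial.elem i) p.1 x| * h x := by
    funext x
    by_cases hx : (x, p) ∈ s
    · have hxS : x ∈ S := hx
      rw [Set.indicator_of_mem hxS, fluxWeight, Set.indicator_of_mem hx]
    · have hxS : x ∉ S := hx
      rw [Set.indicator_of_notMem hxS, fluxWeight, Set.indicator_of_notMem hx, zero_mul]
  have hsk : S ⊆ D.skeleton := by
    intro x hx
    have h2 : (x, p) ∈ D.faceSet i := hsub hx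
    have h3 : x ∈ faces (D.spatial.elem i) := h2
    exact Set.mem_iUnion_of_mem i h3
  rw [h1, skeletonMeasure, setIntegral_indicator hm, Set.inter_eq_right.2 hsk]

/-- Traces are extended by zero off the faces, so at a point shared by just two elements the sum
over all other elements has a single term. The sum is linear in v without any choice of neighbour.
-/
theorem traceNbr_eq {i j : Fin D.spatial.card} (hji : j ≠ i) (v : D.feSpace) {x : Space d}
    (hxi : x ∈ faces (D.spatial.elem i))
    (honly : ∀ k, x ∈ faces (D.spatial.elem k) → k = i ∨ k = j) (p : Direction d × ℝ) :
    D.traceNbr i v (x, p) = D.trace j v (x, p) := by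
  classical
  have h1 : D.traceNbr i v (x, p) = ∑ k ∈ Finset.univ.erase i, D.trace k v (x, p) := by
    rw [traceNbr_apply, Set.indicator_of_mem (show (x, p) ∈ D.faceSet i from hxi)]
  rw [h1, Finset.sum_eq_single j]
  · intro k hk hkj
    refine D.trace_of_notMem v fun hxk => ?_
    rcases honly k hxk with h2 | h2
    · exact (Finset.mem_erase.1 hk).1 h2
    · exact hkj h2
  · exact fun h => absurd (Finset.mem_erase.2 ⟨hji, Finset.mem_univ j⟩) h

/-- At a generic interior face point the exterior and the neighbouring element define the same
neighbourhood filter. The exceptional null set depends on the mesh alone, not on v, μ or E. -/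
theorem ae_traceOut_eq : ∀ᵐ x ∂(surfaceMeasure d), ∀ (i : Fin D.spatial.card) (v : D.feSpace)
    (μ : Direction d) (E : ℝ), x ∈ faces (D.spatial.elem i) → x ∉ frontier pb.Ω →
    traceOut (D.spatial.elem i) v x μ E = D.traceNbr i v (x, μ, E) := by
  obtain ⟨A, hA, hfr⟩ := D.spatial.exists_arrangement
  filter_upwards [hA.ae_generic] with x hx i v μ E hxi hxΩ
  obtain ⟨j, hji, hxj, -, hnhds, honly⟩ :=
    D.spatial.exists_neighbour pb.isOpen_Ω hA hfr hx hxi hxΩ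
  rw [D.traceNbr_eq hji v hxi honly, D.trace_of_mem v hxj, traceOut, traceIn, hnhds]

/-- The part of Ω outside the open elements need not be shown null: the integrands vanish there with
the canonical representatives. -/
theorem sum_setIntegral_elem {f : Space d → ℝ} (hf : IntegrableOn f pb.Ω)
    (h0 : ∀ x ∉ ⋃ i, D.spatial.elem i, f x = 0) :
    ∑ i, ∫ x in D.spatial.elem i, f x = ∫ x in pb.Ω, f x := by
  have hm : ∀ i, MeasurableSet (D.spatial.elem i) := fun i =>
    (D.spatial.isPolytope i).isOpen.measurableSet
  have hsub : (⋃ i, D.spatial.elem i) ⊆ pb.Ω := Set.iUnion_subset D.spatial.subset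
  have h1 : ∫ x in pb.Ω, f x = ∫ x in ⋃ i, D.spatial.elem i, f x :=
    setIntegral_eq_of_subset_of_forall_sdiff_eq_zero pb.isOpen_Ω.measurableSet hsub
      fun x hx => h0 x hx.2
  rw [h1, integral_iUnion_fintype hm (fun i j hij => D.spatial.disjoint i j hij)
    fun i => hf.mono_set (D.spatial.subset i)]

end Discretisation

end Boltzmann

namespace Boltzmann

open MeasureTheory Filter Topology

namespace Discretisation

variable {d : ℕ} {pb : Problem d} (D : Discretisation pb)

/-! ### The forms of the scheme as integrals over product spaces -/

theorem outSet_subset (i : Fin D.spatial.card) : D.outSet i ⊆ D.faceSet i := fun _ hy => hy.1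

theorem inSet_subset (i : Fin D.spatial.card) : D.inSet i ⊆ D.faceSet i := fun _ hy => hy.1.1

theorem inBdSet_subset (i : Fin D.spatial.card) : D.inBdSet i ⊆ D.faceSet i := fun _ hy => hy.1.1

theorem bdSet_subset (i : Fin D.spatial.card) : D.bdSet i ⊆ D.faceSet i := fun _ hy => hy.1

theorem setOf_mem_outSet (i : Fin D.spatial.card) (p : Direction d × ℝ) :
    {x | (x, p) ∈ D.outSet i} = outflow (D.spatial.elem i) p.1 := by
  ext x
  exact Iff.rfl

theorem setOf_mem_inSet (i : Fin D.spatial.card) (p : Direction d × ℝ) :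
    {x | (x, p) ∈ D.inSet i} = inflow (D.spatial.elem i) p.1 \ frontier pb.Ω := by
  ext x
  exact Iff.rfl

theorem setOf_mem_inBdSet (i : Fin D.spatial.card) (p : Direction d × ℝ) :
    {x | (x, p) ∈ D.inBdSet i} = inflow (D.spatial.elem i) p.1 ∩ frontier pb.Ω := by
  ext x
  exact Iff.rfl

theorem setOf_mem_bdSet (i : Fin D.spatial.card) (p : Direction d × ℝ) :
    {x | (x, p) ∈ D.bdSet i} = faces (D.spatial.elem i) ∩ frontier pb.Ω := by
  ext x
  exact Iff.rfl

theorem integral_outflow_eq (i : Fin D.spatial.card) (p : Direction d × ℝ) {F h : Space d → ℝ}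
    (hF : ∀ x ∈ faces (D.spatial.elem i), F x = |normalFlux (D.spatial.elem i) p.1 x| * h x) :
    ∫ x in outflow (D.spatial.elem i) p.1, F x ∂(surfaceMeasure d)
      = ∫ x, D.fluxWeight i (D.outSet i) (x, p) * h x ∂D.skeletonMeasure := by
  rw [← D.setIntegral_face_eq i (D.measurableSet_outSet i) (D.outSet_subset i) p h,
    setOf_mem_outSet]
  have hm : MeasurableSet {x : Space d | (x, p) ∈ D.outSet i} :=
    measurable_prodMk_right (D.measurableSet_outSet i)
  rw [setOf_mem_outSet] at hm
  exact setIntegral_congr_fun hm fun x hx => hF x hx.1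

theorem integral_inflow_eq (i : Fin D.spatial.card) (p : Direction d × ℝ) {F h : Space d → ℝ}
    (hF : ∀ᵐ x ∂(surfaceMeasure d), x ∈ faces (D.spatial.elem i) → x ∉ frontier pb.Ω →
      F x = |normalFlux (D.spatial.elem i) p.1 x| * h x) :
    ∫ x in inflow (D.spatial.elem i) p.1 \ frontier pb.Ω, F x ∂(surfaceMeasure d)
      = ∫ x, D.fluxWeight i (D.inSet i) (x, p) * h x ∂D.skeletonMeasure := by
  rw [← D.setIntegral_face_eq i (D.measurableSet_inSet i) (D.inSet_subset i) p h,
    setOf_mem_inSet]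
  have hm : MeasurableSet {x : Space d | (x, p) ∈ D.inSet i} :=
    measurable_prodMk_right (D.measurableSet_inSet i)
  rw [setOf_mem_inSet] at hm
  exact setIntegral_congr_ae hm (hF.mono fun x h1 hx => h1 hx.1.1 hx.2)

theorem integral_inflow_boundary_eq (i : Fin D.spatial.card) (p : Direction d × ℝ)
    {F h : Space d → ℝ}
    (hF : ∀ x ∈ faces (D.spatial.elem i), F x = |normalFlux (D.spatial.elem i) p.1 x| * h x) :
    ∫ x in inflow (D.spatial.elem i) p.1 ∩ frontier pb.Ω, F x ∂(surfaceMeasure d)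
      = ∫ x, D.fluxWeight i (D.inBdSet i) (x, p) * h x ∂D.skeletonMeasure := by
  rw [← D.setIntegral_face_eq i (D.measurableSet_inBdSet i) (D.inBdSet_subset i) p h,
    setOf_mem_inBdSet]
  have hm : MeasurableSet {x : Space d | (x, p) ∈ D.inBdSet i} :=
    measurable_prodMk_right (D.measurableSet_inBdSet i)
  rw [setOf_mem_inBdSet] at hm
  exact setIntegral_congr_fun hm fun x hx => hF x hx.1.1

theorem integral_boundary_eq (i : Fin D.spatial.card) (p : Direction d × ℝ)
    {F h : Space d → ℝ}
    (hF : ∀ x ∈ faces (D.spatial.elem i), F x = |normalFlux (D.spatial.elem i) p.1 x| * h x) :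
    ∫ x in faces (D.spatial.elem i) ∩ frontier pb.Ω, F x ∂(surfaceMeasure d)
      = ∫ x, D.fluxWeight i (D.bdSet i) (x, p) * h x ∂D.skeletonMeasure := by
  rw [← D.setIntegral_face_eq i (D.measurableSet_bdSet i) (D.bdSet_subset i) p h,
    setOf_mem_bdSet]
  have hm : MeasurableSet {x : Space d | (x, p) ∈ D.bdSet i} :=
    measurable_prodMk_right (D.measurableSet_bdSet i)
  rw [setOf_mem_bdSet] at hm
  exact setIntegral_congr_fun hm fun x hx => hF x hx.1

/-- The volume density of the transport form. -/
noncomputable def volDensity (w v : D.feSpace) (y : Phase d) : ℝ :=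
  -1 * (w : Phase d → ℝ) y * D.dirDeriv v y
    + (pb.α y.1 y.2.2 + pb.β y.1 y.2.1 y.2.2) * (w : Phase d → ℝ) y * (v : Phase d → ℝ) y

/-- The face density of the transport form. -/
noncomputable def faceDensity (w v : D.feSpace) (i : Fin D.spatial.card) (y : Phase d) : ℝ :=
  D.fluxWeight i (D.outSet i) y * D.trace i w y * D.trace i v y
    - D.fluxWeight i (D.inSet i) y * D.traceNbr i w y * D.trace i v y

theorem integrable_αβ : Integrable (fun y : Phase d => pb.α y.1 y.2.2 + pb.β y.1 y.2.1 y.2.2)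
    (phaseMeasure pb) := pb.integrable_α.add pb.integrable_β

instance isFiniteMeasure_phaseMeasure : IsFiniteMeasure (phaseMeasure pb) := by
  unfold phaseMeasure
  infer_instance

theorem integrable_transport (w v : D.feSpace) :
    Integrable (fun y => -1 * (w : Phase d → ℝ) y * D.dirDeriv v y) (phaseMeasure pb) :=
  (((BddMeas.const (-1)).mul (D.bddMeas w)).mul (D.bddMeas_dirDeriv v)).integrable _

theorem integrable_reaction (w v : D.feSpace) :
    Integrable (fun y => (pb.α y.1 y.2.2 + pb.β y.1 y.2.1 y.2.2) * (w : Phase d → ℝ) y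
      * (v : Phase d → ℝ) y) (phaseMeasure pb) :=
  (D.bddMeas v).integrable_mul ((D.bddMeas w).integrable_mul integrable_αβ)

theorem integrable_volDensity (w v : D.feSpace) :
    Integrable (D.volDensity w v) (phaseMeasure pb) :=
  (D.integrable_transport w v).add (D.integrable_reaction w v)

theorem bddMeas_faceDensity (w v : D.feSpace) (i : Fin D.spatial.card) :
    BddMeas (D.faceDensity w v i) :=
  (((D.bddMeas_fluxWeight i (D.measurableSet_outSet i)).mul (D.bddMeas_trace i w)).mul
    (D.bddMeas_trace i v)).sub
  (((D.bddMeas_fluxWeight i (D.measurableSet_inSet i)).mul (D.bddMeas_traceNbr i w)).mul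
    (D.bddMeas_trace i v))

theorem formA_eq (w v : D.feSpace) :
    D.formA w v = ∫ y, D.volDensity w v y ∂(phaseMeasure pb)
      + ∫ y, ∑ i, D.faceDensity w v i y ∂D.faceMeasure := by
  have hf₁ := D.integrable_volDensity w v
  have hf₂ : Integrable (fun y => ∑ i, D.faceDensity w v i y) D.faceMeasure :=
    (BddMeas.sum _ fun i _ => D.bddMeas_faceDensity w v i).integrable _
  refine iterated_integral_add_eq hf₁ hf₂ ?_
  -- The cross-sections are integrable only jointly, so volume integrals at fixed (μ, E) can be
  -- split over elements only for almost every (μ, E).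
  filter_upwards [hf₁.prod_left_ae] with p hp
  have hslice : ∀ {g : Phase d → ℝ}, BddMeas g → Integrable (fun x => g (x, p)) D.skeletonMeasure :=
    fun hg => (hg.comp (by fun_prop)).integrable _
  have hvol : ∀ i, ∫ x in D.spatial.elem i,
      (-((w : Phase d → ℝ) (x, p.1, p.2) * inner ℝ (p.1 : Space d)
          (gradient (fun y => (v : Phase d → ℝ) (y, p.1, p.2)) x))
        + (pb.α x p.2 + pb.β x p.1 p.2) * (w : Phase d → ℝ) (x, p.1, p.2)
          * (v : Phase d → ℝ) (x, p.1, p.2))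
      = ∫ x in D.spatial.elem i, D.volDensity w v (x, p) := fun i => by
    refine setIntegral_congr_fun (D.spatial.isPolytope i).isOpen.measurableSet fun x hx => ?_
    simp only [volDensity]
    rw [show D.dirDeriv v (x, p) = _ from D.dirDeriv_of_mem v hx p.1 p.2, real_inner_comm,
      inner_gradient_left]
    ring
  have hout : ∀ i, ∫ x in outflow (D.spatial.elem i) p.1, |normalFlux (D.spatial.elem i) p.1 x|
        * traceIn (D.spatial.elem i) w x p.1 p.2 * traceIn (D.spatial.elem i) v x p.1 p.2
        ∂(surfaceMeasure d)
      = ∫ x, D.fluxWeight i (D.outSet i) (x, p) * (D.trace i w (x, p) * D.trace i v (x, p))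
        ∂D.skeletonMeasure := fun i => by
    refine D.integral_outflow_eq i p fun x hx => ?_
    rw [mul_assoc, ← D.trace_of_mem w hx, ← D.trace_of_mem v hx]
  have hin : ∀ i, ∫ x in inflow (D.spatial.elem i) p.1 \ frontier pb.Ω,
        |normalFlux (D.spatial.elem i) p.1 x|
        * traceOut (D.spatial.elem i) w x p.1 p.2 * traceIn (D.spatial.elem i) v x p.1 p.2
        ∂(surfaceMeasure d)
      = ∫ x, D.fluxWeight i (D.inSet i) (x, p) * (D.traceNbr i w (x, p) * D.trace i v (x, p))
        ∂D.skeletonMeasure := fun i => by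
    refine D.integral_inflow_eq i p (D.ae_traceOut_eq.mono fun x hx hxf hxΩ => ?_)
    rw [mul_assoc, hx i w p.1 p.2 hxf hxΩ, ← D.trace_of_mem v hxf]
  simp only [add_sub_assoc, Finset.sum_add_distrib]
  simp only [hvol, hout, hin]
  rw [D.sum_setIntegral_elem hp, integral_finsetSum _ fun i _ =>
    hslice (D.bddMeas_faceDensity w v i)]
  · congr 1
    refine Finset.sum_congr rfl fun i _ => ?_
    rw [← integral_sub]
    · refine integral_congr_ae (ae_of_all _ fun x => ?_)
      simp only [faceDensity]
      ring
    · exact hslice ((D.bddMeas_fluxWeight i (D.measurableSet_outSet i)).mul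
        ((D.bddMeas_trace i w).mul (D.bddMeas_trace i v)))
    · exact hslice ((D.bddMeas_fluxWeight i (D.measurableSet_inSet i)).mul
        ((D.bddMeas_traceNbr i w).mul (D.bddMeas_trace i v)))
  · intro x hx
    have h1 : (w : Phase d → ℝ) (x, p) = 0 := D.eq_zero_of_mem_feSpace w.2 (Or.inl hx)
    simp [volDensity, h1]

/-- Additivity of an integral needs integrability of the summands, so the form is assembled from
weighted forms, each with an integrable weight and bounded measurable factors. -/
theorem exists_bilin_formA : ∃ B : D.feSpace →ₗ[ℝ] D.feSpace →ₗ[ℝ] ℝ,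
    ∀ w v, B w v = D.formA w v := by
  have h1 : Integrable (fun _ : Phase d => (-1 : ℝ)) (phaseMeasure pb) := integrable_const _
  have hout := fun i => (D.bddMeas_fluxWeight i (D.measurableSet_outSet i)).integrable D.faceMeasure
  have hin := fun i => (D.bddMeas_fluxWeight i (D.measurableSet_inSet i)).integrable D.faceMeasure
  refine ⟨weightedForm h1 D.feSpace.subtype D.dirDeriv D.bddMeas D.bddMeas_dirDeriv
    + weightedForm (integrable_αβ (pb := pb)) D.feSpace.subtype D.feSpace.subtype D.bddMeas D.bddMeas
    + ∑ i, (weightedForm (hout i) (D.trace i) (D.trace i) (D.bddMeas_trace i) (D.bddMeas_trace i)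
      - weightedForm (hin i) (D.traceNbr i) (D.trace i) (D.bddMeas_traceNbr i)
        (D.bddMeas_trace i)), fun w v => ?_⟩
  rw [D.formA_eq, integral_finsetSum _ fun i _ => (D.bddMeas_faceDensity w v i).integrable _]
  simp only [LinearMap.add_apply, LinearMap.sum_apply, LinearMap.sub_apply, weightedForm_apply]
  congr 1
  · exact (integral_add (D.integrable_transport w v) (D.integrable_reaction w v)).symm
  · refine Finset.sum_congr rfl fun i _ => (integral_sub ?_ ?_).symm
    · exact (((D.bddMeas_fluxWeight i (D.measurableSet_outSet i)).mul (D.bddMeas_trace i w)).mul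
        (D.bddMeas_trace i v)).integrable _
    · exact (((D.bddMeas_fluxWeight i (D.measurableSet_inSet i)).mul (D.bddMeas_traceNbr i w)).mul
        (D.bddMeas_trace i v)).integrable _

theorem exists_bilin_formS : ∃ B : D.feSpace →ₗ[ℝ] D.feSpace →ₗ[ℝ] ℝ,
    ∀ w v, B w v = formS pb w v := by
  refine ⟨weightedForm pb.integrable_kernel
    ((LinearMap.funLeft ℝ ℝ fun z : Space d × (Direction d × ℝ) × (Direction d × ℝ) =>
      (z.1, z.2.1)).comp D.feSpace.subtype)
    ((LinearMap.funLeft ℝ ℝ fun z : Space d × (Direction d × ℝ) × (Direction d × ℝ) =>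
      (z.1, z.2.2)).comp D.feSpace.subtype)
    (fun w => (D.bddMeas w).comp (by fun_prop)) (fun v => (D.bddMeas v).comp (by fun_prop)),
    fun w v => ?_⟩
  rw [formS_eq (D.bddMeas w) (D.bddMeas v)]
  rfl

theorem exists_bilin_mass : ∃ B : D.feSpace →ₗ[ℝ] D.feSpace →ₗ[ℝ] ℝ,
    ∀ w v, B w v = mass pb w v := by
  refine ⟨weightedForm pb.integrable_αbar D.feSpace.subtype D.feSpace.subtype D.bddMeas D.bddMeas,
    fun w v => ?_⟩
  rw [mass_eq (D.bddMeas w) (D.bddMeas v)]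
  rfl

/-- The hypothesis concerns the boundary part of each element; extension by zero moves it to the
common measure on the whole skeleton. -/
theorem BoundaryDataIntegrable.integrable {D : Discretisation pb} (hg : D.BoundaryDataIntegrable)
    (i : Fin D.spatial.card) :
    Integrable (fun y => D.fluxWeight i (D.inBdSet i) y * pb.gD y) D.faceMeasure := by
  have hT : MeasurableSet (faces (D.spatial.elem i) ∩ frontier pb.Ω) :=
    (measurableSet_faces _).inter isClosed_frontier.measurableSet
  have hsk : (faces (D.spatial.elem i) ∩ frontier pb.Ω) ∩ D.skeleton
      = faces (D.spatial.elem i) ∩ frontier pb.Ω :=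
    Set.inter_eq_left.2 fun x hx => Set.mem_iUnion_of_mem i hx.1
  have hm : ((surfaceMeasure d).restrict (faces (D.spatial.elem i) ∩ frontier pb.Ω)).prod
      pb.angleEnergy = D.faceMeasure.restrict
        ((faces (D.spatial.elem i) ∩ frontier pb.Ω) ×ˢ Set.univ) := by
    rw [faceMeasure, ← Measure.prod_restrict, Measure.restrict_univ, skeletonMeasure,
      Measure.restrict_restrict hT, hsk]
  have h1 := hg i
  rw [show ((sphereMeasure d).prod (volume.restrict pb.energies)) = pb.angleEnergy from rfl, hm,
    IntegrableOn, Measure.restrict_restrict (D.measurableSet_inflow i)] at h1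
  have hset : {y : Phase d | y.1 ∈ inflow (D.spatial.elem i) y.2.1} ∩
      (faces (D.spatial.elem i) ∩ frontier pb.Ω) ×ˢ Set.univ = D.inBdSet i := by
    ext y
    exact ⟨fun hy => ⟨hy.1, hy.2.1.2⟩, fun hy => ⟨hy.1, ⟨hy.1.1, hy.2⟩, Set.mem_univ _⟩⟩
  rw [hset] at h1
  refine ((integrable_indicator_iff (D.measurableSet_inBdSet i)).2 h1).congr
    (ae_of_all _ fun y => ?_)
  by_cases hy : y ∈ D.inBdSet i
  · simp only [fluxWeight, Set.indicator_of_mem hy]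
  · simp only [fluxWeight, Set.indicator_of_notMem hy, zero_mul]

theorem exists_linear_load (hg : D.BoundaryDataIntegrable) : ∃ ℓ : D.feSpace →ₗ[ℝ] ℝ,
    ∀ v, ℓ v = D.load v := by
  refine ⟨weightedFunctional (m := phaseMeasure pb) pb.f_integrable D.feSpace.subtype D.bddMeas
    + ∑ i, weightedFunctional (hg.integrable i) (D.trace i) (D.bddMeas_trace i), fun v => ?_⟩
  have hf₁ : Integrable (fun y => pb.f y * (v : Phase d → ℝ) y) (phaseMeasure pb) :=
    (D.bddMeas v).integrable_mul pb.f_integrable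
  have hterm := fun i => (D.bddMeas_trace i v).integrable_mul (hg.integrable i)
  have hf₂ : Integrable (fun y => ∑ i, D.fluxWeight i (D.inBdSet i) y * pb.gD y * D.trace i v y)
      D.faceMeasure := integrable_finsetSum _ fun i _ => hterm i
  have hload : D.load v = ∫ y, pb.f y * (v : Phase d → ℝ) y ∂(phaseMeasure pb)
      + ∫ y, ∑ i, D.fluxWeight i (D.inBdSet i) y * pb.gD y * D.trace i v y ∂D.faceMeasure := by
    refine iterated_integral_add_eq hf₁ hf₂ ?_
    filter_upwards [hf₁.prod_left_ae, ae_all_iff.2 fun i => (hterm i).prod_left_ae] with p hp hpi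
    have hbd : ∀ i, ∫ x in inflow (D.spatial.elem i) p.1 ∩ frontier pb.Ω,
          |normalFlux (D.spatial.elem i) p.1 x|
          * pb.gD (x, p.1, p.2) * traceIn (D.spatial.elem i) v x p.1 p.2 ∂(surfaceMeasure d)
        = ∫ x, D.fluxWeight i (D.inBdSet i) (x, p) * (pb.gD (x, p) * D.trace i v (x, p))
          ∂D.skeletonMeasure := fun i => by
      refine D.integral_inflow_boundary_eq i p fun x hx => ?_
      rw [mul_assoc, ← D.trace_of_mem v hx]
    simp only [Finset.sum_add_distrib, hbd]
    rw [D.sum_setIntegral_elem hp, integral_finsetSum _ fun i _ => hpi i]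
    · simp only [mul_assoc]
    · intro x hx
      have h1 : (v : Phase d → ℝ) (x, p) = 0 := D.eq_zero_of_mem_feSpace v.2 (Or.inl hx)
      rw [show (v : Phase d → ℝ) (x, p.1, p.2) = 0 from h1, mul_zero]
  rw [hload, integral_finsetSum _ fun i _ => hterm i]
  simp only [LinearMap.add_apply, LinearMap.sum_apply]
  rfl

/-- The face density of the squared energy norm. -/
noncomputable def normDensity (v : D.feSpace) (i : Fin D.spatial.card) (y : Phase d) : ℝ :=
  D.fluxWeight i (D.inSet i) y * (D.trace i v y - D.traceNbr i v y) ^ 2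
    + D.fluxWeight i (D.bdSet i) y * D.trace i v y ^ 2

theorem bddMeas_normDensity (v : D.feSpace) (i : Fin D.spatial.card) :
    BddMeas (D.normDensity v i) := by
  have h := (D.bddMeas_trace i v).sub (D.bddMeas_traceNbr i v)
  have h1 : D.normDensity v i = fun y => D.fluxWeight i (D.inSet i) y *
      ((D.trace i v y - D.traceNbr i v y) * (D.trace i v y - D.traceNbr i v y))
      + D.fluxWeight i (D.bdSet i) y * (D.trace i v y * D.trace i v y) := by
    funext y
    simp only [normDensity, sq]
  rw [h1]
  exact
    ((D.bddMeas_fluxWeight i (D.measurableSet_inSet i)).mul (h.mul h)).add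
    ((D.bddMeas_fluxWeight i (D.measurableSet_bdSet i)).mul
      ((D.bddMeas_trace i v).mul (D.bddMeas_trace i v)))

theorem fluxWeight_nonneg (i : Fin D.spatial.card) (s : Set (Phase d)) (y : Phase d) :
    0 ≤ D.fluxWeight i s y := Set.indicator_nonneg (fun _ _ => abs_nonneg _) _

theorem normDensity_nonneg (v : D.feSpace) (i : Fin D.spatial.card) (y : Phase d) :
    0 ≤ D.normDensity v i y :=
  add_nonneg (mul_nonneg (D.fluxWeight_nonneg _ _ _) (sq_nonneg _))
    (mul_nonneg (D.fluxWeight_nonneg _ _ _) (sq_nonneg _))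

theorem dgNorm_sq (hα : pb.Coercive) (v : D.feSpace) :
    D.dgNorm v ^ 2 = ∫ y, pb.αbar y.1 y.2.1 y.2.2 * (v : Phase d → ℝ) y * (v : Phase d → ℝ) y
        ∂(phaseMeasure pb)
      + (1 / 2) * ∫ y, ∑ i, D.normDensity v i y ∂D.faceMeasure := by
  have hf : Integrable (fun y => ∑ i, D.normDensity v i y) D.faceMeasure :=
    (BddMeas.sum _ fun i _ => D.bddMeas_normDensity v i).integrable _
  have hJ : ∫ E in pb.energies, ∫ μ : Direction d,
      (∑ i, (faceNormSq (D.spatial.elem i) μ (inflow (D.spatial.elem i) μ \ frontier pb.Ω)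
            (fun x => traceIn (D.spatial.elem i) v x μ E - traceOut (D.spatial.elem i) v x μ E)
          + faceNormSq (D.spatial.elem i) μ (faces (D.spatial.elem i) ∩ frontier pb.Ω)
            (fun x => traceIn (D.spatial.elem i) v x μ E))) ∂(sphereMeasure d)
      = ∫ y, ∑ i, D.normDensity v i y ∂D.faceMeasure := by
    refine iterated_integral_eq hf (ae_of_all _ fun p => ?_)
    have hslice : ∀ {g : Phase d → ℝ}, BddMeas g →
        Integrable (fun x => g (x, p)) D.skeletonMeasure :=
      fun hg => (hg.comp (by fun_prop)).integrable _
    have hin : ∀ i, faceNormSq (D.spatial.elem i) p.1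
          (inflow (D.spatial.elem i) p.1 \ frontier pb.Ω) (fun x =>
            traceIn (D.spatial.elem i) v x p.1 p.2 - traceOut (D.spatial.elem i) v x p.1 p.2)
        = ∫ x, D.fluxWeight i (D.inSet i) (x, p)
          * (D.trace i v (x, p) - D.traceNbr i v (x, p)) ^ 2 ∂D.skeletonMeasure := fun i => by
      refine D.integral_inflow_eq i p (D.ae_traceOut_eq.mono fun x hx hxf hxΩ => ?_)
      beta_reduce
      rw [hx i v p.1 p.2 hxf hxΩ, ← D.trace_of_mem v hxf]
    have hbd : ∀ i, faceNormSq (D.spatial.elem i) p.1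
          (faces (D.spatial.elem i) ∩ frontier pb.Ω) (fun x =>
            traceIn (D.spatial.elem i) v x p.1 p.2)
        = ∫ x, D.fluxWeight i (D.bdSet i) (x, p) * D.trace i v (x, p) ^ 2
          ∂D.skeletonMeasure := fun i => by
      refine D.integral_boundary_eq i p fun x hx => ?_
      beta_reduce
      rw [← D.trace_of_mem v hx]
    simp only [hin, hbd]
    rw [integral_finsetSum _ fun i _ => hslice (D.bddMeas_normDensity v i)]
    refine Finset.sum_congr rfl fun i _ => (integral_add ?_ ?_).symm
    · have h := (D.bddMeas_trace i v).sub (D.bddMeas_traceNbr i v)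
      simpa only [sq] using
        hslice ((D.bddMeas_fluxWeight i (D.measurableSet_inSet i)).mul (h.mul h))
    · simpa only [sq] using hslice ((D.bddMeas_fluxWeight i (D.measurableSet_bdSet i)).mul
        ((D.bddMeas_trace i v).mul (D.bddMeas_trace i v)))
  have hW : weightedNorm pb pb.Ω Set.univ pb.energies v ^ 2
      = ∫ y, pb.αbar y.1 y.2.1 y.2.2 * (v : Phase d → ℝ) y * (v : Phase d → ℝ) y
        ∂(phaseMeasure pb) := by
    rw [weightedNorm_sq hα subset_rfl pb.isOpen_Ω.measurableSet subset_rfl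
      pb.measurableSet_energies (D.bddMeas v)]
    congr 1
    exact Measure.restrict_eq_self_of_ae_mem
      (pb.ae_mem.mono fun y hy => ⟨hy.1, Set.mem_univ _, hy.2⟩)
  rw [dgNorm, hJ, hW, Real.sq_sqrt]
  rw [← hW]
  exact add_nonneg (sq_nonneg _) (mul_nonneg (by norm_num) (integral_nonneg fun y =>
    Finset.sum_nonneg fun i _ => D.normDensity_nonneg v i y))

end Discretisation

end Boltzmann

namespace Boltzmann

open MeasureTheory Filter Topology

namespace Discretisation

variable {d : ℕ} {pb : Problem d} (D : Discretisation pb)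

/-! ### Coercivity of the scheme in the energy norm -/

theorem fluxWeight_of_notMem_faces {i : Fin D.spatial.card} {s : Set (Phase d)}
    (hs : s ⊆ D.faceSet i) {x : Space d} (hx : x ∉ faces (D.spatial.elem i))
    (p : Direction d × ℝ) : D.fluxWeight i s (x, p) = 0 := by
  have h1 : (x, p) ∉ D.faceSet i := hx
  exact Set.indicator_of_notMem (fun h => h1 (hs h)) _

theorem mem_outSet_iff {i : Fin D.spatial.card} {x : Space d} {p : Direction d × ℝ} :
    (x, p) ∈ D.outSet i ↔
      x ∈ faces (D.spatial.elem i) ∧ 0 ≤ normalFlux (D.spatial.elem i) p.1 x := Iff.rfl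

theorem mem_inSet_iff {i : Fin D.spatial.card} {x : Space d} {p : Direction d × ℝ} :
    (x, p) ∈ D.inSet i ↔ (x ∈ faces (D.spatial.elem i) ∧
      normalFlux (D.spatial.elem i) p.1 x < 0) ∧ x ∉ frontier pb.Ω := Iff.rfl

theorem mem_bdSet_iff {i : Fin D.spatial.card} {x : Space d} {p : Direction d × ℝ} :
    (x, p) ∈ D.bdSet i ↔ x ∈ faces (D.spatial.elem i) ∧ x ∈ frontier pb.Ω := Iff.rfl

theorem fluxWeight_outSet {i : Fin D.spatial.card} {x : Space d}
    (hx : x ∈ faces (D.spatial.elem i)) (p : Direction d × ℝ) :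
    D.fluxWeight i (D.outSet i) (x, p) = max (normalFlux (D.spatial.elem i) p.1 x) 0 := by
  by_cases h : (x, p) ∈ D.outSet i
  · have h2 := (D.mem_outSet_iff.1 h).2
    rw [fluxWeight, Set.indicator_of_mem h, max_eq_left h2]
    exact abs_of_nonneg h2
  · rw [fluxWeight, Set.indicator_of_notMem h]
    rw [mem_outSet_iff, not_and, not_le] at h
    exact (max_eq_right (h hx).le).symm

theorem fluxWeight_inSet {i : Fin D.spatial.card} {x : Space d}
    (hx : x ∈ faces (D.spatial.elem i)) (hxΩ : x ∉ frontier pb.Ω) (p : Direction d × ℝ) :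
    D.fluxWeight i (D.inSet i) (x, p) = max (-normalFlux (D.spatial.elem i) p.1 x) 0 := by
  by_cases h : (x, p) ∈ D.inSet i
  · have h2 := (D.mem_inSet_iff.1 h).1.2
    rw [fluxWeight, Set.indicator_of_mem h, max_eq_left (by linarith)]
    exact abs_of_neg h2
  · rw [fluxWeight, Set.indicator_of_notMem h]
    rw [mem_inSet_iff] at h
    refine (max_eq_right ?_).symm
    by_contra! hcon
    exact h ⟨⟨hx, by linarith⟩, hxΩ⟩

theorem fluxWeight_inSet_of_mem_frontier {i : Fin D.spatial.card} {x : Space d}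
    (hxΩ : x ∈ frontier pb.Ω) (p : Direction d × ℝ) :
    D.fluxWeight i (D.inSet i) (x, p) = 0 :=
  Set.indicator_of_notMem (fun h => (D.mem_inSet_iff.1 h).2 hxΩ) _

theorem fluxWeight_bdSet {i : Fin D.spatial.card} {x : Space d}
    (hx : x ∈ faces (D.spatial.elem i)) (hxΩ : x ∈ frontier pb.Ω) (p : Direction d × ℝ) :
    D.fluxWeight i (D.bdSet i) (x, p) = |normalFlux (D.spatial.elem i) p.1 x| :=
  Set.indicator_of_mem (D.mem_bdSet_iff.2 ⟨hx, hxΩ⟩) _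

theorem fluxWeight_bdSet_of_notMem_frontier {i : Fin D.spatial.card} {x : Space d}
    (hxΩ : x ∉ frontier pb.Ω) (p : Direction d × ℝ) :
    D.fluxWeight i (D.bdSet i) (x, p) = 0 :=
  Set.indicator_of_notMem (fun h => hxΩ (D.mem_bdSet_iff.1 h).2) _

/-- The flux of half the squared trace through the faces of the element `i`. -/
noncomputable def halfFlux (v : D.feSpace) (i : Fin D.spatial.card) (y : Phase d) : ℝ :=
  (1 / 2) * (normalFlux (D.spatial.elem i) y.2.1 y.1 * (D.trace i v y * D.trace i v y))

theorem bddMeas_halfFlux (v : D.feSpace) (i : Fin D.spatial.card) : BddMeas (D.halfFlux v i) :=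
  (BddMeas.const (1 / 2)).mul (BddMeas.mul ⟨measurable_normalFlux _, 1, fun _ =>
    abs_normalFlux_le _ _ _⟩ ((D.bddMeas_trace i v).mul (D.bddMeas_trace i v)))

/-- The divergence theorem applied to half the square of the smooth representative, since v μ·∇v =
μ·∇(v²/2). -/
theorem setIntegral_mul_dirDeriv (v : D.feSpace) (i : Fin D.spatial.card) (p : Direction d × ℝ) :
    ∫ x in D.spatial.elem i, (v : Phase d → ℝ) (x, p) * D.dirDeriv v (x, p)
      = ∫ x, D.halfFlux v i (x, p) ∂D.skeletonMeasure := by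
  obtain ⟨A, hA, hfr⟩ := D.spatial.exists_arrangement
  obtain ⟨V, hV, hvV⟩ := D.exists_smoothRep v.2 i
  have hpoly := D.spatial.isPolytope i
  have hg : ContDiff ℝ 1 fun x => (1 / 2 : ℝ) * (V (x, p.1, p.2) * V (x, p.1, p.2)) :=
    contDiff_const.mul ((hV.contDiff p.1 p.2).mul (hV.contDiff p.1 p.2))
  have hdiv := setIntegral_fderiv_eq_faces hA hpoly.isOpen hpoly.isBounded hpoly.interior_closure
    (hfr i) (m := (p.1 : Space d)) (by simp) hg
  have hleft : ∫ x in D.spatial.elem i, (v : Phase d → ℝ) (x, p) * D.dirDeriv v (x, p)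
      = ∫ x in D.spatial.elem i, fderiv ℝ (fun x => (1 / 2 : ℝ) *
        (V (x, p.1, p.2) * V (x, p.1, p.2))) x (p.1 : Space d) := by
    refine setIntegral_congr_fun hpoly.isOpen.measurableSet fun x hx => ?_
    have hd : DifferentiableAt ℝ (fun x => V (x, p.1, p.2)) x :=
      (hV.contDiff p.1 p.2).differentiable one_ne_zero x
    have hdd : DifferentiableAt ℝ (fun x => V (x, p.1, p.2) * V (x, p.1, p.2)) x := hd.mul hd
    beta_reduce
    rw [show D.dirDeriv v (x, p) = _ from D.dirDeriv_eq v hvV hx p.1 p.2,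
      show (v : Phase d → ℝ) (x, p) = _ from hvV x hx p.1 p.2,
      fderiv_const_mul hdd, fderiv_fun_mul hd hd]
    simp only [smul_apply, add_apply, smul_eq_mul]
    ring
  have hsub : faces (D.spatial.elem i) ⊆ D.skeleton := fun x hx => Set.mem_iUnion_of_mem i hx
  rw [hleft, hdiv, skeletonMeasure,
    setIntegral_eq_of_subset_of_forall_sdiff_eq_zero (measurableSet_skeleton D) hsub]
  · refine setIntegral_congr_fun (measurableSet_faces _) fun x hx => ?_
    beta_reduce
    rw [halfFlux, show D.trace i v (x, p) = _ from D.trace_of_mem v hx p.1 p.2,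
      traceIn_eq hV hvV hx, normalFlux]
    ring
  · intro x hx
    have hxn : x ∉ faces (D.spatial.elem i) := hx.2
    rw [halfFlux, D.trace_of_notMem v (y := (x, p)) hxn]
    ring

theorem integral_transport_self (v : D.feSpace) :
    ∫ y, (v : Phase d → ℝ) y * D.dirDeriv v y ∂(phaseMeasure pb)
      = ∫ y, ∑ i, D.halfFlux v i y ∂D.faceMeasure := by
  have h1 : Integrable (fun y => (v : Phase d → ℝ) y * D.dirDeriv v y) (phaseMeasure pb) :=
    ((D.bddMeas v).mul (D.bddMeas_dirDeriv v)).integrable _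
  have h2 : Integrable (fun y => ∑ i, D.halfFlux v i y) D.faceMeasure :=
    (BddMeas.sum _ fun i _ => D.bddMeas_halfFlux v i).integrable _
  rw [phaseMeasure, integral_prod_symm _ h1, faceMeasure, integral_prod_symm _ h2]
  refine integral_congr_ae ?_
  filter_upwards [h1.prod_left_ae] with p hp
  rw [← D.sum_setIntegral_elem hp, integral_finsetSum _ fun i _ =>
    ((D.bddMeas_halfFlux v i).comp (by fun_prop)).integrable _]
  · exact Finset.sum_congr rfl fun i _ => D.setIntegral_mul_dirDeriv v i p
  · intro x hx
    rw [show (v : Phase d → ℝ) (x, p) = 0 from D.eq_zero_of_mem_feSpace v.2 (Or.inl hx), zero_mul]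

/-- On a boundary face with flux f and trace t, max(f,0)t² - ½ft² = ½|f|t². On an interior face with
upwind trace a, downwind trace b and flux f ≥ 0 out of the upwind element, fa² - fab - ½fa² + ½fb² =
½f(a-b)². -/
theorem face_balance {A : Finset (Space d × ℝ)} (hA : IsArrangement A)
    (hfr : ∀ i, frontier (D.spatial.elem i) ⊆ ⋃ h ∈ A, hyp h) (v : D.feSpace) {x : Space d}
    (hx : Generic A x) (p : Direction d × ℝ) :
    ∑ i, (D.faceDensity v v i (x, p) - D.halfFlux v i (x, p))
      = ∑ i, (1 / 2) * D.normDensity v i (x, p) := by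
  have hoff : ∀ i, x ∉ faces (D.spatial.elem i) →
      D.faceDensity v v i (x, p) - D.halfFlux v i (x, p) = 0 ∧
      (1 / 2) * D.normDensity v i (x, p) = 0 := fun i hi => by
    simp only [faceDensity, halfFlux, normDensity,
      D.fluxWeight_of_notMem_faces (D.outSet_subset i) hi,
      D.fluxWeight_of_notMem_faces (D.inSet_subset i) hi,
      D.fluxWeight_of_notMem_faces (D.bdSet_subset i) hi,
      D.trace_of_notMem v (y := (x, p)) hi]
    constructor <;> ring
  by_cases hxΩ : x ∈ frontier pb.Ω
  · refine Finset.sum_congr rfl fun i _ => ?_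
    by_cases hi : x ∈ faces (D.spatial.elem i)
    · simp only [faceDensity, halfFlux, normDensity, D.fluxWeight_outSet hi,
        D.fluxWeight_inSet_of_mem_frontier hxΩ, D.fluxWeight_bdSet hi hxΩ]
      rcases le_total 0 (normalFlux (D.spatial.elem i) p.1 x) with h | h
      · rw [max_eq_left h, abs_of_nonneg h]
        ring
      · rw [max_eq_right h, abs_of_nonpos h]
        ring
    · rw [(hoff i hi).1, (hoff i hi).2]
  by_cases hex : ∃ i, x ∈ faces (D.spatial.elem i)
  · obtain ⟨i, hi⟩ := hex
    obtain ⟨j, hji, hj, hn, -, honly⟩ :=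
      D.spatial.exists_neighbour pb.isOpen_Ω hA hfr hx hi hxΩ
    have hflux : normalFlux (D.spatial.elem j) p.1 x = -normalFlux (D.spatial.elem i) p.1 x := by
      rw [normalFlux, hn, inner_neg_right, normalFlux]
    have hother : ∀ k, k ≠ i ∧ k ≠ j → x ∉ faces (D.spatial.elem k) := fun k hk hxk =>
      (honly k hxk).elim hk.1 hk.2
    -- Only the two elements sharing x contribute, and their fluxes are opposite.
    rw [Fintype.sum_eq_add i j hji.symm fun k hk => (hoff k (hother k hk)).1,
      Fintype.sum_eq_add i j hji.symm fun k hk => (hoff k (hother k hk)).2]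
    simp only [faceDensity, halfFlux, normDensity, D.fluxWeight_outSet hi, D.fluxWeight_outSet hj,
      D.fluxWeight_inSet hi hxΩ, D.fluxWeight_inSet hj hxΩ,
      D.fluxWeight_bdSet_of_notMem_frontier hxΩ, D.traceNbr_eq hji v hi honly,
      D.traceNbr_eq hji.symm v hj fun k hk => (honly k hk).symm, hflux, neg_neg]
    rcases le_total 0 (normalFlux (D.spatial.elem i) p.1 x) with h | h
    · rw [max_eq_left h, max_eq_right (neg_nonpos.2 h)]
      ring
    · rw [max_eq_right h, max_eq_left (neg_nonneg.2 h)]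
      ring
  · push Not at hex
    rw [Finset.sum_eq_zero fun i _ => (hoff i (hex i)).1,
      Finset.sum_eq_zero fun i _ => (hoff i (hex i)).2]

theorem ae_face_balance (v : D.feSpace) : ∀ᵐ y ∂D.faceMeasure,
    ∑ i, D.faceDensity v v i y - ∑ i, D.halfFlux v i y = (1 / 2) * ∑ i, D.normDensity v i y := by
  obtain ⟨A, hA, hfr⟩ := D.spatial.exists_arrangement
  have h1 : ∀ᵐ y ∂D.faceMeasure, Generic A y.1 :=
    Measure.quasiMeasurePreserving_fst.ae (ae_restrict_of_ae hA.ae_generic)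
  filter_upwards [h1] with y hy
  rw [← Finset.sum_sub_distrib, Finset.mul_sum]
  exact D.face_balance hA hfr v hy y.2

/-- Integration by parts and the face balance give a(v,v) exactly, as the face part of the norm plus
∫(α+β)v². Only the scattering bound is an inequality. -/
theorem dgNorm_sq_le (hα : pb.Coercive) (v : D.feSpace) :
    D.dgNorm v ^ 2 ≤ D.formA v v - formS pb v v := by
  have hv := D.bddMeas v
  have hI : ∀ {k : Phase d → ℝ}, Integrable k (phaseMeasure pb) →
      Integrable (fun y => k y * (v : Phase d → ℝ) y * (v : Phase d → ℝ) y) (phaseMeasure pb) :=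
    fun hk => hv.integrable_mul (hv.integrable_mul hk)
  have hα' := hI pb.integrable_α
  have hβ := hI pb.integrable_β
  have hγ := hI pb.integrable_γ
  have hfd : Integrable (fun y => ∑ i, D.faceDensity v v i y) D.faceMeasure :=
    (BddMeas.sum _ fun i _ => D.bddMeas_faceDensity v v i).integrable _
  have hhf : Integrable (fun y => ∑ i, D.halfFlux v i y) D.faceMeasure :=
    (BddMeas.sum _ fun i _ => D.bddMeas_halfFlux v i).integrable _
  have hface : ∫ y, ∑ i, D.faceDensity v v i y ∂D.faceMeasure
      - ∫ y, ∑ i, D.halfFlux v i y ∂D.faceMeasure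
      = (1 / 2) * ∫ y, ∑ i, D.normDensity v i y ∂D.faceMeasure := by
    rw [← integral_sub hfd hhf, ← integral_const_mul]
    exact integral_congr_ae (D.ae_face_balance v)
  have hvol : ∫ y, D.volDensity v v y ∂(phaseMeasure pb)
      = -∫ y, ∑ i, D.halfFlux v i y ∂D.faceMeasure
        + (∫ y, pb.α y.1 y.2.2 * (v : Phase d → ℝ) y * (v : Phase d → ℝ) y ∂(phaseMeasure pb)
        + ∫ y, pb.β y.1 y.2.1 y.2.2 * (v : Phase d → ℝ) y * (v : Phase d → ℝ) y
          ∂(phaseMeasure pb)) := by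
    rw [← D.integral_transport_self, ← integral_add hα' hβ, ← integral_neg, ← integral_add]
    · refine integral_congr_ae (ae_of_all _ fun y => ?_)
      simp only [volDensity]
      ring
    · exact (hv.mul (D.bddMeas_dirDeriv v)).neg.integrable _
    · exact hα'.add hβ
  have hbar : ∫ y, pb.αbar y.1 y.2.1 y.2.2 * (v : Phase d → ℝ) y * (v : Phase d → ℝ) y
        ∂(phaseMeasure pb)
      = ∫ y, pb.α y.1 y.2.2 * (v : Phase d → ℝ) y * (v : Phase d → ℝ) y ∂(phaseMeasure pb)
        + (1 / 2) * (∫ y, pb.β y.1 y.2.1 y.2.2 * (v : Phase d → ℝ) y * (v : Phase d → ℝ) y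
          ∂(phaseMeasure pb)
        - ∫ y, pb.γ y.1 y.2.1 y.2.2 * (v : Phase d → ℝ) y * (v : Phase d → ℝ) y
          ∂(phaseMeasure pb)) := by
    have hβγ : Integrable (fun y => (1 / 2) * (pb.β y.1 y.2.1 y.2.2 * (v : Phase d → ℝ) y
        * (v : Phase d → ℝ) y - pb.γ y.1 y.2.1 y.2.2 * (v : Phase d → ℝ) y
        * (v : Phase d → ℝ) y)) (phaseMeasure pb) := (hβ.sub hγ).const_mul _
    rw [← integral_sub hβ hγ, ← integral_const_mul, ← integral_add hα' hβγ]
    refine integral_congr_ae (ae_of_all _ fun y => ?_)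
    simp only [Problem.αbar]
    ring
  rw [D.dgNorm_sq hα, D.formA_eq, hvol, hbar]
  linarith [formS_self_le (pb := pb) hv]

end Discretisation

end Boltzmann

namespace Boltzmann

open MeasureTheory Filter Topology

/-! ### Disjointness of energy groups and curved angular elements -/

theorem EnergyMesh.disjoint_group {a b : ℝ} (T : EnergyMesh a b) {g h : Fin T.card}
    (hgh : g ≠ h) : Disjoint (T.group g) (T.group h) := by
  wlog hlt : g < h generalizing g h
  · exact (this hgh.symm (lt_of_le_of_ne (not_lt.1 hlt) hgh.symm)).symm
  have h1 : T.node h.castSucc ≤ T.node g.succ :=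
    T.anti.antitone (Fin.succ_le_castSucc_iff.2 hlt)
  refine Set.disjoint_left.2 fun x hx hx' => ?_
  exact absurd (hx.1.trans hx'.2) (not_lt.2 h1)

theorem AngularMesh.disjoint_curved {d : ℕ} (T : AngularMesh d) {i j : Fin T.card}
    (hij : i ≠ j) : Disjoint (T.cell i).curved (T.cell j).curved :=
  Set.disjoint_left.2 fun _ hx hx' => Set.disjoint_left.1 (T.disjoint i j hij) hx hx'

namespace Discretisation

variable {d : ℕ} {pb : Problem d} (D : Discretisation pb)

/-! ### The estimator -/

theorem weightedNorm_domain_sq (hα : pb.Coercive) (v : D.feSpace) :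
    weightedNorm pb pb.Ω Set.univ pb.energies v ^ 2 = mass pb v v := by
  rw [weightedNorm_sq hα subset_rfl pb.isOpen_Ω.measurableSet subset_rfl
    pb.measurableSet_energies (D.bddMeas v), mass_eq (D.bddMeas v) (D.bddMeas v)]
  congr 1
  exact Measure.restrict_eq_self_of_ae_mem
    (pb.ae_mem.mono fun y hy => ⟨hy.1, Set.mem_univ _, hy.2⟩)

theorem weightedNorm_nonneg (K : Set (Space d)) (M : Set (Direction d)) (G : Set ℝ)
    (v : Phase d → ℝ) : 0 ≤ weightedNorm pb K M G v := Real.sqrt_nonneg _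

/-- The product elements are disjoint and v vanishes off their union, so the squared local norms add
up to the global one. -/
theorem sum_indicator_sq (hα : pb.Coercive) (v : D.feSpace) :
    ∑ i, ∑ j, ∑ g, D.indicator v i j g ^ 2 = mass pb v v := by
  have hv := D.bddMeas v
  set F : Phase d → ℝ := fun y => pb.αbar y.1 y.2.1 y.2.2 * (v : Phase d → ℝ) y
    * (v : Phase d → ℝ) y with hF
  have hint : Integrable F (phaseMeasure pb) :=
    hv.integrable_mul (hv.integrable_mul pb.integrable_αbar)
  set O : Fin D.spatial.card × Fin D.angular.card × Fin D.energy.card → Set (Phase d) :=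
    fun k => D.spatial.elem k.1 ×ˢ (D.angular.cell k.2.1).curved ×ˢ D.energy.group k.2.2 with hO
  have hm : ∀ k, MeasurableSet (O k) := fun k =>
    (D.spatial.isPolytope k.1).isOpen.measurableSet.prod
      ((D.angular.cell k.2.1).isOpen_curved.measurableSet.prod measurableSet_Ioo)
  have hdisj : Pairwise (Function.onFun Disjoint O) := by
    intro k l hkl
    by_cases h1 : k.1 = l.1
    · by_cases h2 : k.2.1 = l.2.1
      · have h3 : k.2.2 ≠ l.2.2 := fun h3 => hkl (Prod.ext h1 (Prod.ext h2 h3))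
        exact Set.disjoint_prod.2 (Or.inr (Set.disjoint_prod.2
          (Or.inr (D.energy.disjoint_group h3))))
      · exact Set.disjoint_prod.2 (Or.inr (Set.disjoint_prod.2
          (Or.inl (D.angular.disjoint_curved h2))))
    · exact Set.disjoint_prod.2 (Or.inl (D.spatial.disjoint _ _ h1))
  have hzero : ∀ y ∉ ⋃ k, O k, F y = 0 := by
    intro y hy
    have h0 : (v : Phase d → ℝ) y = 0 := by
      refine D.eq_zero_of_mem_feSpace v.2 ?_
      by_contra! hcon
      obtain ⟨hi, hj, hg⟩ := hcon
      obtain ⟨i, hi⟩ := Set.mem_iUnion.1 hi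
      obtain ⟨j, hj⟩ := Set.mem_iUnion.1 hj
      obtain ⟨g, hg⟩ := Set.mem_iUnion.1 hg
      exact hy (Set.mem_iUnion.2 ⟨(i, j, g), hi, hj, hg⟩)
    rw [hF]
    simp only [h0, mul_zero]
  rw [mass_eq hv hv, ← setIntegral_eq_integral_of_forall_compl_eq_zero hzero,
    integral_iUnion_fintype hm hdisj fun k => hint.integrableOn, Fintype.sum_prod_type]
  refine Finset.sum_congr rfl fun i _ => ?_
  rw [Fintype.sum_prod_type]
  refine Finset.sum_congr rfl fun j _ => Finset.sum_congr rfl fun g _ => ?_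
  exact weightedNorm_sq hα (D.spatial.subset i) (D.spatial.isPolytope i).isOpen.measurableSet
    (D.energy.group_subset g) measurableSet_Ioo hv

theorem estimator_eq (hα : pb.Coercive) (v : D.feSpace) :
    D.estimator v = weightedNorm pb pb.Ω Set.univ pb.energies v := by
  rw [estimator, D.sum_indicator_sq hα, ← D.weightedNorm_domain_sq hα,
    Real.sqrt_sq (weightedNorm_nonneg _ _ _ _)]

/-! ### The mass form and the residual -/

theorem mass_comm (w v : D.feSpace) : mass pb w v = mass pb v w := by
  rw [mass_eq (D.bddMeas w) (D.bddMeas v), mass_eq (D.bddMeas v) (D.bddMeas w)]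
  refine integral_congr_ae (ae_of_all _ fun y => ?_)
  ring

theorem mass_self_nonneg (hα : pb.Coercive) (v : D.feSpace) : 0 ≤ mass pb v v := by
  rw [← D.weightedNorm_domain_sq hα]
  exact sq_nonneg _

theorem eq_zero_of_mass_self_eq_zero (hα : pb.Coercive) {v : D.feSpace}
    (h : mass pb v v = 0) : v = 0 := by
  have hv := D.bddMeas v
  rw [mass_eq hv hv] at h
  have hint : Integrable (fun y => pb.αbar y.1 y.2.1 y.2.2 * (v : Phase d → ℝ) y
      * (v : Phase d → ℝ) y) (phaseMeasure pb) :=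
    hv.integrable_mul (hv.integrable_mul pb.integrable_αbar)
  have h0 := (integral_eq_zero_iff_of_nonneg_ae (hα.ae_pos.mono fun y hy => by
    rw [mul_assoc]
    exact mul_nonneg hy.le (mul_self_nonneg _)) hint).1 h
  refine Subtype.ext (D.eq_zero_of_ae_eq_zero v.2 ?_)
  filter_upwards [h0, hα.ae_pos] with y hy hpos
  rw [Pi.zero_apply, mul_assoc] at hy
  exact mul_self_eq_zero.1 ((mul_eq_zero.1 hy).resolve_left hpos.ne')

theorem mass_self_le (hα : pb.Coercive) (v : D.feSpace) : mass pb v v ≤ D.dgNorm v ^ 2 := by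
  rw [D.dgNorm_sq hα, mass_eq (D.bddMeas v) (D.bddMeas v)]
  exact le_add_of_nonneg_right (mul_nonneg (by norm_num) (integral_nonneg fun y =>
    Finset.sum_nonneg fun i _ => D.normDensity_nonneg v i y))

theorem dgNorm_nonneg (v : Phase d → ℝ) : 0 ≤ D.dgNorm v := Real.sqrt_nonneg _

/-- The bilinear form `a - s` of the scheme. -/
theorem exists_bilin_scheme : ∃ G : D.feSpace →ₗ[ℝ] D.feSpace →ₗ[ℝ] ℝ,
    ∀ w v, G w v = D.formA w v - formS pb w v := by
  obtain ⟨A, hA⟩ := D.exists_bilin_formA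
  obtain ⟨S, hS⟩ := D.exists_bilin_formS
  exact ⟨A - S, fun w v => by rw [LinearMap.sub_apply, LinearMap.sub_apply, hA, hS]⟩

/-- The error is bounded by the weighted norm of the residual function. -/
theorem dgNorm_sub_le (hα : pb.Coercive) {u w r : D.feSpace} (hu : D.IsSolution u)
    (hr : D.IsResidualFunction w r) :
    D.dgNorm (u - w : D.feSpace) ≤ weightedNorm pb pb.Ω Set.univ pb.energies r := by
  obtain ⟨G, hG⟩ := D.exists_bilin_scheme
  obtain ⟨m, hm⟩ := D.exists_bilin_mass
  set e : D.feSpace := u - w with he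
  -- Coercivity, then the scheme for u: (a-s)(u-w, e) = ℓ(e) - (a-s)(w, e), which is the residual of
  -- w tested with the error.
  have h1 : D.dgNorm e ^ 2 ≤ mass pb r e := by
    refine (D.dgNorm_sq_le hα e).trans (le_of_eq ?_)
    rw [← hG, hr e, residual, ← hG w e, eq_sub_of_add_eq' (hu e).symm, ← hG, he, map_sub G,
      LinearMap.sub_apply]
  -- Young in place of Cauchy–Schwarz: 2|||e|||² ≤ 2(ᾱr,e) ≤ (ᾱr,r) + (ᾱe,e), and the last term is
  -- absorbed by |||e|||².
  have h2 : 0 ≤ mass pb (r - e : D.feSpace) (r - e : D.feSpace) := D.mass_self_nonneg hα _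
  have h3 : mass pb (r - e : D.feSpace) (r - e : D.feSpace)
      = mass pb r r - 2 * mass pb r e + mass pb e e := by
    rw [← hm, map_sub, map_sub, LinearMap.sub_apply, LinearMap.sub_apply, hm, hm, hm, hm,
      D.mass_comm e r]
    ring
  refine (sq_le_sq₀ (D.dgNorm_nonneg _) (weightedNorm_nonneg _ _ _ _)).1 ?_
  rw [D.weightedNorm_domain_sq hα]
  linarith [D.mass_self_le hα e]

/-! ### Matrices -/

variable {N : ℕ} (φ : Module.Basis (Fin N) ℝ D.feSpace)

theorem expand_eq (c : Fin N → ℝ) : D.expand φ c = φ.equivFun.symm c :=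
  (φ.equivFun_symm_apply c).symm

theorem exists_expand (v : D.feSpace) : ∃ c, D.expand φ c = v :=
  ⟨φ.equivFun v, by rw [expand_eq, LinearEquiv.symm_apply_apply]⟩

theorem expand_injective : Function.Injective (D.expand φ) := fun c c' h => by
  rw [expand_eq, expand_eq] at h
  exact φ.equivFun.symm.injective h

theorem bilin_expand (G : D.feSpace →ₗ[ℝ] D.feSpace →ₗ[ℝ] ℝ) (c : Fin N → ℝ) (v : D.feSpace) :
    G (D.expand φ c) v = ∑ j, G (φ j) v * c j := by
  simp only [expand, map_sum, map_smul, LinearMap.sum_apply, LinearMap.smul_apply, smul_eq_mul,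
    mul_comm]

theorem scheme_expand (c : Fin N → ℝ) (i : Fin N) :
    D.formA (D.expand φ c) (φ i) - formS pb (D.expand φ c) (φ i)
      = ((D.matA φ - D.matS φ).mulVec c) i := by
  obtain ⟨G, hG⟩ := D.exists_bilin_scheme
  rw [← hG, bilin_expand, Matrix.mulVec, dotProduct]
  refine Finset.sum_congr rfl fun j _ => ?_
  rw [hG]
  rfl

theorem mass_expand (c : Fin N → ℝ) (i : Fin N) :
    mass pb (D.expand φ c) (φ i) = ((D.matM φ).mulVec c) i := by
  obtain ⟨m, hm⟩ := D.exists_bilin_mass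
  rw [← hm, bilin_expand, Matrix.mulVec, dotProduct]
  refine Finset.sum_congr rfl fun j _ => ?_
  rw [hm, D.mass_comm]
  rfl

theorem mass_expand_self (c : Fin N → ℝ) :
    mass pb (D.expand φ c) (D.expand φ c) = c ⬝ᵥ (D.matM φ).mulVec c := by
  obtain ⟨m, hm⟩ := D.exists_bilin_mass
  have h1 : m (D.expand φ c) (D.expand φ c) = ∑ i, c i * m (D.expand φ c) (φ i) := by
    nth_rewrite 2 [expand]
    simp only [map_sum, map_smul, smul_eq_mul]
  rw [← hm, h1, dotProduct]
  simp only [hm, mass_expand]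

theorem isResidualFunction_expand_iff (hg : D.BoundaryDataIntegrable) (c ρ : Fin N → ℝ) :
    D.IsResidualFunction (D.expand φ c) (D.expand φ ρ) ↔
      (D.matM φ).mulVec ρ = D.vecF φ - (D.matA φ - D.matS φ).mulVec c := by
  obtain ⟨G, hG⟩ := D.exists_bilin_scheme
  obtain ⟨m, hm⟩ := D.exists_bilin_mass
  obtain ⟨ℓ, hℓ⟩ := D.exists_linear_load hg
  have hres : ∀ v : D.feSpace, D.residual (D.expand φ c) v = (ℓ - G (D.expand φ c)) v := fun v => by
    rw [residual, LinearMap.sub_apply, hℓ, hG]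
  constructor
  · intro h
    funext i
    rw [← mass_expand, h (φ i), residual, scheme_expand]
    rfl
  · intro h
    -- Both sides are linear in the test function, so agreement on the basis suffices.
    have h1 : m (D.expand φ ρ) = ℓ - G (D.expand φ c) := φ.ext fun i => by
      rw [← hres, hm, mass_expand, h, residual, scheme_expand]
      rfl
    intro v
    rw [hres, ← h1, hm]

/-- A solution is a function whose residual is represented by zero, so the matrix form of the scheme
is the case ρ = 0 of the residual equation. -/
theorem isSolution_iff (w : D.feSpace) : D.IsSolution w ↔ D.IsResidualFunction w 0 := by
  obtain ⟨m, hm⟩ := D.exists_bilin_mass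
  refine forall_congr' fun v => ?_
  rw [← hm, map_zero, LinearMap.zero_apply, residual]
  constructor <;> intro h <;> linarith

theorem isSolution_expand_iff (hg : D.BoundaryDataIntegrable) (c : Fin N → ℝ) :
    D.IsSolution (D.expand φ c) ↔ (D.matA φ - D.matS φ).mulVec c = D.vecF φ := by
  have h0 : D.expand φ 0 = 0 := by rw [expand_eq, map_zero]
  rw [isSolution_iff, ← h0, isResidualFunction_expand_iff D φ hg, Matrix.mulVec_zero, eq_comm,
    sub_eq_zero, eq_comm]

theorem posDef_matM (hα : pb.Coercive) : (D.matM φ).PosDef := by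
  refine Matrix.PosDef.of_dotProduct_mulVec_pos ?_ fun c hc => ?_
  · ext i j
    simp only [Matrix.conjTranspose_apply, star_trivial, matM, Matrix.of_apply]
    exact D.mass_comm _ _
  · rw [star_trivial, ← mass_expand_self]
    refine lt_of_le_of_ne (D.mass_self_nonneg hα _) fun h => hc ?_
    refine D.expand_injective φ ?_
    rw [D.eq_zero_of_mass_self_eq_zero hα h.symm, expand_eq, map_zero]

/-- A kernel vector expands to a function with (a-s)(v,v) = 0; coercivity and definiteness of the
mass form make it zero. -/
theorem isUnit_det_scheme (hα : pb.Coercive) : IsUnit (D.matA φ - D.matS φ).det := by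
  obtain ⟨G, hG⟩ := D.exists_bilin_scheme
  rw [← Matrix.isUnit_iff_isUnit_det, ← Matrix.mulVec_injective_iff_isUnit]
  refine (injective_iff_map_eq_zero (D.matA φ - D.matS φ).mulVecLin).2 fun c hc => ?_
  rw [Matrix.mulVecLin_apply] at hc
  have h1 : G (D.expand φ c) = 0 := φ.ext fun i => by
    rw [hG, scheme_expand, hc]
    rfl
  have h2 : D.dgNorm (D.expand φ c) ^ 2 ≤ 0 := by
    refine (D.dgNorm_sq_le hα _).trans (le_of_eq ?_)
    rw [← hG, h1, LinearMap.zero_apply]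
  have h3 : mass pb (D.expand φ c) (D.expand φ c) = 0 :=
    le_antisymm ((D.mass_self_le hα _).trans h2) (D.mass_self_nonneg hα _)
  refine D.expand_injective φ ?_
  rw [D.eq_zero_of_mass_self_eq_zero hα h3, expand_eq, map_zero]

theorem existsUnique_isSolution (hα : pb.Coercive) (hg : D.BoundaryDataIntegrable)
    {N : ℕ} (φ : Module.Basis (Fin N) ℝ D.feSpace) : ∃! u : D.feSpace, D.IsSolution u := by
  have hK := D.isUnit_det_scheme φ hα
  refine ⟨D.expand φ ((D.matA φ - D.matS φ)⁻¹.mulVec (D.vecF φ)), ?_, fun w hw => ?_⟩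
  · beta_reduce
    rw [isSolution_expand_iff D φ hg, Matrix.mulVec_mulVec, Matrix.mul_nonsing_inv _ hK,
      Matrix.one_mulVec]
  · obtain ⟨c, rfl⟩ := D.exists_expand φ w
    rw [isSolution_expand_iff D φ hg] at hw
    rw [← hw, Matrix.mulVec_mulVec, Matrix.nonsing_inv_mul _ hK, Matrix.one_mulVec]

/-- The Euclidean norm of the preconditioned residual is the weighted norm of the residual
function. -/
theorem euclNorm_residual (hα : pb.Coercive) {L K : Matrix (Fin N) (Fin N) ℝ}
    (hL : IsCholeskyFactor (D.matM φ) L) {P : Matrix (Fin N) (Fin N) ℝ} {F z ρ : Fin N → ℝ}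
    (hρ : (D.matM φ).mulVec ρ = F - K.mulVec ((P⁻¹ * L).mulVec z)) :
    euclNorm (L⁻¹.mulVec F - (L⁻¹ * K * P⁻¹ * L).mulVec z)
      = weightedNorm pb pb.Ω Set.univ pb.energies (D.expand φ ρ) := by
  -- The unpreconditioned residual is Mρ = LL^Tρ, so applying L⁻¹ leaves L^Tρ. The preconditioner P
  -- enters only through the coefficient vector P⁻¹Lz.
  have h1 : L⁻¹.mulVec F - (L⁻¹ * K * P⁻¹ * L).mulVec z = L.transpose.mulVec ρ := by
    have h2 : L⁻¹.mulVec ((D.matM φ).mulVec ρ) = L.transpose.mulVec ρ := by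
      rw [hL.2.2, Matrix.conjTranspose_eq_transpose_of_trivial, Matrix.mulVec_mulVec,
        ← Matrix.mul_assoc, Matrix.nonsing_inv_mul _ hL.isUnit_det, Matrix.one_mul]
    rw [← h2, hρ, Matrix.mulVec_sub, Matrix.mulVec_mulVec, Matrix.mulVec_mulVec]
    simp only [Matrix.mul_assoc]
  rw [h1]
  refine (sq_eq_sq₀ (euclNorm_nonneg _) (weightedNorm_nonneg _ _ _ _)).1 ?_
  -- Both squares equal ρ^T L L^T ρ = ρ^T M ρ.
  rw [euclNorm_sq, D.weightedNorm_domain_sq hα, mass_expand_self, hL.2.2,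
    Matrix.conjTranspose_eq_transpose_of_trivial, ← Matrix.mulVec_mulVec,
    Matrix.dotProduct_mulVec ρ L, Matrix.mulVec_transpose]

end Discretisation

end Boltzmann


/-! ### The residual estimate and the GMRES stopping criterion -/

theorem mainTheorem7 {d : ℕ} (hd : d = 2 ∨ d = 3)
    (pb : Boltzmann.Problem d) (hα : pb.Coercive)
    (D : Boltzmann.Discretisation pb) (hg : D.BoundaryDataIntegrable)
    {N : ℕ} (φ : Module.Basis (Fin N) ℝ D.feSpace)
    (P : Matrix (Fin N) (Fin N) ℝ) (hP : IsUnit P.det) :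
    -- the discrete problem is uniquely solvable and the mass matrix has a Cholesky factor
    (∃! u : D.feSpace, D.IsSolution u) ∧
    (∃ L, Boltzmann.IsCholeskyFactor (D.matM φ) L) ∧
    ∀ u : D.feSpace, D.IsSolution u →
    ∀ L, Boltzmann.IsCholeskyFactor (D.matM φ) L →
      -- for every vector the Euclidean residual is the estimator, which bounds the error
      (∀ z : Fin N → ℝ, ∃ r : D.feSpace,
        D.IsResidualFunction (D.expand φ ((P⁻¹ * L).mulVec z)) r ∧
        (∀ r', D.IsResidualFunction (D.expand φ ((P⁻¹ * L).mulVec z)) r' → r' = r) ∧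
        Boltzmann.euclNorm (L⁻¹.mulVec (D.vecF φ)
            - (L⁻¹ * (D.matA φ - D.matS φ) * P⁻¹ * L).mulVec z) = D.estimator r ∧
        D.estimator r = Boltzmann.Discretisation.weightedNorm pb pb.Ω Set.univ pb.energies r ∧
        D.dgNorm (u - D.expand φ ((P⁻¹ * L).mulVec z)) ≤ D.estimator r) ∧
      ∀ (TOL : ℝ) (z₀ : Fin N → ℝ),
        -- GMRES terminates
        (0 ≤ TOL → ∃ z, Boltzmann.IsGMRESOutput (L⁻¹ * (D.matA φ - D.matS φ) * P⁻¹ * L)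
          (L⁻¹.mulVec (D.vecF φ)) z₀ TOL z) ∧
        -- and whatever it returns satisfies the error bound
        ∀ z, Boltzmann.IsGMRESOutput (L⁻¹ * (D.matA φ - D.matS φ) * P⁻¹ * L)
            (L⁻¹.mulVec (D.vecF φ)) z₀ TOL z →
          D.dgNorm (u - D.expand φ ((P⁻¹ * L).mulVec z)) ≤ TOL := by
  have hM : IsUnit (D.matM φ).det := (D.posDef_matM φ hα).det_pos.ne'.isUnit
  refine ⟨D.existsUnique_isSolution hα hg φ,
    Boltzmann.exists_isCholeskyFactor (D.posDef_matM φ hα), fun u hu L hL => ?_⟩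
  have hres : ∀ z : Fin N → ℝ, ∃ r : D.feSpace,
      D.IsResidualFunction (D.expand φ ((P⁻¹ * L).mulVec z)) r ∧
      (∀ r', D.IsResidualFunction (D.expand φ ((P⁻¹ * L).mulVec z)) r' → r' = r) ∧
      Boltzmann.euclNorm (L⁻¹.mulVec (D.vecF φ)
          - (L⁻¹ * (D.matA φ - D.matS φ) * P⁻¹ * L).mulVec z) = D.estimator r ∧
      D.estimator r = Boltzmann.Discretisation.weightedNorm pb pb.Ω Set.univ pb.energies r ∧
      D.dgNorm (u - D.expand φ ((P⁻¹ * L).mulVec z)) ≤ D.estimator r := by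
    intro z
    -- The coefficients of the residual function, obtained by solving with the weighted mass matrix.
    set ρ : Fin N → ℝ := (D.matM φ)⁻¹.mulVec
      (D.vecF φ - (D.matA φ - D.matS φ).mulVec ((P⁻¹ * L).mulVec z)) with hρ
    have hMρ : (D.matM φ).mulVec ρ
        = D.vecF φ - (D.matA φ - D.matS φ).mulVec ((P⁻¹ * L).mulVec z) := by
      rw [hρ, Matrix.mulVec_mulVec, Matrix.mul_nonsing_inv _ hM, Matrix.one_mulVec]
    have hr := (D.isResidualFunction_expand_iff φ hg _ _).2 hMρ
    refine ⟨D.expand φ ρ, hr, fun r' hr' => ?_, ?_, D.estimator_eq hα _, ?_⟩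
    · obtain ⟨ρ', rfl⟩ := D.exists_expand φ r'
      rw [D.isResidualFunction_expand_iff φ hg] at hr'
      rw [hρ, ← hr', Matrix.mulVec_mulVec, Matrix.nonsing_inv_mul _ hM, Matrix.one_mulVec]
    · rw [D.estimator_eq hα]
      exact D.euclNorm_residual φ hα hL hMρ
    · rw [D.estimator_eq hα]
      exact D.dgNorm_sub_le hα hu hr
  refine ⟨hres, fun TOL z₀ => ⟨fun hTOL => ?_, fun z hz => ?_⟩⟩
  · refine Boltzmann.exists_isGMRESOutput ?_ _ _ hTOL
    rw [Matrix.det_mul, Matrix.det_mul, Matrix.det_mul]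
    exact (((L.isUnit_nonsing_inv_det hL.isUnit_det).mul (D.isUnit_det_scheme φ hα)).mul
      (P.isUnit_nonsing_inv_det hP)).mul hL.isUnit_det
  · obtain ⟨r, -, -, hnorm, -, hle⟩ := hres z
    -- Only the residual bound of the returned vector matters: the error bound holds for every
    -- vector, so neither minimality nor the stopping index enters.
    obtain ⟨n, -, htol, -⟩ := hz
    exact hle.trans (hnorm ▸ htol)
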